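/- **Setting.** For each index $m\in\mathbb N$ (suppressed below; all limits are as $m\to\infty$) there are $G$ clusters, cluster $g$ containing $n_g\ge 1$ units, $n=\sum_g n_g$, and $n_G$ denotes the size of the largest cluster. For units $(i,g)$, $$Y_{i,g}=W_{i,g}'\gamma+U_{i,g},\qquad X_{i,g}=W_{i,g}'\pi+V_{i,g},\qquad \mathbb E U_{i,g}=\mathbb E V_{i,g}=0,$$ where the $n\times d$ matrix $W$ is nonrandom with $W'W$ invertible. Let $A_0\neq0$ be a nonrandom $d\times d$ matrix and $\theta=\pi'A_0\gamma$. All of $G,n_g,d,W,A_0,\pi,\gamma$ and the laws of the errors may depend on $m$. Subscripts $g$ and $g,h$ denote subvectors and blocks belonging to clusters; $\|\cdot\|_{op}$ is the spectral norm, $\|\cdot\|_F$ the Frobenius norm, $\|\cdot\|_2$ the Euclidean norm. Put $$P=W(W'W)^{-1}W',\quad M=I_n-P,\quad A=W(W'W)^{-1}A_0(W'W)^{-1}W',\quad B=A-M\,\mathrm{Bdiag}(M_{g,g}^{-1}A_{g,g}),$$ where $\mathrm{Bdiag}$ is the block diagonal matrix with the given diagonal blocks. The leave-one-cluster-out estimator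 is $$\hat\theta_{LO}=\sum_{g}\hat\pi_{-g}'A_0(W'W)^{-1}W_g'Y_g,\qquad \hat\pi_{-g}=(W'W-W_g'W_g)^{-1}(W'X-W_g'X_g).$$ Let $\Pi=W\pi$, $\Gamma=W\gamma$, $r_n=\operatorname{rank}A$, $h_n=\|(W'W)^{-1/2}A_0(W'W)^{-1/2}\|_{op}$, and $$H=B'\Pi/h_n,\quad \tilde H=B\Gamma/h_n,\quad \kappa_n=\|B\|_F^2/h_n^2,\quad \lambda_n=\max_g\|P_{g,g}\|_{op},\quad \zeta_{H,n}=\max_g\|H_g\|_2^2,\quad \zeta_{\tilde H,n}=\max_g\|\tilde H_g\|_2^2,$$ $$\mu_n^2=\|H\|_2^2,\quad \tilde\mu_n^2=\|\tilde H\|_2^2,\quad \eta_n=\max\{1,\ \log^2(r_n)+\log^2(n)\lambda_n^2\}.$$ Let $\Omega_{U,g}=\mathbb E U_gU_g'$, $\Omega_{V,g}=\mathbb E V_gV_g'$, $\Omega_{U,V,g}=\mathbb E U_gV_g'$, and let $\Omega_g=\begin{pmatrix}\Omega_{U,g}&\Omega_{U,V,g}\\ \Omega_{U,V,g}'&\Omega_{V,g}\end{pmatrix}$.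 **Assumptions.** There are constants $c>0$, $C<\infty$, $q\ge2$, not depending on $m$, and a real sequence $u_n$ such that, for every $m$, 1. the pairs $(U_g,V_g)$, $1\le g\le G$, are independent across $g$; 2. $\min_g\lambda_{\min}(M_{g,g})\ge c$; 3. $\mathbb E|U_{i,g}|^{2q}+\mathbb E|V_{i,g}|^{2q}\le C$ for all $i,g$, and $c\le\min_g\lambda_{\min}(\Omega_g)\le\max_g\lambda_{\max}(\Omega_g)\le u_n$; 4. $\max_g\|\Pi_g\|_2^2+\max_g\|\Gamma_g\|_2^2\le C\,n_G$; and, as $m\to\infty$, $G\to\infty$ and $$u_n^3\eta_n(\mu_n^2+\tilde\mu_n^2)+u_n^{\frac{3q-4}{q-1}}n_G^{\frac q{q-1}}\lambda_n\kappa_n+u_n^4\eta_n\kappa_n+u_n^{\frac{2(q-2)}{q-1}}n_G^{\frac{2q}{q-1}}\lambda_n^2\kappa_n+u_n^{\frac{q-2}{q-1}}n_G^{\frac q{q-1}}\bigl(\zeta_{H,n}\mu_n^2+\zeta_{\tilde H,n}\tilde\mu_n^2+\kappa_n\bigr)=o\bigl((\mu_n^2+\tilde\mu_n^2+\kappa_n)^2\bigr).$$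 **Conclusion.** $(\hat\theta_{LO}-\theta)/\omega_n$ converges in distribution to $\mathcal N(0,1)$, where $\omega_n=\sqrt{\omega_n^2}$ with $$\omega_n^2=\sum_{g,h}\operatorname{tr}\bigl(\Omega_{V,g}B_{g,h}\Omega_{U,h}B_{g,h}'\bigr)+\sum_{g,h}\operatorname{tr}\bigl(\Omega_{U,V,g}B_{g,h}\Omega_{U,V,h}B_{h,g}\bigr)+h_n^2\Bigl(\sum_gH_g'\Omega_{U,g}H_g+\sum_g\tilde H_g'\Omega_{V,g}\tilde H_g+2\sum_gH_g'\Omega_{U,V,g}\tilde H_g\Bigr).$$ -/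

import Mathlib

open MeasureTheory ProbabilityTheory Filter
open scoped Matrix Topology

noncomputable section

/-- The nonrandom part of two linear regressions with clustered data: `G` clusters, cluster `g` with
`size g` units, a covariate matrix `W` whose rows are indexed by the units `(g, i)`, the known matrix
`A₀` of the quadratic form, and the coefficients `coefX` (written `π`) of the regression of `X` and
`coefY` (written `γ`) of the regression of `Y`. -/
structure ClusterDesign where
  /-- number of clusters -/
  G : ℕ
  /-- cluster sizes -/
  size : Fin G → ℕ
  /-- number of covariates -/
  d : ℕ
  /-- covariates -/
  W : Matrix (Σ g : Fin G, Fin (size g)) (Fin d) ℝ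
  /-- matrix of the quadratic form -/
  A₀ : Matrix (Fin d) (Fin d) ℝ
  /-- the coefficient vector `π` -/
  coefX : Fin d → ℝ
  /-- the coefficient vector `γ` -/
  coefY : Fin d → ℝ

namespace ClusterDesign

/-- The spectral norm of a rectangular real matrix, i.e. the square root of the largest eigenvalue of
`Qᵀ Q`. -/
def opNorm {m n : Type*} [Fintype m] [Fintype n] [DecidableEq n] (Q : Matrix m n ℝ) : ℝ :=
  ‖LinearMap.toContinuousLinearMap (Matrix.toEuclideanLin Q)‖

open scoped MatrixOrder in
/-- `S^{-1/2}`: the positive semidefinite square root of the inverse of `S`. -/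
def invSqrt {n : Type*} [Fintype n] [DecidableEq n] (S : Matrix n n ℝ) : Matrix n n ℝ :=
  CFC.sqrt S⁻¹

/-- The matrix of second moments `E[S Tᵀ]` of two random vectors. -/
def crossMoment {Ω ι κ : Type*} [MeasurableSpace Ω] (P : Measure Ω) (S : Ω → ι → ℝ) (T : Ω → κ → ℝ) :
    Matrix ι κ ℝ :=
  Matrix.of fun i j => ∫ ω, S ω i * T ω j ∂P

variable (D : ClusterDesign)

/-- The units, i.e. pairs (cluster, unit within the cluster). -/
abbrev Obs : Type := Σ g : Fin D.G, Fin (D.size g)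

/-- Total sample size `n`. -/
def n : ℕ := ∑ g, D.size g

/-- Size of the largest cluster (written `n_G`). -/
def nMax : ℕ := Finset.univ.sup D.size

variable {D}

/-- The `(g, h)` block of an `n × n` matrix. -/
def block (Q : Matrix D.Obs D.Obs ℝ) (g h : Fin D.G) :
    Matrix (Fin (D.size g)) (Fin (D.size h)) ℝ :=
  Q.submatrix (fun i => ⟨g, i⟩) (fun j => ⟨h, j⟩)

/-- The subvector of an `n`-vector that belongs to cluster `g`. -/
def seg (v : D.Obs → ℝ) (g : Fin D.G) : Fin (D.size g) → ℝ := fun i => v ⟨g, i⟩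

variable (D)

/-- The rows of `W` that belong to cluster `g`. -/
def Wc (g : Fin D.G) : Matrix (Fin (D.size g)) (Fin D.d) ℝ := D.W.submatrix (fun i => ⟨g, i⟩) id

/-- `W'W`. -/
def gram : Matrix (Fin D.d) (Fin D.d) ℝ := D.Wᵀ * D.W

/-- Projection matrix `P = W (W'W)⁻¹ W'`. -/
def proj : Matrix D.Obs D.Obs ℝ := D.W * D.gram⁻¹ * D.Wᵀ

/-- Annihilator matrix `M = I - P`. -/
def annih : Matrix D.Obs D.Obs ℝ := 1 - D.proj

/-- `A = W (W'W)⁻¹ A₀ (W'W)⁻¹ W'`. -/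
def A : Matrix D.Obs D.Obs ℝ := D.W * D.gram⁻¹ * D.A₀ * D.gram⁻¹ * D.Wᵀ

/-- The block diagonal matrix with diagonal blocks `M_{g,g}⁻¹ A_{g,g}`. -/
def corr : Matrix D.Obs D.Obs ℝ :=
  Matrix.blockDiagonal' fun g => (block D.annih g g)⁻¹ * block D.A g g

/-- `B = A - M Bdiag(M_{g,g}⁻¹ A_{g,g})`. -/
def B : Matrix D.Obs D.Obs ℝ := D.A - D.annih * D.corr

/-- The estimand `θ = π' A₀ γ`. -/
def theta : ℝ := D.coefX ⬝ᵥ D.A₀ *ᵥ D.coefY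

/-- The least squares estimator of `π` that leaves out cluster `g`,
`(W'W - W_g'W_g)⁻¹ (W'X - W_g'X_g)`. -/
def piHatLO (X : D.Obs → ℝ) (g : Fin D.G) : Fin D.d → ℝ :=
  (D.gram - (D.Wc g)ᵀ * D.Wc g)⁻¹ *ᵥ (D.Wᵀ *ᵥ X - (D.Wc g)ᵀ *ᵥ seg X g)

/-- The leave-one-cluster-out estimator `∑_g π̂_{-g}' A₀ (W'W)⁻¹ W_g' Y_g`. -/
def thetaLO (X Y : D.Obs → ℝ) : ℝ :=
  ∑ g, D.piHatLO X g ⬝ᵥ D.A₀ *ᵥ D.gram⁻¹ *ᵥ (D.Wc g)ᵀ *ᵥ seg Y g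

/-- The signal `Π = W π`. -/
def sigX : D.Obs → ℝ := D.W *ᵥ D.coefX

/-- The signal `Γ = W γ`. -/
def sigY : D.Obs → ℝ := D.W *ᵥ D.coefY

/-- `h_n`, the operator norm of `(W'W)^{-1/2} A₀ (W'W)^{-1/2}`. -/
def hNorm : ℝ := opNorm (invSqrt D.gram * D.A₀ * invSqrt D.gram)

/-- `H = B'Π / h_n`. -/
def H : D.Obs → ℝ := D.hNorm⁻¹ • D.Bᵀ *ᵥ D.sigX

/-- `H̃ = BΓ / h_n`. -/
def Ht : D.Obs → ℝ := D.hNorm⁻¹ • D.B *ᵥ D.sigY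

/-- `κ_n = ‖B‖_F² / h_n²`. -/
def kappa : ℝ := (D.Bᵀ * D.B).trace / D.hNorm ^ 2

/-- `λ_n = max_g ‖P_{g,g}‖_op`. -/
def lam : ℝ := ⨆ g : Fin D.G, opNorm (block D.proj g g)

/-- `max_g ‖v_g‖₂²`. -/
def maxSegSq {D : ClusterDesign} (v : D.Obs → ℝ) : ℝ := ⨆ g : Fin D.G, seg v g ⬝ᵥ seg v g

/-- `ζ_{H,n}`. -/
def zetaH : ℝ := maxSegSq D.H

/-- `ζ_{H̃,n}`. -/
def zetaHt : ℝ := maxSegSq D.Ht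

/-- `μ_n² = ‖H‖₂²`. -/
def muSq : ℝ := D.H ⬝ᵥ D.H

/-- `μ̃_n² = ‖H̃‖₂²`. -/
def mutSq : ℝ := D.Ht ⬝ᵥ D.Ht

/-- `η_n = max {1, log² (rank A) + log² (n) λ_n²}`. -/
def eta : ℝ := max 1 (Real.log D.A.rank ^ 2 + Real.log D.n ^ 2 * D.lam ^ 2)

/-- The left-hand side of the rate condition. -/
def rateLHS (q u : ℝ) : ℝ :=
  u ^ 3 * D.eta * (D.muSq + D.mutSq)
    + u ^ ((3 * q - 4) / (q - 1)) * (D.nMax : ℝ) ^ (q / (q - 1)) * D.lam * D.kappa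
    + u ^ 4 * D.eta * D.kappa
    + u ^ (2 * (q - 2) / (q - 1)) * (D.nMax : ℝ) ^ (2 * q / (q - 1)) * D.lam ^ 2 * D.kappa
    + u ^ ((q - 2) / (q - 1)) * (D.nMax : ℝ) ^ (q / (q - 1))
        * (D.zetaH * D.muSq + D.zetaHt * D.mutSq + D.kappa)

variable {D} {Ω : Type*} [MeasurableSpace Ω]

/-- `E[S_g T_g']` for `n`-vectors `S`, `T` of errors: the matrices `Ω_{U,g}`, `Ω_{V,g}`, `Ω_{U,V,g}`. -/
def covBlock (P : Measure Ω) (S T : Ω → D.Obs → ℝ) (g : Fin D.G) :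
    Matrix (Fin (D.size g)) (Fin (D.size g)) ℝ :=
  crossMoment P (fun ω => seg (S ω) g) (fun ω => seg (T ω) g)

/-- The second moment matrix `Ω_g` of the stacked error vector `(U_g, V_g)`. -/
def covFull (P : Measure Ω) (U V : Ω → D.Obs → ℝ) (g : Fin D.G) :
    Matrix (Fin (D.size g) ⊕ Fin (D.size g)) (Fin (D.size g) ⊕ Fin (D.size g)) ℝ :=
  Matrix.fromBlocks (covBlock P U U g) (covBlock P U V g) (covBlock P U V g)ᵀ (covBlock P V V g)

/-- `ω_n²`. The vectors `H`, `H̃` are normalized by `h_n` and `B` is not, whence the factor `h_n²` in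
front of the linear part. -/
def omegaSq (P : Measure Ω) (U V : Ω → D.Obs → ℝ) : ℝ :=
  (∑ g, ∑ h, (covBlock P V V g * block D.B g h * covBlock P U U h * (block D.B g h)ᵀ).trace)
    + (∑ g, ∑ h, (covBlock P U V g * block D.B g h * covBlock P U V h * block D.B h g).trace)
    + D.hNorm ^ 2 *
      ((∑ g, seg D.H g ⬝ᵥ covBlock P U U g *ᵥ seg D.H g)
        + (∑ g, seg D.Ht g ⬝ᵥ covBlock P V V g *ᵥ seg D.Ht g)
        + 2 * ∑ g, seg D.H g ⬝ᵥ covBlock P U V g *ᵥ seg D.Ht g)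

end ClusterDesign

end

open MeasureTheory ProbabilityTheory Filter
open scoped Matrix Topology

set_option linter.unusedSectionVars false

/-! ### Splitting vectors by cluster; linear plus hollow quadratic statistics. -/

section Clusters

variable {J ι : Type} [Fintype J] [DecidableEq ι]

/-! The correction in `B` is designed so that the diagonal blocks of `B` vanish (`block_B_self`),
while `W'BW = A₀` still holds because `M` annihilates `W` (`W_transpose_mul_B_mul_W`). Woodbury's
identity shows that the estimator is exactly `X'BY` (`thetaLO_eq`), so its error is `V'BU + h U'H +
h V'H̃` (`thetaLO_sub_theta`). For the stacked noise `ε = (U, V)` this is `T = b'ε + ½ ε'Kε` with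
`K` symmetric and free of within-cluster entries (`linQuad_stack`), and the theorem becomes a
central limit theorem for such statistics.

That theorem is proved by Stein's method on characteristic functions. Let `S` be the covariance
matrix of `ε`. Then `T = ∑ a_g` with `a_g = ε_g'(b + ½Kε)`, and deleting cluster `g` lowers `T` by
`d_g = ε_g'(b + Kε)`. As `K` is hollow, the coefficients of `ε_g` in both depend on the other
clusters only. Expand `exp(itT)` in `d_g` around the statistic without cluster `g`: the leading term
integrates to zero against `a_g`, the next one yields the covariance of `a_g` and `d_g` given the
other clusters (`norm_integral_clusterPart_mul_exp_sub_le`). These covariances add up to the Stein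
kernel `(b + ½Kε)'S(b + Kε)`, called `steinVar`, whose mean is `ω²`. After scaling to `ω = 1`, if `∑
E d_g⁴` and the variance of the kernel are small, the characteristic function almost solves `ψ' =
-tψ` and is close to `exp(-t²/2)` (`norm_integral_exp_linQuad_sub_le`).

It remains to bound these two quantities (`integral_steinVar_sub_sq_le`, `sum_integral_pow_four_le`)
relative to `ω⁴`. The bounds involve the largest eigenvalue of `S`; a number `φ` with `E
(y'ε_g)²|ε_g|² ≤ φ|y|²`, obtained by interpolating between second moments and moments of order `2q`
(`integral_sq_mul_le_of_rpow`); and the squared norms of `K` as an operator, on one cluster, and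
from cluster to cluster. The last three are of order `h²`, `h²λ`, `h²λ²` (`BlockBound`), because a
vector supported on one cluster gains a factor `λ` in the quadratic form of `P`. Since `ω²` is at
least a constant times `h²(μ² + μ̃² + κ)` (`le_integral_steinVar`), both ratios are controlled by
the rate condition (`approx_terms_le`). -/

/-- The vector `x` with all coordinates outside cluster `g` set to zero. -/
def clusterPart (cl : J → ι) (g : ι) (x : J → ℝ) : J → ℝ := fun j => if cl j = g then x j else 0

/-- The vector `x` with all coordinates in cluster `g` set to zero. -/
def clusterRest (cl : J → ι) (g : ι) (x : J → ℝ) : J → ℝ := fun j => if cl j = g then 0 else x j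

variable (cl : J → ι)

lemma clusterPart_add_clusterRest (g : ι) (x : J → ℝ) :
    clusterPart cl g x + clusterRest cl g x = x := by
  ext j
  simp only [clusterPart, clusterRest, Pi.add_apply]
  split_ifs <;> simp

lemma sum_clusterPart [Fintype ι] (x : J → ℝ) : ∑ g, clusterPart cl g x = x := by
  ext j
  simp [clusterPart, Finset.sum_apply]

lemma clusterPart_dotProduct_comm (g : ι) (x y : J → ℝ) :
    clusterPart cl g x ⬝ᵥ y = x ⬝ᵥ clusterPart cl g y := by
  simp only [dotProduct, clusterPart, ite_mul, mul_ite, zero_mul, mul_zero]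

@[simp]
lemma clusterPart_clusterPart (g : ι) (x : J → ℝ) :
    clusterPart cl g (clusterPart cl g x) = clusterPart cl g x := by
  ext j
  simp only [clusterPart]
  split_ifs <;> rfl

lemma clusterPart_dotProduct_clusterPart (g : ι) (x y : J → ℝ) :
    clusterPart cl g x ⬝ᵥ clusterPart cl g y = x ⬝ᵥ clusterPart cl g y := by
  rw [clusterPart_dotProduct_comm, clusterPart_clusterPart]

lemma sum_dotProduct_clusterPart [Fintype ι] (x y : J → ℝ) :
    ∑ g, x ⬝ᵥ clusterPart cl g y = x ⬝ᵥ y := by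
  rw [← dotProduct_sum, sum_clusterPart]

lemma clusterPart_add (g : ι) (x y : J → ℝ) :
    clusterPart cl g (x + y) = clusterPart cl g x + clusterPart cl g y := by
  ext j
  simp only [clusterPart, Pi.add_apply]
  split_ifs <;> simp

lemma clusterPart_smul (g : ι) (a : ℝ) (x : J → ℝ) :
    clusterPart cl g (a • x) = a • clusterPart cl g x := by
  ext j
  simp [clusterPart]

@[fun_prop]
lemma measurable_clusterPart (g : ι) : Measurable (clusterPart cl g) := by
  refine measurable_pi_lambda _ fun j => ?_
  simp only [clusterPart]
  split_ifs <;> fun_prop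

@[fun_prop]
lemma measurable_clusterRest (g : ι) : Measurable (clusterRest cl g) := by
  refine measurable_pi_lambda _ fun j => ?_
  simp only [clusterRest]
  split_ifs <;> fun_prop

/-- A matrix that vanishes on pairs of indices from the same cluster. -/
def IsHollow (K : Matrix J J ℝ) : Prop := ∀ i j, cl i = cl j → K i j = 0

variable {cl}

lemma IsHollow.clusterPart_mulVec_clusterPart {K : Matrix J J ℝ} (hK : IsHollow cl K) (g : ι)
    (x : J → ℝ) : clusterPart cl g (K *ᵥ clusterPart cl g x) = 0 := by
  ext j
  simp only [clusterPart, Pi.zero_apply, Matrix.mulVec, dotProduct]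
  split_ifs with hj
  · refine Finset.sum_eq_zero fun k _ => ?_
    split_ifs with hk
    · rw [hK j k (hj.trans hk.symm), zero_mul]
    · rw [mul_zero]
  · rfl

/-- The coefficient of `x_g` in a hollow form sees only the other clusters. This lets every identity
below pass between `Kx` and `K` applied to `x` without cluster `g`, which is independent of that
cluster. -/
lemma IsHollow.clusterPart_mulVec_clusterRest {K : Matrix J J ℝ} (hK : IsHollow cl K) (g : ι)
    (x : J → ℝ) : clusterPart cl g (K *ᵥ clusterRest cl g x) = clusterPart cl g (K *ᵥ x) := by
  conv_rhs => rw [← clusterPart_add_clusterRest cl g x, Matrix.mulVec_add, clusterPart_add,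
    hK.clusterPart_mulVec_clusterPart, zero_add]

/-- The statistic with linear part `b` and quadratic part `K`. -/
noncomputable def linQuad (b : J → ℝ) (K : Matrix J J ℝ) (x : J → ℝ) : ℝ :=
  x ⬝ᵥ (b + (1 / 2 : ℝ) • K *ᵥ x)

lemma IsHollow.clusterPart_dotProduct_affine {K : Matrix J J ℝ} (hK : IsHollow cl K) (g : ι)
    (b x : J → ℝ) (a : ℝ) :
    clusterPart cl g x ⬝ᵥ (b + a • K *ᵥ clusterRest cl g x)
      = clusterPart cl g x ⬝ᵥ (b + a • K *ᵥ x) := by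
  rw [clusterPart_dotProduct_comm, clusterPart_dotProduct_comm, clusterPart_add, clusterPart_add,
    clusterPart_smul, clusterPart_smul, hK.clusterPart_mulVec_clusterRest]

lemma dotProduct_mulVec_comm_of_isSymm {K : Matrix J J ℝ} (hs : K.IsSymm) (x y : J → ℝ) :
    x ⬝ᵥ K *ᵥ y = y ⬝ᵥ K *ᵥ x := by
  rw [Matrix.dotProduct_mulVec, ← Matrix.mulVec_transpose, hs.eq, dotProduct_comm]

/-- By symmetry the cross term between cluster `g` and the rest occurs twice, which cancels the `½`.
Hence the increment carries `K` with coefficient 1, whereas the additive share of the cluster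
carries it with coefficient `½`. -/
lemma linQuad_eq_rest_add {K : Matrix J J ℝ} (hK : IsHollow cl K) (hs : K.IsSymm) (b x : J → ℝ)
    (g : ι) : linQuad b K x = linQuad b K (clusterRest cl g x)
      + clusterPart cl g x ⬝ᵥ (b + K *ᵥ clusterRest cl g x) := by
  have h0 : clusterPart cl g x ⬝ᵥ K *ᵥ clusterPart cl g x = 0 := by
    rw [← clusterPart_clusterPart, clusterPart_dotProduct_comm,
      clusterPart_clusterPart, hK.clusterPart_mulVec_clusterPart, dotProduct_zero]
  have h1 := dotProduct_mulVec_comm_of_isSymm hs (clusterRest cl g x) (clusterPart cl g x)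
  conv_lhs => rw [← clusterPart_add_clusterRest cl g x]
  simp only [linQuad, dotProduct_add, add_dotProduct, Matrix.mulVec_add, dotProduct_smul,
    smul_eq_mul, h0, h1]
  ring

lemma sum_clusterPart_dotProduct_rest [Fintype ι] {K : Matrix J J ℝ} (hK : IsHollow cl K)
    (b x : J → ℝ) :
    ∑ g, clusterPart cl g x ⬝ᵥ (b + (1 / 2 : ℝ) • K *ᵥ clusterRest cl g x) = linQuad b K x := by
  simp only [hK.clusterPart_dotProduct_affine]
  rw [← sum_dotProduct, sum_clusterPart, linQuad]

end Clusters

/-! ### Noise with independent clusters: integrating out one cluster given the others. -/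

section Moments

variable {J ι : Type} [Fintype J] [DecidableEq ι] {Ω : Type*} [MeasurableSpace Ω]

/-- Centered random vectors with finite fourth moments whose cluster subvectors are independent. -/
structure ClusterNoise (P : Measure Ω) (cl : J → ι) (ε : Ω → J → ℝ) : Prop where
  measurable : Measurable ε
  memLp : ∀ j, MemLp (fun ω => ε ω j) 4 P
  mean : ∀ j, ∫ ω, ε ω j ∂P = 0
  indep : iIndepFun (fun g ω => clusterPart cl g (ε ω)) P

namespace ClusterNoise

variable {P : Measure Ω} [IsProbabilityMeasure P] {cl : J → ι} {ε : Ω → J → ℝ}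

open ClusterDesign (crossMoment)

lemma memLp_dotProduct (h : ClusterNoise P cl ε) (y : J → ℝ) : MemLp (fun ω => y ⬝ᵥ ε ω) 4 P := by
  simp only [dotProduct]
  exact memLp_finsetSum _ fun j _ => (h.memLp j).const_mul _

lemma memLp_two (h : ClusterNoise P cl ε) (j : J) : MemLp (fun ω => ε ω j) 2 P :=
  (h.memLp j).mono_exponent (by norm_num)

lemma integrable_coord_mul (h : ClusterNoise P cl ε)
    (j k : J) : Integrable (fun ω => ε ω j * ε ω k) P :=
  (h.memLp_two j).integrable_mul (h.memLp_two k)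

lemma integral_dotProduct_mul (h : ClusterNoise P cl ε) (y z : J → ℝ) :
    ∫ ω, (y ⬝ᵥ ε ω) * (z ⬝ᵥ ε ω) ∂P = y ⬝ᵥ crossMoment P ε ε *ᵥ z := by
  simp only [dotProduct, Finset.sum_mul_sum, Matrix.mulVec, crossMoment, Matrix.of_apply]
  rw [integral_finsetSum]
  · refine Finset.sum_congr rfl fun i _ => ?_
    rw [integral_finsetSum, Finset.mul_sum]
    · refine Finset.sum_congr rfl fun j _ => ?_
      rw [mul_comm (∫ ω, _ ∂P), ← mul_assoc, ← integral_const_mul]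
      exact integral_congr_ae (.of_forall fun ω => by simp only []; ring)
    · intro j _
      exact ((h.integrable_coord_mul i j).const_mul (y i * z j)).congr
        (.of_forall fun ω => by simp only []; ring)
  · intro i _
    refine integrable_finsetSum _ fun j _ => ?_
    exact ((h.integrable_coord_mul i j).const_mul (y i * z j)).congr
        (.of_forall fun ω => by simp only []; ring)

/-- The rest is the sum of the parts in the other clusters, hence a function of variables that are
jointly independent of cluster `g`. -/
lemma indepFun_rest (h : ClusterNoise P cl ε) [Fintype ι] (g : ι) :
    IndepFun (fun ω => clusterPart cl g (ε ω)) (fun ω => clusterRest cl g (ε ω)) P := by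
  have h1 := h.indep.indepFun_finset {g} (Finset.univ.erase g) (by simp)
    (fun i => (measurable_clusterPart cl i).comp h.measurable)
  have m1 : Measurable fun x : {i // i ∈ ({g} : Finset ι)} → J → ℝ => x ⟨g, by simp⟩ :=
    measurable_pi_apply (⟨g, by simp⟩ : {i // i ∈ ({g} : Finset ι)})
  have m2 : Measurable fun x : {i // i ∈ Finset.univ.erase g} → J → ℝ => ∑ i, x i :=
    Finset.measurable_sum _ fun i _ => measurable_pi_apply i
  have h2 := h1.comp m1 m2
  have e : (fun ω => clusterRest cl g (ε ω))
      = (fun x : {i // i ∈ Finset.univ.erase g} → J → ℝ => ∑ i, x i)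
        ∘ fun ω i => clusterPart cl (i : ι) (ε ω) := by
    funext ω
    ext j
    simp only [Function.comp_apply, clusterRest, Finset.sum_apply]
    rw [Finset.sum_coe_sort (Finset.univ.erase g) (fun i => clusterPart cl i (ε ω) j)]
    simp only [clusterPart, Finset.sum_ite_eq, Finset.mem_erase, Finset.mem_univ, and_true]
    by_cases hj : cl j = g <;> simp [hj]
  rw [e]
  exact h2

lemma indepFun_coord_rest (h : ClusterNoise P cl ε)
    [Fintype ι] {g : ι} {j k : J} (hj : cl j = g) (hk : cl k = g) :
    IndepFun (fun ω => (ε ω j, ε ω k)) (fun ω => clusterRest cl g (ε ω)) P := by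
  have := (h.indepFun_rest g).comp (φ := fun x => (x j, x k)) (ψ := id) (by fun_prop) (by fun_prop)
  simpa only [Function.comp_def, clusterPart, hj, hk, if_true, id] using this

variable {𝕜 : Type*} [RCLike 𝕜]

lemma integral_coord_mul_rest (h : ClusterNoise P cl ε)
    [Fintype ι] {g : ι} {j : J} (hj : cl j = g) {f : (J → ℝ) → 𝕜}
    (hf : Measurable f) : ∫ ω, (ε ω j : 𝕜) * f (clusterRest cl g (ε ω)) ∂P = 0 := by
  have := (h.indepFun_coord_rest hj hj).integral_fun_comp_mul_comp (f := fun x => (x.1 : 𝕜)) (g := f)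
    (by have := h.measurable; fun_prop) (by have := h.measurable; fun_prop)
    (by fun_prop) hf.aestronglyMeasurable
  rw [this, integral_ofReal, h.mean, RCLike.ofReal_zero, zero_mul]

lemma integral_coord_mul_coord_mul_rest (h : ClusterNoise P cl ε)
    [Fintype ι] {g : ι} {j k : J} (hj : cl j = g) (hk : cl k = g)
    {f : (J → ℝ) → 𝕜} (hf : Measurable f) :
    ∫ ω, ((ε ω j * ε ω k : ℝ) : 𝕜) * f (clusterRest cl g (ε ω)) ∂P
      = (crossMoment P ε ε j k : 𝕜) * ∫ ω, f (clusterRest cl g (ε ω)) ∂P := by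
  have := (h.indepFun_coord_rest hj hk).integral_fun_comp_mul_comp
    (f := fun x : ℝ × ℝ => ((x.1 * x.2 : ℝ) : 𝕜)) (g := f)
    (by have := h.measurable; fun_prop) (by have := h.measurable; fun_prop)
    (by fun_prop) hf.aestronglyMeasurable
  rw [this, integral_ofReal]
  rfl

lemma integrable_coord_mul_coord_mul_rest (h : ClusterNoise P cl ε)
    [Fintype ι] {g : ι} {j k : J} (hj : cl j = g)
    (hk : cl k = g) {f : (J → ℝ) → 𝕜} (hf : Measurable f)
    (hi : Integrable (fun ω => f (clusterRest cl g (ε ω))) P) :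
    Integrable (fun ω => ((ε ω j * ε ω k : ℝ) : 𝕜) * f (clusterRest cl g (ε ω))) P :=
  ((h.indepFun_coord_rest hj hk).comp (φ := fun x : ℝ × ℝ => ((x.1 * x.2 : ℝ) : 𝕜)) (ψ := f)
    (by fun_prop) hf).integrable_mul (h.integrable_coord_mul j k).ofReal hi

lemma integrable_coord_mul_rest (h : ClusterNoise P cl ε)
    [Fintype ι] {g : ι} {j : J} (hj : cl j = g) {f : (J → ℝ) → 𝕜}
    (hf : Measurable f) (hi : Integrable (fun ω => f (clusterRest cl g (ε ω))) P) :
    Integrable (fun ω => (ε ω j : 𝕜) * f (clusterRest cl g (ε ω))) P :=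
  ((h.indepFun_coord_rest hj hj).comp (φ := fun x : ℝ × ℝ => ((x.1 : ℝ) : 𝕜)) (ψ := f)
    (by fun_prop) hf).integrable_mul ((h.memLp_two j).integrable (by norm_num)).ofReal hi

lemma crossMoment_eq_zero (h : ClusterNoise P cl ε)
    [Fintype ι] {j k : J} (hjk : cl j ≠ cl k) : crossMoment P ε ε j k = 0 := by
  have := h.integral_coord_mul_rest (𝕜 := ℝ) (g := cl j) rfl (f := fun x => x k) (by fun_prop)
  simpa [crossMoment, clusterRest, hjk.symm] using this

lemma crossMoment_isSymm (P : Measure Ω) (ε : Ω → J → ℝ) : (crossMoment P ε ε).IsSymm := by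
  ext i j
  simp [crossMoment, mul_comm]

end ClusterNoise

end Moments

namespace ClusterNoise

open ClusterDesign (crossMoment)

variable {J ι : Type} [Fintype J] [DecidableEq ι] [Fintype ι] {Ω : Type*} [MeasurableSpace Ω]
  {P : Measure Ω} [IsProbabilityMeasure P] {cl : J → ι} {ε : Ω → J → ℝ} {𝕜 : Type*} [RCLike 𝕜]

/-- The conditional mean of `ε_g` given the other clusters is zero, expressed through test functions
`f` of the rest instead of conditional expectations. -/
lemma integral_clusterPart_dotProduct_mul (h : ClusterNoise P cl ε) (g : ι)
    {A : (J → ℝ) → J → ℝ} {f : (J → ℝ) → 𝕜} (hA : Measurable A) (hf : Measurable f)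
    (hi : ∀ j, Integrable
      (fun ω => (A (clusterRest cl g (ε ω)) j : 𝕜) * f (clusterRest cl g (ε ω))) P) :
    ∫ ω, ((clusterPart cl g (ε ω) ⬝ᵥ A (clusterRest cl g (ε ω)) : ℝ) : 𝕜)
      * f (clusterRest cl g (ε ω)) ∂P = 0 := by
  have hAj : ∀ j, Measurable fun x => (A x j : 𝕜) * f x := fun j => by
    have := (measurable_pi_apply j).comp hA
    exact (RCLike.measurable_ofReal.comp this).mul hf
  have key : ∀ j, Integrable (fun ω => ((clusterPart cl g (ε ω) j : ℝ) : 𝕜)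
        * ((A (clusterRest cl g (ε ω)) j : 𝕜) * f (clusterRest cl g (ε ω)))) P ∧
      ∫ ω, ((clusterPart cl g (ε ω) j : ℝ) : 𝕜)
        * ((A (clusterRest cl g (ε ω)) j : 𝕜) * f (clusterRest cl g (ε ω))) ∂P = 0 := by
    intro j
    by_cases hj : cl j = g
    · simp only [clusterPart, if_pos hj]
      exact ⟨h.integrable_coord_mul_rest hj (hAj j) (hi j), h.integral_coord_mul_rest hj (hAj j)⟩
    · simp [clusterPart, hj]
  simp only [dotProduct, RCLike.ofReal_sum, RCLike.ofReal_mul, Finset.sum_mul, mul_assoc]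
  rw [integral_finsetSum _ fun j _ => (key j).1]
  exact Finset.sum_eq_zero fun j _ => (key j).2

/-- Given the other clusters, `ε_g ε_g'` may be replaced by its expectation. The restriction of the
covariance matrix to cluster `g` is imposed by cutting both vectors to that cluster. -/
lemma integral_clusterPart_dotProduct_mul_mul (h : ClusterNoise P cl ε) (g : ι)
    {A D : (J → ℝ) → J → ℝ} {f : (J → ℝ) → 𝕜} (hA : Measurable A) (hD : Measurable D)
    (hf : Measurable f)
    (hi : ∀ j k, Integrable
      (fun ω => ((A (clusterRest cl g (ε ω)) j * D (clusterRest cl g (ε ω)) k : ℝ) : 𝕜)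
        * f (clusterRest cl g (ε ω))) P) :
    ∫ ω, (((clusterPart cl g (ε ω) ⬝ᵥ A (clusterRest cl g (ε ω)))
        * (clusterPart cl g (ε ω) ⬝ᵥ D (clusterRest cl g (ε ω))) : ℝ) : 𝕜)
        * f (clusterRest cl g (ε ω)) ∂P
      = ∫ ω, ((clusterPart cl g (A (clusterRest cl g (ε ω)))
        ⬝ᵥ crossMoment P ε ε *ᵥ clusterPart cl g (D (clusterRest cl g (ε ω))) : ℝ) : 𝕜)
        * f (clusterRest cl g (ε ω)) ∂P := by
  set r : Ω → J → ℝ := fun ω => clusterRest cl g (ε ω) with hr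
  have hAj : ∀ j k, Measurable fun x => ((A x j * D x k : ℝ) : 𝕜) * f x := fun j k => by
    have h1 := (measurable_pi_apply j).comp hA
    have h2 := (measurable_pi_apply k).comp hD
    exact (RCLike.measurable_ofReal.comp (h1.mul h2)).mul hf
  have key : ∀ j k, Integrable (fun ω => ((clusterPart cl g (ε ω) j * clusterPart cl g (ε ω) k : ℝ) : 𝕜)
        * (((A (r ω) j * D (r ω) k : ℝ) : 𝕜) * f (r ω))) P ∧
      Integrable (fun ω => ((clusterPart cl g (A (r ω)) j * (crossMoment P ε ε j k
        * clusterPart cl g (D (r ω)) k) : ℝ) : 𝕜) * f (r ω)) P ∧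
      ∫ ω, ((clusterPart cl g (ε ω) j * clusterPart cl g (ε ω) k : ℝ) : 𝕜)
        * (((A (r ω) j * D (r ω) k : ℝ) : 𝕜) * f (r ω)) ∂P
        = ∫ ω, ((clusterPart cl g (A (r ω)) j * (crossMoment P ε ε j k
        * clusterPart cl g (D (r ω)) k) : ℝ) : 𝕜) * f (r ω) ∂P := by
    intro j k
    by_cases hj : cl j = g
    · by_cases hk : cl k = g
      · have e : ∀ ω, ((A (r ω) j * (crossMoment P ε ε j k * D (r ω) k) : ℝ) : 𝕜) * f (r ω)
            = (crossMoment P ε ε j k : 𝕜) * (((A (r ω) j * D (r ω) k : ℝ) : 𝕜) * f (r ω)) := by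
          intro ω
          push_cast
          ring
        simp only [clusterPart, if_pos hj, if_pos hk, e]
        refine ⟨h.integrable_coord_mul_coord_mul_rest hj hk (hAj j k) (hi j k),
          (hi j k).const_mul _, ?_⟩
        rw [integral_const_mul]
        exact h.integral_coord_mul_coord_mul_rest hj hk (hAj j k)
      · simp [clusterPart, hk]
    · simp [clusterPart, hj]
  calc _ = ∫ ω, ∑ j, ∑ k, ((clusterPart cl g (ε ω) j * clusterPart cl g (ε ω) k : ℝ) : 𝕜)
        * (((A (r ω) j * D (r ω) k : ℝ) : 𝕜) * f (r ω)) ∂P := by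
        refine integral_congr_ae (.of_forall fun ω => ?_)
        simp only [dotProduct, Finset.sum_mul_sum]
        push_cast
        rw [Finset.sum_mul]
        refine Finset.sum_congr rfl fun j _ => ?_
        rw [Finset.sum_mul]
        refine Finset.sum_congr rfl fun k _ => ?_
        ring
    _ = ∫ ω, ∑ j, ∑ k, ((clusterPart cl g (A (r ω)) j * (crossMoment P ε ε j k
        * clusterPart cl g (D (r ω)) k) : ℝ) : 𝕜) * f (r ω) ∂P := by
        rw [integral_finsetSum _ fun j _ => integrable_finsetSum _ fun k _ => (key j k).1,
          integral_finsetSum _ fun j _ => integrable_finsetSum _ fun k _ => (key j k).2.1]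
        refine Finset.sum_congr rfl fun j _ => ?_
        rw [integral_finsetSum _ fun k _ => (key j k).1,
          integral_finsetSum _ fun k _ => (key j k).2.1]
        exact Finset.sum_congr rfl fun k _ => (key j k).2.2
    _ = _ := by
        refine integral_congr_ae (.of_forall fun ω => ?_)
        simp only [dotProduct, Matrix.mulVec, Finset.mul_sum]
        push_cast
        rw [Finset.sum_mul]
        refine Finset.sum_congr rfl fun j _ => ?_
        rw [Finset.sum_mul]

end ClusterNoise

/-! ### Integrability of products and of affine images. -/

section MemLp

variable {Ω : Type*} [MeasurableSpace Ω] {P : Measure Ω}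

lemma memLp_four_iff {f : Ω → ℝ} :
    MemLp f 4 P ↔ AEStronglyMeasurable f P ∧ Integrable (fun ω => f ω ^ 4) P := by
  have e : ∀ ω, ‖f ω‖ ^ (4 : ENNReal).toReal = f ω ^ 4 := fun ω => by
    rw [show (4 : ENNReal).toReal = ((4 : ℕ) : ℝ) by norm_num, Real.rpow_natCast, Real.norm_eq_abs]
    exact Even.pow_abs (by decide) _
  constructor
  · intro h
    refine ⟨h.aestronglyMeasurable, ?_⟩
    simpa only [e] using h.integrable_norm_rpow (by norm_num) (by norm_num)
  · rintro ⟨h1, h2⟩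
    rw [← integrable_norm_rpow_iff h1 (by norm_num) (by norm_num)]
    simpa only [e] using h2

lemma MeasureTheory.MemLp.integrable_pow_four {f : Ω → ℝ} (hf : MemLp f 4 P) :
    Integrable (fun ω => f ω ^ 4) P := (memLp_four_iff.1 hf).2

lemma ProbabilityTheory.IndepFun.memLp_four_mul {X Y : Ω → ℝ} (hXY : IndepFun X Y P)
    (hX : MemLp X 4 P) (hY : MemLp Y 4 P) : MemLp (fun ω => X ω * Y ω) 4 P := by
  rw [memLp_four_iff]
  refine ⟨hX.aestronglyMeasurable.mul hY.aestronglyMeasurable, ?_⟩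
  simp only [mul_pow]
  exact (hXY.comp (φ := fun x => x ^ 4) (ψ := fun x => x ^ 4) (by fun_prop)
    (by fun_prop)).integrable_mul hX.integrable_pow_four hY.integrable_pow_four

instance : ENNReal.HolderTriple 4 4 2 :=
  ⟨by
    rw [show (4 : ENNReal) = 2 * 2 by norm_num,
      ENNReal.mul_inv (by norm_num) (by norm_num), ← mul_add, ENNReal.inv_two_add_inv_two, mul_one]⟩

lemma MeasureTheory.MemLp.two_of_four {f : Ω → ℝ} [IsFiniteMeasure P] (hf : MemLp f 4 P) :
    MemLp f 2 P := hf.mono_exponent (by norm_num)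

lemma memLp_two_dotProduct_mulVec {J : Type} [Fintype J] (M : Matrix J J ℝ) {X Y : Ω → J → ℝ}
    (hX : ∀ j, MemLp (fun ω => X ω j) 4 P) (hY : ∀ j, MemLp (fun ω => Y ω j) 4 P) :
    MemLp (fun ω => X ω ⬝ᵥ M *ᵥ Y ω) 2 P := by
  simp only [dotProduct, Matrix.mulVec]
  refine memLp_finsetSum _ fun i _ => ?_
  have : MemLp (fun ω => ∑ j, M i j * Y ω j) 4 P :=
    memLp_finsetSum _ fun j _ => (hY j).const_mul _
  exact MemLp.mul this (hX i)

lemma memLp_mulVec {J : Type} [Fintype J] {p : ENNReal} (M : Matrix J J ℝ) {X : Ω → J → ℝ}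
    (hX : ∀ j, MemLp (fun ω => X ω j) p P) (i : J) : MemLp (fun ω => (M *ᵥ X ω) i) p P :=
  memLp_finsetSum _ fun j _ => (hX j).const_mul _

lemma memLp_clusterPart {J ι : Type} [DecidableEq ι] (cl : J → ι) (g : ι) {p : ENNReal}
    {X : Ω → J → ℝ} (hX : ∀ j, MemLp (fun ω => X ω j) p P) (j : J) :
    MemLp (fun ω => clusterPart cl g (X ω) j) p P := by
  by_cases hj : cl j = g
  · simpa [clusterPart, hj] using hX j
  · simp [clusterPart, hj]

lemma memLp_clusterRest {J ι : Type} [DecidableEq ι] (cl : J → ι) (g : ι) {p : ENNReal}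
    {X : Ω → J → ℝ} (hX : ∀ j, MemLp (fun ω => X ω j) p P) (j : J) :
    MemLp (fun ω => clusterRest cl g (X ω) j) p P := by
  by_cases hj : cl j = g
  · simp [clusterRest, hj]
  · simpa [clusterRest, hj] using hX j

lemma memLp_affine {J : Type} [Fintype J] [IsFiniteMeasure P] {p : ENNReal} (b : J → ℝ)
    (M : Matrix J J ℝ) {X : Ω → J → ℝ} (hX : ∀ j, MemLp (fun ω => X ω j) p P) (i : J) :
    MemLp (fun ω => (b + M *ᵥ X ω) i) p P :=
  (memLp_const (b i)).add (memLp_mulVec M hX i)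

end MemLp

/-! ### Integration by parts in one cluster against `exp(itT)`. -/

namespace Complex

/-- The constant is not sharp: for `|x| > 1` it comes from `|e^{ix} - 1| + |x| ≤ 2|x| ≤ 2x²`. A
second-order bound valid for all `x` avoids truncation. -/
lemma norm_exp_mul_I_sub_one_sub_le (x : ℝ) : ‖exp (x * I) - 1 - x * I‖ ≤ 2 * x ^ 2 := by
  by_cases hx : |x| ≤ 1
  · have h : ‖(x : ℂ) * I‖ = |x| := by simp
    have := norm_exp_sub_one_sub_id_le (x := x * I) (by rw [h]; exact hx)
    rw [h, sq_abs] at this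
    nlinarith [sq_nonneg x]
  · have h1 : ‖exp (x * I) - 1‖ ≤ |x| := by
      have := Real.norm_exp_I_mul_ofReal_sub_one_le (x := x)
      rwa [mul_comm I, Real.norm_eq_abs] at this
    have h2 := norm_sub_le (exp (x * I) - 1) (x * I)
    have h : ‖(x : ℂ) * I‖ = |x| := by simp
    rw [h] at h2
    have h3 : |x| ≤ x ^ 2 := by
      rw [← sq_abs]
      nlinarith
    linarith

end Complex

namespace ClusterNoise

open ClusterDesign (crossMoment)

variable {J ι : Type} [Fintype J] [DecidableEq ι] [Fintype ι] {Ω : Type*} [MeasurableSpace Ω]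
  {P : Measure Ω} [IsProbabilityMeasure P] {cl : J → ι} {ε : Ω → J → ℝ}

lemma memLp_clusterPart_dotProduct_rest (h : ClusterNoise P cl ε) (g : ι) {A : (J → ℝ) → J → ℝ}
    (hA : Measurable A) (hi : ∀ j, MemLp (fun ω => A (clusterRest cl g (ε ω)) j) 4 P) :
    MemLp (fun ω => clusterPart cl g (ε ω) ⬝ᵥ A (clusterRest cl g (ε ω))) 4 P := by
  simp only [dotProduct]
  refine memLp_finsetSum _ fun j _ => ?_
  exact ((h.indepFun_rest g).comp (measurable_pi_apply j)
    ((measurable_pi_apply j).comp hA)).memLp_four_mul (memLp_clusterPart cl g h.memLp j) (hi j)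

lemma dotProduct_crossMoment_self_nonneg (h : ClusterNoise P cl ε) (y : J → ℝ) :
    0 ≤ y ⬝ᵥ crossMoment P ε ε *ᵥ y := by
  rw [← h.integral_dotProduct_mul]
  exact integral_nonneg fun ω => mul_self_nonneg _

/-- The covariance form is nonnegative at `τy + dz` and at `τy - dz`; expanding both gives the
weighted arithmetic-geometric inequality for its off-diagonal value. -/
lemma two_mul_abs_crossMoment_mul_le (h : ClusterNoise P cl ε) (y z : J → ℝ) (d : ℝ) {τ : ℝ}
    (hτ : 0 < τ) :
    2 * (|y ⬝ᵥ crossMoment P ε ε *ᵥ z| * |d|)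
      ≤ τ * (y ⬝ᵥ crossMoment P ε ε *ᵥ y) + d ^ 2 * (z ⬝ᵥ crossMoment P ε ε *ᵥ z) / τ := by
  have h1 := h.dotProduct_crossMoment_self_nonneg (τ • y + d • z)
  have h2 := h.dotProduct_crossMoment_self_nonneg (τ • y - d • z)
  have hc := dotProduct_mulVec_comm_of_isSymm (crossMoment_isSymm P ε) z y
  simp only [add_dotProduct, dotProduct_add, sub_dotProduct, dotProduct_sub, smul_dotProduct,
    dotProduct_smul, Matrix.mulVec_add, Matrix.mulVec_sub, Matrix.mulVec_smul, smul_eq_mul,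
    hc] at h1 h2
  rw [← abs_mul]
  set a := y ⬝ᵥ crossMoment P ε ε *ᵥ y
  set m := y ⬝ᵥ crossMoment P ε ε *ᵥ z
  set e := z ⬝ᵥ crossMoment P ε ε *ᵥ z
  have key : 2 * |m * d| * τ ≤ τ * a * τ + d ^ 2 * e := by
    rcases abs_cases (m * d) with ⟨e1, -⟩ | ⟨e1, -⟩ <;> rw [e1] <;> nlinarith
  calc 2 * |m * d| = 2 * |m * d| * τ / τ := by field_simp
    _ ≤ (τ * a * τ + d ^ 2 * e) / τ := by gcongr
    _ = _ := by field_simp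

/-- The covariance of `y ⬝ᵥ ε` and `z ⬝ᵥ ε` restricted to cluster `g`. -/
noncomputable def clusterCov (P : Measure Ω) (cl : J → ι) (ε : Ω → J → ℝ) (g : ι) (y z : J → ℝ) : ℝ :=
  clusterPart cl g y ⬝ᵥ crossMoment P ε ε *ᵥ clusterPart cl g z

lemma memLp_clusterCov {g : ι} {X Y : Ω → J → ℝ} (hX : ∀ j, MemLp (fun ω => X ω j) 4 P)
    (hY : ∀ j, MemLp (fun ω => Y ω j) 4 P) :
    MemLp (fun ω => clusterCov P cl ε g (X ω) (Y ω)) 2 P :=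
  memLp_two_dotProduct_mulVec _ (memLp_clusterPart cl g hX) (memLp_clusterPart cl g hY)

lemma measurable_clusterCov {g : ι} {X Y : (J → ℝ) → J → ℝ} (hX : Measurable X)
    (hY : Measurable Y) : Measurable fun x => clusterCov P cl ε g (X x) (Y x) := by
  simp only [clusterCov, dotProduct, Matrix.mulVec]
  refine Finset.measurable_sum _ fun i _ => ?_
  refine Measurable.mul ((measurable_pi_apply i).comp ((measurable_clusterPart cl g).comp hX)) ?_
  refine Finset.measurable_sum _ fun j _ => ?_
  exact ((measurable_pi_apply j).comp ((measurable_clusterPart cl g).comp hY)).const_mul _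

lemma integral_clusterPart_dotProduct_sq (h : ClusterNoise P cl ε) (g : ι) {A : (J → ℝ) → J → ℝ}
    (hA : Measurable A) (hi : ∀ j, MemLp (fun ω => A (clusterRest cl g (ε ω)) j) 4 P) :
    ∫ ω, (clusterPart cl g (ε ω) ⬝ᵥ A (clusterRest cl g (ε ω))) ^ 2 ∂P
      = ∫ ω, clusterCov P cl ε g (A (clusterRest cl g (ε ω))) (A (clusterRest cl g (ε ω))) ∂P := by
  have := h.integral_clusterPart_dotProduct_mul_mul (𝕜 := ℝ) g hA hA (f := fun _ => 1)
    measurable_const (fun j k => by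
      simpa using (MemLp.mul' (hi k) (hi j) (r := 2)).integrable (by norm_num))
  simpa [pow_two, clusterCov] using this

/-- This plays the part of conditional Jensen. Let `x` be the conditional variance of `d`. Then `E[x
d²] = E[x²]`, while `x d² ≤ (x² + d⁴)/2` pointwise; absorbing half of `E[x²]` leaves the bound by
`E[d⁴]`. -/
lemma integral_clusterCov_sq_le (h : ClusterNoise P cl ε) (g : ι) {D : (J → ℝ) → J → ℝ}
    (hD : Measurable D) (hi : ∀ j, MemLp (fun ω => D (clusterRest cl g (ε ω)) j) 4 P) :
    ∫ ω, clusterCov P cl ε g (D (clusterRest cl g (ε ω))) (D (clusterRest cl g (ε ω)))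
        * (clusterPart cl g (ε ω) ⬝ᵥ D (clusterRest cl g (ε ω))) ^ 2 ∂P
      ≤ ∫ ω, (clusterPart cl g (ε ω) ⬝ᵥ D (clusterRest cl g (ε ω))) ^ 4 ∂P := by
  set x : Ω → ℝ := fun ω =>
    clusterCov P cl ε g (D (clusterRest cl g (ε ω))) (D (clusterRest cl g (ε ω))) with hx
  set d : Ω → ℝ := fun ω => clusterPart cl g (ε ω) ⬝ᵥ D (clusterRest cl g (ε ω)) with hd
  have hx2 : MemLp x 2 P := memLp_clusterCov hi hi
  have hd4 : MemLp d 4 P := h.memLp_clusterPart_dotProduct_rest g hD hi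
  have hd2 : MemLp (fun ω => d ω ^ 2) 2 P := by
    simpa only [pow_two] using MemLp.mul' hd4 hd4
  have e : ∫ ω, x ω * d ω ^ 2 ∂P = ∫ ω, x ω ^ 2 ∂P := by
    have := h.integral_clusterPart_dotProduct_mul_mul (𝕜 := ℝ) g hD hD
      (f := fun y => clusterCov P cl ε g (D y) (D y)) (measurable_clusterCov hD hD) (fun j k => by
        have h2 : MemLp (fun ω => D (clusterRest cl g (ε ω)) j * D (clusterRest cl g (ε ω)) k) 2 P :=
          MemLp.mul' (hi k) (hi j)
        exact h2.integrable_mul hx2)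
    simp only [RCLike.ofReal_real_eq_id, id] at this
    calc _ = _ := integral_congr_ae (.of_forall fun ω => by simp only [hx, hd, pow_two]; ring)
      _ = _ := this
      _ = _ := integral_congr_ae (.of_forall fun ω => by simp only [hx, clusterCov, pow_two])
  have hxd : Integrable (fun ω => x ω * d ω ^ 2) P := hx2.integrable_mul hd2
  have hle : ∫ ω, x ω * d ω ^ 2 ∂P ≤ ∫ ω, (x ω ^ 2 / 2 + d ω ^ 4 / 2) ∂P := by
    refine integral_mono hxd ((hx2.integrable_sq.div_const 2).add
      (hd4.integrable_pow_four.div_const 2)) fun ω => ?_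
    simp only
    nlinarith [sq_nonneg (x ω - d ω ^ 2)]
  rw [integral_add (hx2.integrable_sq.div_const 2) (hd4.integrable_pow_four.div_const 2),
    integral_div, integral_div, ← e] at hle
  linarith

/-- Integration by parts in one cluster, with remainder. -/
lemma norm_integral_clusterPart_mul_exp_sub_le (h : ClusterNoise P cl ε) (g : ι)
    {A D : (J → ℝ) → J → ℝ} {w : (J → ℝ) → ℝ} (hA : Measurable A) (hD : Measurable D)
    (hw : Measurable w) (hAi : ∀ j, MemLp (fun ω => A (clusterRest cl g (ε ω)) j) 4 P)
    (hDi : ∀ j, MemLp (fun ω => D (clusterRest cl g (ε ω)) j) 4 P) (t : ℝ) {τ : ℝ} (hτ : 0 < τ) :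
    ‖∫ ω, (((clusterPart cl g (ε ω) ⬝ᵥ A (clusterRest cl g (ε ω)) : ℝ) : ℂ)
        - t * Complex.I * ((clusterCov P cl ε g (A (clusterRest cl g (ε ω)))
          (D (clusterRest cl g (ε ω))) : ℝ) : ℂ))
        * Complex.exp ((t * (w (clusterRest cl g (ε ω))
          + clusterPart cl g (ε ω) ⬝ᵥ D (clusterRest cl g (ε ω))) : ℝ) * Complex.I) ∂P‖
      ≤ 3 / 2 * t ^ 2 * (τ * ∫ ω, (clusterPart cl g (ε ω) ⬝ᵥ A (clusterRest cl g (ε ω))) ^ 2 ∂P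
        + (∫ ω, (clusterPart cl g (ε ω) ⬝ᵥ D (clusterRest cl g (ε ω))) ^ 4 ∂P) / τ) := by
  set r : Ω → J → ℝ := fun ω => clusterRest cl g (ε ω) with hr
  set a : Ω → ℝ := fun ω => clusterPart cl g (ε ω) ⬝ᵥ A (r ω) with ha
  set d : Ω → ℝ := fun ω => clusterPart cl g (ε ω) ⬝ᵥ D (r ω) with hd
  set q : Ω → ℝ := fun ω => clusterCov P cl ε g (A (r ω)) (D (r ω)) with hq
  set z : Ω → ℝ := fun ω => clusterCov P cl ε g (A (r ω)) (A (r ω)) with hz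
  set x : Ω → ℝ := fun ω => clusterCov P cl ε g (D (r ω)) (D (r ω)) with hx
  set E : (J → ℝ) → ℂ := fun y => Complex.exp ((t * w y : ℝ) * Complex.I) with hE
  have hEm : Measurable E := by fun_prop
  have hEn : ∀ y, ‖E y‖ = 1 := fun y => Complex.norm_exp_ofReal_mul_I _
  have hrm : Measurable r := (measurable_clusterRest cl g).comp h.measurable
  have hErm : AEStronglyMeasurable (fun ω => E (r ω)) P := (hEm.comp hrm).aestronglyMeasurable
  have bdd : ∀ {F : Ω → ℝ}, Integrable F P → Integrable (fun ω => (F ω : ℂ) * E (r ω)) P :=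
    fun hF => hF.ofReal.mul_bdd hErm (.of_forall fun ω => (hEn _).le)
  have a4 : MemLp a 4 P := h.memLp_clusterPart_dotProduct_rest g hA hAi
  have d4 : MemLp d 4 P := h.memLp_clusterPart_dotProduct_rest g hD hDi
  have q2 : MemLp q 2 P := memLp_clusterCov hAi hDi
  have z2 : MemLp z 2 P := memLp_clusterCov hAi hAi
  have x2 : MemLp x 2 P := memLp_clusterCov hDi hDi
  have ai : Integrable a P := a4.integrable (by norm_num)
  have qi : Integrable q P := q2.integrable (by norm_num)
  have adi : Integrable (fun ω => a ω * d ω) P := a4.two_of_four.integrable_mul d4.two_of_four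
  -- `E (r ω)` is the exponential of the statistic without cluster `g`. The zeroth-order term
  -- vanishes (`I1`), and the first-order term cancels the covariance `q` up to the remainder `R`
  -- (`I2`).
  have I1 : ∫ ω, (a ω : ℂ) * E (r ω) ∂P = 0 :=
    h.integral_clusterPart_dotProduct_mul (𝕜 := ℂ) g hA hEm
      fun j => bdd ((hAi j).integrable (by norm_num))
  have I2 : ∫ ω, ((a ω * d ω : ℝ) : ℂ) * E (r ω) ∂P = ∫ ω, (q ω : ℂ) * E (r ω) ∂P :=
    h.integral_clusterPart_dotProduct_mul_mul (𝕜 := ℂ) g hA hD hEm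
      fun j k => bdd ((hAi j).two_of_four.integrable_mul (hDi k).two_of_four)
  set R : Ω → ℂ := fun ω => (a ω : ℂ) * E (r ω)
      * (Complex.exp ((t * d ω : ℝ) * Complex.I) - 1 - (t * d ω : ℝ) * Complex.I)
    - t * Complex.I * q ω * E (r ω) * (Complex.exp ((t * d ω : ℝ) * Complex.I) - 1) with hR
  have split : ∀ ω, ((a ω : ℂ) - t * Complex.I * (q ω : ℂ))
        * Complex.exp ((t * (w (r ω) + d ω) : ℝ) * Complex.I)
      = (a ω : ℂ) * E (r ω) + t * Complex.I * (((a ω * d ω : ℝ) : ℂ) * E (r ω)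
        - (q ω : ℂ) * E (r ω)) + R ω := by
    intro ω
    have e : Complex.exp ((t * (w (r ω) + d ω) : ℝ) * Complex.I)
        = E (r ω) * Complex.exp ((t * d ω : ℝ) * Complex.I) := by
      rw [hE, ← Complex.exp_add]
      congr 1
      push_cast
      ring
    rw [e, hR]
    push_cast
    ring
  -- The remainder is of size `t²(|a| d² + |q||d|)`. The weight `τ` splits both products into
  -- second-moment terms, which are not small, and fourth-order terms in `d`, which are.
  set bd : Ω → ℝ := fun ω => t ^ 2 * (τ * a ω ^ 2 + d ω ^ 4 / τ)
    + t ^ 2 / 2 * (τ * z ω + x ω * d ω ^ 2 / τ) with hbd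
  have d22 : MemLp (fun ω => d ω ^ 2) 2 P := by simpa only [pow_two] using MemLp.mul' d4 d4
  have i1 : Integrable (fun ω => τ * a ω ^ 2) P := a4.two_of_four.integrable_sq.const_mul _
  have i2 : Integrable (fun ω => d ω ^ 4 / τ) P := d4.integrable_pow_four.div_const _
  have i3 : Integrable (fun ω => τ * z ω) P := (z2.integrable (by norm_num)).const_mul _
  have i4 : Integrable (fun ω => x ω * d ω ^ 2 / τ) P := (x2.integrable_mul d22).div_const _
  have i5 : Integrable (fun ω => t ^ 2 * (τ * a ω ^ 2 + d ω ^ 4 / τ)) P := (i1.add i2).const_mul _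
  have i6 : Integrable (fun ω => t ^ 2 / 2 * (τ * z ω + x ω * d ω ^ 2 / τ)) P :=
    (i3.add i4).const_mul _
  have bdi : Integrable bd P := i5.add i6
  have hRle : ∀ ω, ‖R ω‖ ≤ bd ω := by
    intro ω
    have n1 := Complex.norm_exp_mul_I_sub_one_sub_le (t * d ω)
    have n2 : ‖Complex.exp ((t * d ω : ℝ) * Complex.I) - 1‖ ≤ |t * d ω| := by
      have := Real.norm_exp_I_mul_ofReal_sub_one_le (x := t * d ω)
      rwa [mul_comm Complex.I, Real.norm_eq_abs] at this
    have n3 : 2 * (|q ω| * |d ω|) ≤ τ * z ω + d ω ^ 2 * x ω / τ :=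
      h.two_mul_abs_crossMoment_mul_le _ _ _ hτ
    have n4 : 2 * (|a ω| * d ω ^ 2) ≤ τ * a ω ^ 2 + d ω ^ 4 / τ := by
      have : 2 * (|a ω| * d ω ^ 2) * τ ≤ (τ * a ω ^ 2 + d ω ^ 4 / τ) * τ := by
        have : (τ * a ω ^ 2 + d ω ^ 4 / τ) * τ = (τ * |a ω|) ^ 2 + (d ω ^ 2) ^ 2 := by
          rw [mul_pow, sq_abs]
          field_simp
        nlinarith [sq_nonneg (τ * |a ω| - d ω ^ 2)]
      exact le_of_mul_le_mul_right this hτ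
    calc ‖R ω‖ ≤ |a ω| * (2 * (t * d ω) ^ 2) + |t| * |q ω| * |t * d ω| := by
          refine (norm_sub_le _ _).trans (add_le_add ?_ ?_)
          · rw [norm_mul, norm_mul, hEn, mul_one, Complex.norm_real, Real.norm_eq_abs]
            gcongr
          · rw [norm_mul, norm_mul, hEn, mul_one, norm_mul, norm_mul, Complex.norm_I, mul_one,
              Complex.norm_real, Complex.norm_real, Real.norm_eq_abs, Real.norm_eq_abs]
            gcongr
      _ = t ^ 2 * (2 * (|a ω| * d ω ^ 2)) + t ^ 2 / 2 * (2 * (|q ω| * |d ω|)) := by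
          rw [abs_mul, mul_pow, ← sq_abs t]
          ring
      _ ≤ bd ω := by
          rw [hbd]
          simp only []
          rw [mul_comm (x ω)]
          gcongr
  have Ri : Integrable R P := by
    refine bdi.mono' ?_ (.of_forall hRle)
    have hdm : AEStronglyMeasurable d P := d4.aestronglyMeasurable
    have m1 : AEStronglyMeasurable (fun ω => Complex.exp ((t * d ω : ℝ) * Complex.I)) P :=
      (by fun_prop : Continuous fun y : ℝ => Complex.exp ((t * y : ℝ) * Complex.I))
        |>.comp_aestronglyMeasurable hdm
    have m2 : AEStronglyMeasurable (fun ω => ((t * d ω : ℝ) : ℂ) * Complex.I) P :=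
      (by fun_prop : Continuous fun y : ℝ => ((t * y : ℝ) : ℂ) * Complex.I)
        |>.comp_aestronglyMeasurable hdm
    have m3 : AEStronglyMeasurable (fun ω => ((t : ℂ) * Complex.I * (q ω : ℂ))) P :=
      qi.ofReal.aestronglyMeasurable.const_mul _
    exact ((bdd ai).aestronglyMeasurable.mul ((m1.sub aestronglyMeasurable_const).sub m2)).sub
      ((m3.mul hErm).mul (m1.sub aestronglyMeasurable_const))
  have eq : ∫ ω, ((a ω : ℂ) - t * Complex.I * (q ω : ℂ))
        * Complex.exp ((t * (w (r ω) + d ω) : ℝ) * Complex.I) ∂P = ∫ ω, R ω ∂P := by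
    simp only [split]
    have j1 : Integrable (fun ω => t * Complex.I * (((a ω * d ω : ℝ) : ℂ) * E (r ω)
        - (q ω : ℂ) * E (r ω))) P := ((bdd adi).sub (bdd qi)).const_mul _
    have j2 : Integrable (fun ω => (a ω : ℂ) * E (r ω) + t * Complex.I
        * (((a ω * d ω : ℝ) : ℂ) * E (r ω) - (q ω : ℂ) * E (r ω))) P := (bdd ai).add j1
    rw [integral_add j2 Ri, integral_add (bdd ai) j1, integral_const_mul,
      integral_sub (bdd adi) (bdd qi), I1, I2]
    ring
  rw [eq]
  refine (norm_integral_le_of_norm_le bdi (.of_forall hRle)).trans ?_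
  rw [hbd, integral_add i5 i6, integral_const_mul,
    integral_const_mul]
  have e1 : ∫ ω, τ * a ω ^ 2 + d ω ^ 4 / τ ∂P = τ * ∫ ω, a ω ^ 2 ∂P + (∫ ω, d ω ^ 4 ∂P) / τ := by
    rw [integral_add i1 i2, integral_const_mul, integral_div]
  -- In expectation the covariance terms are no larger than the terms in `a` and `d` themselves, so
  -- the two halves of `bd` add to `1 + 1/2 = 3/2`.
  have e2 : ∫ ω, τ * z ω + x ω * d ω ^ 2 / τ ∂P
      ≤ τ * ∫ ω, a ω ^ 2 ∂P + (∫ ω, d ω ^ 4 ∂P) / τ := by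
    rw [integral_add i3 i4, integral_const_mul, integral_div,
      h.integral_clusterPart_dotProduct_sq g hA hAi]
    exact add_le_add le_rfl (div_le_div_of_nonneg_right (h.integral_clusterCov_sq_le g hD hDi) hτ.le)
  rw [e1]
  nlinarith [mul_le_mul_of_nonneg_left e2 (by positivity : 0 ≤ t ^ 2 / 2)]

end ClusterNoise

/-! ### From an approximate differential equation to the Gaussian characteristic function. -/

section Gaussian

/-- If `ψ' + tψ` is small then `ψ` is close to the characteristic function of a standard normal. -/
lemma norm_sub_exp_neg_le_of_hasDerivAt {ψ ψ' : ℝ → ℂ} {δ : ℝ} (hδ : 0 ≤ δ)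
    (hψ : ∀ t, HasDerivAt ψ (ψ' t) t) (h0 : ψ 0 = 1)
    (hb : ∀ t, ‖ψ' t + t * ψ t‖ ≤ (|t| + 3 * t ^ 2) * δ) (t : ℝ) :
    ‖ψ t - Real.exp (-t ^ 2 / 2)‖ ≤ Real.exp (t ^ 2 / 2) * ((|t| + 3 * t ^ 2) * δ) * |t| := by
  -- The integrating factor `exp(s²/2)` turns the defect `ψ' + sψ` into a derivative; the mean value
  -- inequality on `[-|t|, |t|]` then finishes.
  have hd : ∀ s : ℝ, HasDerivAt (fun s : ℝ => (Real.exp (s ^ 2 / 2) : ℂ) * ψ s)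
      ((Real.exp (s ^ 2 / 2) : ℂ) * (ψ' s + s * ψ s)) s := by
    intro s
    have h1 : HasDerivAt (fun s : ℝ => Real.exp (s ^ 2 / 2)) (Real.exp (s ^ 2 / 2) * s) s := by
      have := ((hasDerivAt_pow 2 s).div_const 2).exp
      convert this using 2
      norm_num
    exact (h1.ofReal_comp.mul (hψ s)).congr_deriv (by push_cast; ring)
  have hbound : ∀ s ∈ Set.Icc (-|t|) |t|, ‖(Real.exp (s ^ 2 / 2) : ℂ) * (ψ' s + s * ψ s)‖
      ≤ Real.exp (t ^ 2 / 2) * ((|t| + 3 * t ^ 2) * δ) := by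
    intro s hs
    have hst : |s| ≤ |t| := abs_le.2 hs
    have hst2 : s ^ 2 ≤ t ^ 2 := sq_le_sq.2 hst
    rw [norm_mul, Complex.norm_real, Real.norm_of_nonneg (Real.exp_pos _).le]
    refine mul_le_mul (Real.exp_le_exp.2 (by linarith)) ((hb s).trans ?_) (norm_nonneg _)
      (Real.exp_pos _).le
    gcongr
  have h := Convex.norm_image_sub_le_of_norm_hasDerivWithin_le
    (fun s _ => (hd s).hasDerivWithinAt) hbound (convex_Icc _ _)
    (x := 0) (y := t) (by simp) ⟨neg_abs_le t, le_abs_self t⟩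
  simp only [h0, sub_zero, Real.norm_eq_abs] at h
  have e : ψ t - Real.exp (-t ^ 2 / 2) = (Real.exp (-t ^ 2 / 2) : ℂ)
      * ((Real.exp (t ^ 2 / 2) : ℂ) * ψ t - (Real.exp (0 ^ 2 / 2) : ℂ) * 1) := by
    rw [mul_sub, ← mul_assoc, ← Complex.ofReal_mul, ← Real.exp_add]
    simp [neg_div]
  rw [e, norm_mul, Complex.norm_real, Real.norm_of_nonneg (Real.exp_pos _).le]
  have : Real.exp (-t ^ 2 / 2) ≤ 1 := Real.exp_le_one_iff.2 (by nlinarith [sq_nonneg t])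
  exact (mul_le_of_le_one_left (norm_nonneg _) this).trans h

end Gaussian

/-! ### The Stein kernel and the normal approximation with an explicit error. -/

namespace ClusterNoise

open ClusterDesign (crossMoment)

variable {J ι : Type} [Fintype J] [DecidableEq ι] [Fintype ι] {Ω : Type*} [MeasurableSpace Ω]
  {P : Measure Ω} [IsProbabilityMeasure P] {cl : J → ι} {ε : Ω → J → ℝ}

/-- Independent centred clusters have a block diagonal covariance matrix, which therefore commutes
with restriction to a cluster. -/
lemma clusterPart_crossMoment_mulVec (h : ClusterNoise P cl ε) (g : ι) (z : J → ℝ) :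
    clusterPart cl g (crossMoment P ε ε *ᵥ z) = crossMoment P ε ε *ᵥ clusterPart cl g z := by
  ext j
  simp only [clusterPart, Matrix.mulVec, dotProduct, mul_ite, mul_zero]
  split_ifs with hj
  · refine Finset.sum_congr rfl fun k _ => ?_
    split_ifs with hk
    · rfl
    · rw [h.crossMoment_eq_zero (by rw [hj]; exact Ne.symm hk), zero_mul]
  · refine (Finset.sum_eq_zero fun k _ => ?_).symm
    split_ifs with hk
    · rw [h.crossMoment_eq_zero (by rw [hk]; exact hj), zero_mul]
    · rfl

lemma sum_clusterCov (h : ClusterNoise P cl ε) (y z : J → ℝ) :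
    ∑ g, clusterCov P cl ε g y z = y ⬝ᵥ crossMoment P ε ε *ᵥ z := by
  have e : ∀ g, clusterCov P cl ε g y z = clusterPart cl g y ⬝ᵥ crossMoment P ε ε *ᵥ z := by
    intro g
    rw [clusterCov, ← h.clusterPart_crossMoment_mulVec, clusterPart_dotProduct_clusterPart,
      clusterPart_dotProduct_comm]
  simp only [e]
  rw [← sum_dotProduct, sum_clusterPart]

lemma _root_.IsHollow.clusterCov_rest {K : Matrix J J ℝ} (hK : IsHollow cl K) (g : ι)
    (b c x : J → ℝ) (s t : ℝ) :
    clusterCov P cl ε g (b + s • K *ᵥ clusterRest cl g x) (c + t • K *ᵥ clusterRest cl g x)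
      = clusterCov P cl ε g (b + s • K *ᵥ x) (c + t • K *ᵥ x) := by
  simp only [clusterCov, clusterPart_add, clusterPart_smul, hK.clusterPart_mulVec_clusterRest]

/-- The random variable whose expectation is the variance of `linQuad b K ε`. -/
noncomputable def steinVar (P : Measure Ω) (ε : Ω → J → ℝ) (b : J → ℝ) (K : Matrix J J ℝ)
    (ω : Ω) : ℝ :=
  (b + (1 / 2 : ℝ) • K *ᵥ ε ω) ⬝ᵥ crossMoment P ε ε *ᵥ (b + (1 : ℝ) • K *ᵥ ε ω)

lemma memLp_affine_smul (h : ClusterNoise P cl ε) (b : J → ℝ) (K : Matrix J J ℝ) (s : ℝ) (j : J) :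
    MemLp (fun ω => (b + s • K *ᵥ ε ω) j) 4 P := by
  simpa only [Matrix.smul_mulVec] using memLp_affine b (s • K) h.memLp j

lemma memLp_affine_smul_rest (h : ClusterNoise P cl ε) (b : J → ℝ) (K : Matrix J J ℝ) (s : ℝ) (g : ι)
    (j : J) : MemLp (fun ω => (b + s • K *ᵥ clusterRest cl g (ε ω)) j) 4 P := by
  simpa only [Matrix.smul_mulVec] using memLp_affine b (s • K) (memLp_clusterRest cl g h.memLp) j

lemma measurable_affine_smul (b : J → ℝ) (K : Matrix J J ℝ) (s : ℝ) :
    Measurable fun x : J → ℝ => b + s • K *ᵥ x := by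
  have : Continuous fun x : J → ℝ => b + s • K *ᵥ x := by
    fun_prop
  exact this.measurable

lemma measurable_linQuad (b : J → ℝ) (K : Matrix J J ℝ) : Measurable (linQuad b K) := by
  have : Continuous (linQuad b K) := by
    unfold linQuad
    fun_prop
  exact this.measurable

lemma memLp_two_linQuad (h : ClusterNoise P cl ε) (b : J → ℝ) (K : Matrix J J ℝ) :
    MemLp (fun ω => linQuad b K (ε ω)) 2 P := by
  classical
  simpa only [Matrix.one_mulVec, linQuad] using
    memLp_two_dotProduct_mulVec 1 h.memLp (h.memLp_affine_smul b K (1 / 2))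

lemma memLp_two_steinVar (h : ClusterNoise P cl ε) (b : J → ℝ) (K : Matrix J J ℝ) :
    MemLp (steinVar P ε b K) 2 P :=
  memLp_two_dotProduct_mulVec _ (h.memLp_affine_smul b K _) (h.memLp_affine_smul b K _)

/-- Sum the one-cluster estimates: the shares add up to the statistic and the cluster covariances to
`steinVar`. Having `τ²` dominate the sum of fourth moments makes both parts of the remainder at most
`τ`, whence `3 = 2 · 3/2`. -/
lemma norm_integral_linQuad_sub_mul_exp_le (h : ClusterNoise P cl ε) {b : J → ℝ}
    {K : Matrix J J ℝ} (hK : IsHollow cl K) (hs : K.IsSymm) {τ : ℝ} (hτ : 0 < τ)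
    (hA : ∫ ω, (b + (1 / 2 : ℝ) • K *ᵥ ε ω) ⬝ᵥ crossMoment P ε ε *ᵥ (b + (1 / 2 : ℝ) • K *ᵥ ε ω) ∂P
      ≤ 1)
    (hF : ∑ g, ∫ ω, (clusterPart cl g (ε ω) ⬝ᵥ (b + (1 : ℝ) • K *ᵥ ε ω)) ^ 4 ∂P ≤ τ ^ 2) (t : ℝ) :
    ‖∫ ω, ((linQuad b K (ε ω) : ℂ) - t * Complex.I * (steinVar P ε b K ω : ℂ))
      * Complex.exp ((t * linQuad b K (ε ω) : ℝ) * Complex.I) ∂P‖ ≤ 3 * t ^ 2 * τ := by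
  have step : ∀ g, ‖∫ ω, (((clusterPart cl g (ε ω) ⬝ᵥ (b + (1 / 2 : ℝ) • K *ᵥ ε ω) : ℝ) : ℂ)
        - t * Complex.I * ((clusterCov P cl ε g (b + (1 / 2 : ℝ) • K *ᵥ ε ω)
          (b + (1 : ℝ) • K *ᵥ ε ω) : ℝ) : ℂ))
        * Complex.exp ((t * linQuad b K (ε ω) : ℝ) * Complex.I) ∂P‖
      ≤ 3 / 2 * t ^ 2 * (τ * ∫ ω, clusterCov P cl ε g (b + (1 / 2 : ℝ) • K *ᵥ ε ω)
          (b + (1 / 2 : ℝ) • K *ᵥ ε ω) ∂P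
        + (∫ ω, (clusterPart cl g (ε ω) ⬝ᵥ (b + (1 : ℝ) • K *ᵥ ε ω)) ^ 4 ∂P) / τ) := by
    intro g
    have := h.norm_integral_clusterPart_mul_exp_sub_le g (measurable_affine_smul b K (1 / 2))
      (measurable_affine_smul b K 1) (measurable_linQuad b K) (h.memLp_affine_smul_rest b K _ g)
      (h.memLp_affine_smul_rest b K _ g) t hτ
    rw [h.integral_clusterPart_dotProduct_sq g (measurable_affine_smul b K (1 / 2))
      (h.memLp_affine_smul_rest b K _ g)] at this
    have e : ∀ ω, linQuad b K (clusterRest cl g (ε ω)) + clusterPart cl g (ε ω) ⬝ᵥ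
        (b + (1 : ℝ) • K *ᵥ clusterRest cl g (ε ω)) = linQuad b K (ε ω) := fun ω => by
      rw [one_smul, ← linQuad_eq_rest_add hK hs]
    simp only [e] at this
    simpa only [hK.clusterCov_rest, hK.clusterPart_dotProduct_affine] using this
  have hE : ∀ ω, ‖Complex.exp ((t * linQuad b K (ε ω) : ℝ) * Complex.I)‖ = 1 :=
    fun ω => Complex.norm_exp_ofReal_mul_I _
  have hEm : AEStronglyMeasurable
      (fun ω => Complex.exp ((t * linQuad b K (ε ω) : ℝ) * Complex.I)) P := by
    have := (measurable_linQuad b K).comp h.measurable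
    have : Measurable fun ω => linQuad b K (ε ω) := this
    exact Measurable.aestronglyMeasurable (by fun_prop)
  have ia : ∀ g, Integrable
      (fun ω => clusterPart cl g (ε ω) ⬝ᵥ (b + (1 / 2 : ℝ) • K *ᵥ ε ω)) P := by
    intro g
    simpa only [hK.clusterPart_dotProduct_affine] using (h.memLp_clusterPart_dotProduct_rest g
      (measurable_affine_smul b K (1 / 2)) (h.memLp_affine_smul_rest b K _ g)).integrable (by norm_num)
  have iq : ∀ g (s : ℝ), Integrable (fun ω => clusterCov P cl ε g (b + (1 / 2 : ℝ) • K *ᵥ ε ω)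
      (b + s • K *ᵥ ε ω)) P := fun g s =>
    (memLp_clusterCov (h.memLp_affine_smul b K _) (h.memLp_affine_smul b K _)).integrable
      (by norm_num)
  have split : ∀ ω, ((linQuad b K (ε ω) : ℂ) - t * Complex.I * (steinVar P ε b K ω : ℂ))
      * Complex.exp ((t * linQuad b K (ε ω) : ℝ) * Complex.I)
      = ∑ g, (((clusterPart cl g (ε ω) ⬝ᵥ (b + (1 / 2 : ℝ) • K *ᵥ ε ω) : ℝ) : ℂ)
        - t * Complex.I * ((clusterCov P cl ε g (b + (1 / 2 : ℝ) • K *ᵥ ε ω)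
          (b + (1 : ℝ) • K *ᵥ ε ω) : ℝ) : ℂ))
        * Complex.exp ((t * linQuad b K (ε ω) : ℝ) * Complex.I) := by
    intro ω
    rw [← Finset.sum_mul, Finset.sum_sub_distrib, ← Finset.mul_sum, ← Complex.ofReal_sum,
      ← Complex.ofReal_sum, h.sum_clusterCov, ← sum_dotProduct, sum_clusterPart]
    rfl
  simp only [split]
  have hi : ∀ g, Integrable (fun ω => (((clusterPart cl g (ε ω) ⬝ᵥ (b + (1 / 2 : ℝ) • K *ᵥ ε ω) : ℝ)
        : ℂ) - t * Complex.I * ((clusterCov P cl ε g (b + (1 / 2 : ℝ) • K *ᵥ ε ω)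
          (b + (1 : ℝ) • K *ᵥ ε ω) : ℝ) : ℂ))
        * Complex.exp ((t * linQuad b K (ε ω) : ℝ) * Complex.I)) P := fun g =>
    ((ia g).ofReal.sub ((iq g 1).ofReal.const_mul _)).mul_bdd hEm (.of_forall fun ω => (hE ω).le)
  rw [integral_finsetSum _ fun g _ => hi g]
  refine (norm_sum_le _ _).trans ((Finset.sum_le_sum fun g _ => step g).trans ?_)
  rw [← Finset.mul_sum, Finset.sum_add_distrib, ← Finset.mul_sum, ← Finset.sum_div,
    ← integral_finsetSum _ fun g _ => iq g _]
  simp only [h.sum_clusterCov]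
  have h1 : (∑ g, ∫ ω, (clusterPart cl g (ε ω) ⬝ᵥ (b + (1 : ℝ) • K *ᵥ ε ω)) ^ 4 ∂P) / τ ≤ τ := by
    rw [div_le_iff₀ hτ, ← pow_two]
    exact hF
  calc _ ≤ 3 / 2 * t ^ 2 * (τ * 1 + τ) := by gcongr
    _ = _ := by ring

/-- Quantitative central limit theorem for linear plus hollow quadratic forms. -/
theorem norm_integral_exp_linQuad_sub_le (h : ClusterNoise P cl ε) {b : J → ℝ}
    {K : Matrix J J ℝ} (hK : IsHollow cl K) (hs : K.IsSymm) {δ : ℝ} (hδ : 0 < δ)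
    (hA : ∫ ω, (b + (1 / 2 : ℝ) • K *ᵥ ε ω) ⬝ᵥ crossMoment P ε ε *ᵥ (b + (1 / 2 : ℝ) • K *ᵥ ε ω) ∂P
      ≤ 1)
    (hF : ∑ g, ∫ ω, (clusterPart cl g (ε ω) ⬝ᵥ (b + (1 : ℝ) • K *ᵥ ε ω)) ^ 4 ∂P ≤ δ ^ 2)
    (hV : ∫ ω, (steinVar P ε b K ω - 1) ^ 2 ∂P ≤ δ ^ 2) (t : ℝ) :
    ‖∫ ω, Complex.exp ((t * linQuad b K (ε ω) : ℝ) * Complex.I) ∂P - Real.exp (-t ^ 2 / 2)‖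
      ≤ Real.exp (t ^ 2 / 2) * ((|t| + 3 * t ^ 2) * δ) * |t| := by
  have hWm : Measurable fun ω => linQuad b K (ε ω) := (measurable_linQuad b K).comp h.measurable
  have hWi : Integrable (fun ω => linQuad b K (ε ω)) P :=
    (h.memLp_two_linQuad b K).integrable (by norm_num)
  have hSi : Integrable (steinVar P ε b K) P := (h.memLp_two_steinVar b K).integrable (by norm_num)
  set E : ℝ → Ω → ℂ := fun t ω => Complex.exp ((t * linQuad b K (ε ω) : ℝ) * Complex.I) with hE
  have hEn : ∀ t ω, ‖E t ω‖ = 1 := fun t ω => Complex.norm_exp_ofReal_mul_I _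
  have hEm : ∀ t, AEStronglyMeasurable (E t) P := fun t => by
    exact Measurable.aestronglyMeasurable (by fun_prop)
  have hEi : ∀ t, Integrable (E t) P := fun t =>
    (integrable_const (1 : ℝ)).mono' (hEm t) (.of_forall fun ω => (hEn t ω).le)
  have bdd : ∀ {F : Ω → ℝ} (t : ℝ), Integrable F P → Integrable (fun ω => (F ω : ℂ) * E t ω) P :=
    fun t hF => hF.ofReal.mul_bdd (hEm t) (.of_forall fun ω => (hEn t ω).le)
  have hderiv : ∀ t, HasDerivAt (fun t => ∫ ω, E t ω ∂P)
      (∫ ω, Complex.I * ((linQuad b K (ε ω) : ℂ) * E t ω) ∂P) t := by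
    intro t
    refine (hasDerivAt_integral_of_dominated_loc_of_deriv_le (s := Set.univ)
      (F' := fun t ω => Complex.I * ((linQuad b K (ε ω) : ℂ) * E t ω))
      (bound := fun ω => |linQuad b K (ε ω)|) univ_mem (.of_forall hEm) (hEi t)
      ((bdd t hWi).const_mul _).aestronglyMeasurable (.of_forall fun ω s _ => ?_) hWi.abs
      (.of_forall fun ω s _ => ?_)).2
    · rw [norm_mul, norm_mul, hEn, Complex.norm_I, one_mul, mul_one, Complex.norm_real,
        Real.norm_eq_abs]
    · have h1 : HasDerivAt (fun s : ℝ => ((s * linQuad b K (ε ω) : ℝ) : ℂ) * Complex.I)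
          ((linQuad b K (ε ω) : ℂ) * Complex.I) s := by
        simpa using (((hasDerivAt_id s).mul_const (linQuad b K (ε ω))).ofReal_comp).mul_const
          Complex.I
      exact h1.cexp.congr_deriv (by ring)
  refine norm_sub_exp_neg_le_of_hasDerivAt hδ.le hderiv (by simp [hE]) (fun t => ?_) t
  have hmain := h.norm_integral_linQuad_sub_mul_exp_le hK hs hδ hA hF t
  -- Cauchy-Schwarz in the form `|y| ≤ δ/2 + y²/(2δ)`, with each half at most `δ/2` in expectation.
  have hrem : ‖∫ ω, ((1 - steinVar P ε b K ω : ℝ) : ℂ) * E t ω ∂P‖ ≤ δ := by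
    have hi2 : Integrable (fun ω => (steinVar P ε b K ω - 1) ^ 2) P :=
      ((h.memLp_two_steinVar b K).sub (memLp_const 1)).integrable_sq
    have hi : Integrable (fun ω => δ / 2 + (steinVar P ε b K ω - 1) ^ 2 / (2 * δ)) P :=
      (integrable_const _).add (hi2.div_const _)
    refine (norm_integral_le_of_norm_le hi (.of_forall fun ω => ?_)).trans ?_
    · rw [norm_mul, hEn, mul_one, Complex.norm_real, Real.norm_eq_abs, abs_sub_comm]
      set y := steinVar P ε b K ω - 1
      rw [← sq_abs y, div_add_div _ _ (by norm_num) (by positivity), le_div_iff₀ (by positivity)]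
      nlinarith [sq_nonneg (δ - |y|)]
    · rw [integral_add (integrable_const _) (hi2.div_const _), integral_const, integral_div,
        probReal_univ, one_smul]
      rw [div_add_div _ _ (by norm_num) (by positivity), div_le_iff₀ (by positivity)]
      nlinarith
  -- The defect `ψ' + tψ` is `i` times the Stein error plus `t` times the integrated deviation of
  -- the kernel from 1, since `i · (-it) = t`.
  have e : (∫ ω, Complex.I * ((linQuad b K (ε ω) : ℂ) * E t ω) ∂P) + t * ∫ ω, E t ω ∂P
      = Complex.I * (∫ ω, ((linQuad b K (ε ω) : ℂ) - t * Complex.I * (steinVar P ε b K ω : ℂ))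
        * E t ω ∂P) + t * ∫ ω, ((1 - steinVar P ε b K ω : ℝ) : ℂ) * E t ω ∂P := by
    have e1 : ∫ ω, ((linQuad b K (ε ω) : ℂ) - t * Complex.I * (steinVar P ε b K ω : ℂ)) * E t ω ∂P
        = (∫ ω, (linQuad b K (ε ω) : ℂ) * E t ω ∂P)
          - t * Complex.I * ∫ ω, (steinVar P ε b K ω : ℂ) * E t ω ∂P := by
      rw [← integral_const_mul, ← integral_sub (bdd t hWi) ((bdd t hSi).const_mul _)]
      exact integral_congr_ae (.of_forall fun ω => by simp only []; ring)
    have e2 : ∫ ω, ((1 - steinVar P ε b K ω : ℝ) : ℂ) * E t ω ∂P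
        = (∫ ω, E t ω ∂P) - ∫ ω, (steinVar P ε b K ω : ℂ) * E t ω ∂P := by
      rw [← integral_sub (hEi t) (bdd t hSi)]
      exact integral_congr_ae (.of_forall fun ω => by push_cast; ring)
    rw [e1, e2, integral_const_mul]
    linear_combination (t * ∫ ω, (steinVar P ε b K ω : ℂ) * E t ω ∂P) * (Complex.I_mul_I)
  rw [e]
  refine (norm_add_le _ _).trans ?_
  rw [norm_mul, norm_mul, Complex.norm_I, one_mul, Complex.norm_real, Real.norm_eq_abs]
  calc _ ≤ 3 * t ^ 2 * δ + |t| * δ := by gcongr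
    _ = _ := by ring

end ClusterNoise

/-! ### Conditioning and fourth moments of independent sums. -/

section IndepSums

variable {Ω : Type*} [MeasurableSpace Ω] {P : Measure Ω} [IsProbabilityMeasure P]

/-- Conditioning on one of two independent variables. -/
lemma ProbabilityTheory.IndepFun.integral_le_of_forall_integral_le {α β : Type*} [MeasurableSpace α]
    [MeasurableSpace β] {X : Ω → α} {Y : Ω → β} (hXY : IndepFun X Y P) (hX : Measurable X)
    (hY : Measurable Y) {f : α → β → ℝ} (hf : Measurable (Function.uncurry f))
    (h0 : ∀ x y, 0 ≤ f x y) (hi : Integrable (fun ω => f (X ω) (Y ω)) P) {B : α → ℝ}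
    (hB : Integrable (fun ω => B (X ω)) P) (hle : ∀ x, ∫ ω, f x (Y ω) ∂P ≤ B x) :
    ∫ ω, f (X ω) (Y ω) ∂P ≤ ∫ ω, B (X ω) ∂P := by
  have hm := (indepFun_iff_map_prod_eq_prod_map_map hX.aemeasurable hY.aemeasurable).1 hXY
  have : IsProbabilityMeasure (P.map X) := Measure.isProbabilityMeasure_map hX.aemeasurable
  have : IsProbabilityMeasure (P.map Y) := Measure.isProbabilityMeasure_map hY.aemeasurable
  have e1 : ∫ ω, f (X ω) (Y ω) ∂P = ∫ z, Function.uncurry f z ∂((P.map X).prod (P.map Y)) := by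
    rw [← hm, integral_map (hX.prodMk hY).aemeasurable hf.aestronglyMeasurable]
    rfl
  have i1 : Integrable (Function.uncurry f) ((P.map X).prod (P.map Y)) := by
    rw [← hm, integrable_map_measure hf.aestronglyMeasurable (hX.prodMk hY).aemeasurable]
    exact hi
  have hin : ∀ x, ∫ y, f x y ∂(P.map Y) = ∫ ω, f x (Y ω) ∂P := fun x =>
    integral_map hY.aemeasurable (hf.comp measurable_prodMk_left).aestronglyMeasurable
  have e2 := integral_map (μ := P) hX.aemeasurable i1.integral_prod_left.aestronglyMeasurable
  rw [e1, integral_prod _ i1, e2]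
  refine integral_mono_of_nonneg (.of_forall fun ω => integral_nonneg fun y => h0 _ _) hB
    (.of_forall fun ω => ?_)
  exact (hin (X ω)).le.trans (hle _)

/-- Induction on `s`: in `(S + X)⁴` the terms with a first power of `S` or `X` integrate to zero,
and the surviving `6 E[S²] E[X²]` is the cross term of three times the squared variance. -/
lemma integral_sum_pow_four_le {ι : Type*} {X : ι → Ω → ℝ} (hm : ∀ i, Measurable (X i))
    (h4 : ∀ i, MemLp (X i) 4 P) (h0 : ∀ i, ∫ ω, X i ω ∂P = 0) (hX : iIndepFun X P)
    (s : Finset ι) :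
    ∫ ω, (∑ i ∈ s, X i ω) ^ 2 ∂P = ∑ i ∈ s, ∫ ω, X i ω ^ 2 ∂P ∧
    ∫ ω, (∑ i ∈ s, X i ω) ^ 4 ∂P
      ≤ 3 * (∑ i ∈ s, ∫ ω, X i ω ^ 2 ∂P) ^ 2 + ∑ i ∈ s, ∫ ω, X i ω ^ 4 ∂P := by
  classical
  induction s using Finset.induction_on with
  | empty => simp
  | insert a s ha ih =>
    obtain ⟨ih2, ih4⟩ := ih
    set S : Ω → ℝ := fun ω => ∑ i ∈ s, X i ω with hS
    have hS4 : MemLp S 4 P := memLp_finsetSum _ fun i _ => h4 i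
    have ind : IndepFun S (X a) P := by
      have := hX.indepFun_finsetSum_of_notMem hm ha
      convert this using 1
      ext ω
      simp [hS]
    have hSm : Measurable S := Finset.measurable_sum _ fun i _ => hm i
    have pw : ∀ m n : ℕ, IndepFun (fun ω => S ω ^ m) (fun ω => X a ω ^ n) P := fun m n =>
      ind.comp (φ := fun x => x ^ m) (ψ := fun x => x ^ n) (by fun_prop) (by fun_prop)
    have hip : ∀ {f : Ω → ℝ} (n : ℕ), n ≤ 4 → MemLp f 4 P → Integrable (fun ω => f ω ^ n) P := by
      intro f n hn hf
      rcases n.eq_zero_or_pos with rfl | hn0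
      · simp
      have h1 : MemLp f n P := hf.mono_exponent (by exact_mod_cast hn)
      have h2 := h1.integrable_norm_pow hn0.ne'
      refine (integrable_norm_iff ((by fun_prop : Continuous fun y : ℝ => y ^ n)
        |>.comp_aestronglyMeasurable hf.aestronglyMeasurable)).1 ?_
      simpa using h2
    have E : ∀ m n : ℕ, m ≤ 4 → n ≤ 4 → Integrable (fun ω => S ω ^ m * X a ω ^ n) P ∧
        ∫ ω, S ω ^ m * X a ω ^ n ∂P = (∫ ω, S ω ^ m ∂P) * ∫ ω, X a ω ^ n ∂P := fun m n h1 h2 =>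
      ⟨(pw m n).integrable_mul (hip m h1 hS4) (hip n h2 (h4 a)),
        (pw m n).integral_fun_mul_eq_mul_integral (hSm.pow_const m).aestronglyMeasurable
          ((hm a).pow_const n).aestronglyMeasurable⟩
    have hS0 : ∫ ω, S ω ∂P = 0 := by
      rw [hS, integral_finsetSum _ fun i _ => (h4 i).integrable (by norm_num)]
      exact Finset.sum_eq_zero fun i _ => h0 i
    have ex2 : ∀ ω, (∑ i ∈ insert a s, X i ω) ^ 2
        = S ω ^ 2 * X a ω ^ 0 + (2 * (S ω ^ 1 * X a ω ^ 1) + S ω ^ 0 * X a ω ^ 2) := by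
      intro ω
      rw [Finset.sum_insert ha]
      simp only [hS]
      ring
    have ex4 : ∀ ω, (∑ i ∈ insert a s, X i ω) ^ 4
        = S ω ^ 4 * X a ω ^ 0 + (4 * (S ω ^ 3 * X a ω ^ 1) + (6 * (S ω ^ 2 * X a ω ^ 2)
          + (4 * (S ω ^ 1 * X a ω ^ 3) + S ω ^ 0 * X a ω ^ 4))) := by
      intro ω
      rw [Finset.sum_insert ha]
      simp only [hS]
      ring
    have i20 := (E 2 0 (by norm_num) (by norm_num)).1
    have i11 := (E 1 1 (by norm_num) (by norm_num)).1.const_mul 2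
    have i02 := (E 0 2 (by norm_num) (by norm_num)).1
    have i40 := (E 4 0 (by norm_num) (by norm_num)).1
    have i31 := (E 3 1 (by norm_num) (by norm_num)).1.const_mul 4
    have i22 := (E 2 2 (by norm_num) (by norm_num)).1.const_mul 6
    have i13 := (E 1 3 (by norm_num) (by norm_num)).1.const_mul 4
    have i04 := (E 0 4 (by norm_num) (by norm_num)).1
    simp only [ex2, ex4]
    simp only [Finset.sum_insert ha]
    rw [integral_add i20 (i11.fun_add i02), integral_add i11 i02,
      integral_add i40 (i31.fun_add (i22.fun_add (i13.fun_add i04))), integral_add i31 (i22.fun_add (i13.fun_add i04)),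
      integral_add i22 (i13.fun_add i04), integral_add i13 i04]
    simp only [integral_const_mul]
    rw [(E 2 0 (by norm_num) (by norm_num)).2, (E 1 1 (by norm_num) (by norm_num)).2,
      (E 0 2 (by norm_num) (by norm_num)).2, (E 4 0 (by norm_num) (by norm_num)).2,
      (E 3 1 (by norm_num) (by norm_num)).2, (E 2 2 (by norm_num) (by norm_num)).2,
      (E 1 3 (by norm_num) (by norm_num)).2, (E 0 4 (by norm_num) (by norm_num)).2]
    simp only [pow_zero, pow_one, integral_const, probReal_univ, one_smul, h0, hS0, mul_one,
      one_mul, mul_zero, zero_mul, zero_add]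
    refine ⟨by rw [ih2]; ring, ?_⟩
    rw [ih2]
    nlinarith [sq_nonneg (∫ ω, X a ω ^ 2 ∂P)]

end IndepSums

/-! ### Second moments and hollow forms in terms of spectral and Frobenius norms. -/

namespace ClusterNoise

open ClusterDesign (crossMoment)

variable {J ι : Type} [Fintype J] [DecidableEq ι] [Fintype ι] {Ω : Type*} [MeasurableSpace Ω]
  {P : Measure Ω} [IsProbabilityMeasure P] {cl : J → ι} {ε : Ω → J → ℝ}

/-- Squared Frobenius norm. -/
def _root_.frobSq (K : Matrix J J ℝ) : ℝ := ∑ i, K.row i ⬝ᵥ K.row i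

lemma _root_.dotProduct_self_nonneg' (x : J → ℝ) : 0 ≤ x ⬝ᵥ x :=
  Finset.sum_nonneg fun _ _ => mul_self_nonneg _

lemma _root_.dotProduct_sq_le (x y : J → ℝ) : (x ⬝ᵥ y) ^ 2 ≤ (x ⬝ᵥ x) * (y ⬝ᵥ y) := by
  have := Finset.sum_mul_sq_le_sq_mul_sq Finset.univ x y
  simpa only [dotProduct, pow_two] using this

lemma _root_.frobSq_nonneg (K : Matrix J J ℝ) : 0 ≤ frobSq K :=
  Finset.sum_nonneg fun _ _ => dotProduct_self_nonneg' _

lemma integral_dotProduct_sq_le (h : ClusterNoise P cl ε) {u : ℝ}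
    (hu : ∀ y : J → ℝ, y ⬝ᵥ crossMoment P ε ε *ᵥ y ≤ u * (y ⬝ᵥ y)) (y : J → ℝ) :
    ∫ ω, (y ⬝ᵥ ε ω) ^ 2 ∂P ≤ u * (y ⬝ᵥ y) := by
  simp only [pow_two, h.integral_dotProduct_mul]
  exact hu y

lemma integrable_mulVec_dotProduct_mulVec (h : ClusterNoise P cl ε) (K : Matrix J J ℝ) :
    Integrable (fun ω => K *ᵥ ε ω ⬝ᵥ K *ᵥ ε ω) P := by
  refine integrable_finsetSum _ fun j _ => ?_
  have := memLp_mulVec K h.memLp j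
  exact this.two_of_four.integrable_mul this.two_of_four

lemma integral_mulVec_dotProduct_mulVec_le (h : ClusterNoise P cl ε) {u : ℝ}
    (hu : ∀ y : J → ℝ, y ⬝ᵥ crossMoment P ε ε *ᵥ y ≤ u * (y ⬝ᵥ y)) (K : Matrix J J ℝ) :
    ∫ ω, K *ᵥ ε ω ⬝ᵥ K *ᵥ ε ω ∂P ≤ u * frobSq K := by
  have e : ∀ ω, K *ᵥ ε ω ⬝ᵥ K *ᵥ ε ω = ∑ j, (K.row j ⬝ᵥ ε ω) ^ 2 := fun ω =>
    Finset.sum_congr rfl fun j _ => (pow_two _).symm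
  simp only [e]
  rw [integral_finsetSum _ fun j _ => (h.memLp_dotProduct _).two_of_four.integrable_sq, frobSq,
    Finset.mul_sum]
  exact Finset.sum_le_sum fun j _ => h.integral_dotProduct_sq_le hu _

lemma mul_frobSq_le_integral (h : ClusterNoise P cl ε) {c : ℝ}
    (hc : ∀ y : J → ℝ, c * (y ⬝ᵥ y) ≤ y ⬝ᵥ crossMoment P ε ε *ᵥ y) (K : Matrix J J ℝ) :
    c * frobSq K ≤ ∫ ω, K *ᵥ ε ω ⬝ᵥ K *ᵥ ε ω ∂P := by
  have e : ∀ ω, K *ᵥ ε ω ⬝ᵥ K *ᵥ ε ω = ∑ j, (K.row j ⬝ᵥ ε ω) * (K.row j ⬝ᵥ ε ω) := fun ω => rfl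
  simp only [e]
  have hi : ∀ j, Integrable (fun ω => (K.row j ⬝ᵥ ε ω) * (K.row j ⬝ᵥ ε ω)) P := fun j =>
    (h.memLp_dotProduct _).two_of_four.integrable_mul (h.memLp_dotProduct _).two_of_four
  rw [integral_finsetSum _ fun j _ => hi j, frobSq, Finset.mul_sum]
  exact Finset.sum_le_sum fun j _ => (hc _).trans (h.integral_dotProduct_mul _ _).ge

/-- `|Sx|² ≤ u²|x|²` for the covariance matrix `S ≤ u`. -/
lemma crossMoment_mulVec_sq_le (h : ClusterNoise P cl ε) {u : ℝ} (hu0 : 0 < u)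
    (hu : ∀ y : J → ℝ, y ⬝ᵥ crossMoment P ε ε *ᵥ y ≤ u * (y ⬝ᵥ y)) (x : J → ℝ) :
    crossMoment P ε ε *ᵥ x ⬝ᵥ crossMoment P ε ε *ᵥ x ≤ u ^ 2 * (x ⬝ᵥ x) := by
  -- Weight `τ = u` and second vector `Sx`: this reads `2|Sx|² ≤ u x'Sx + (Sx)'S(Sx)/u`, whose right
  -- side is at most `u²|x|² + |Sx|²`.
  have h1 := h.two_mul_abs_crossMoment_mul_le x (crossMoment P ε ε *ᵥ x) 1 hu0
  rw [dotProduct_mulVec_comm_of_isSymm (crossMoment_isSymm P ε) x (crossMoment P ε ε *ᵥ x)] at h1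
  have h2 := hu x
  have h3 := hu (crossMoment P ε ε *ᵥ x)
  have h0 := dotProduct_self_nonneg' (crossMoment P ε ε *ᵥ x)
  rw [abs_of_nonneg h0, abs_one, mul_one, one_pow, one_mul] at h1
  have h4 : crossMoment P ε ε *ᵥ x ⬝ᵥ crossMoment P ε ε *ᵥ (crossMoment P ε ε *ᵥ x) / u
      ≤ crossMoment P ε ε *ᵥ x ⬝ᵥ crossMoment P ε ε *ᵥ x := by
    rw [div_le_iff₀ hu0, mul_comm _ u]
    exact h3
  nlinarith

/-- Row `i` of `KSK` is `KS` applied to row `i` of `K`, so operator bounds for `K` and `S` act row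
by row and only one Frobenius norm is spent. -/
lemma frobSq_mul_crossMoment_mul_le (h : ClusterNoise P cl ε) {u ν : ℝ} (hu0 : 0 < u)
    (hu : ∀ y : J → ℝ, y ⬝ᵥ crossMoment P ε ε *ᵥ y ≤ u * (y ⬝ᵥ y)) {K : Matrix J J ℝ}
    (hs : K.IsSymm) (hν0 : 0 ≤ ν) (hν : ∀ x : J → ℝ, K *ᵥ x ⬝ᵥ K *ᵥ x ≤ ν * (x ⬝ᵥ x)) :
    frobSq (K * crossMoment P ε ε * K) ≤ ν * u ^ 2 * frobSq K := by
  rw [frobSq, frobSq, Finset.mul_sum]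
  refine Finset.sum_le_sum fun i _ => ?_
  have e : (K * crossMoment P ε ε * K).row i = K *ᵥ (crossMoment P ε ε *ᵥ K.row i) := by
    ext j
    rw [Matrix.mulVec_mulVec]
    have : (K * crossMoment P ε ε * K)ᵀ = K * crossMoment P ε ε * K := by
      rw [Matrix.transpose_mul, Matrix.transpose_mul, hs.eq, (crossMoment_isSymm P ε).eq,
        Matrix.mul_assoc]
    have hj := congrFun (congrFun this j) i
    rw [Matrix.transpose_apply] at hj
    rw [Matrix.row_apply, hj, Matrix.mul_apply]
    exact Finset.sum_congr rfl fun k _ => by rw [Matrix.row_apply, hs.apply]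
  rw [e]
  calc _ ≤ ν * (crossMoment P ε ε *ᵥ K.row i ⬝ᵥ crossMoment P ε ε *ᵥ K.row i) := hν _
    _ ≤ ν * (u ^ 2 * (K.row i ⬝ᵥ K.row i)) := by
      gcongr
      exact h.crossMoment_mulVec_sq_le hu0 hu _
    _ = _ := by ring

/-- The second moment of a hollow quadratic form. -/
lemma integral_linQuad_zero_sq_le (h : ClusterNoise P cl ε) {u : ℝ} (hu0 : 0 < u)
    (hu : ∀ y : J → ℝ, y ⬝ᵥ crossMoment P ε ε *ᵥ y ≤ u * (y ⬝ᵥ y)) {K : Matrix J J ℝ}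
    (hK : IsHollow cl K) (hs : K.IsSymm) :
    ∫ ω, linQuad 0 K (ε ω) ∂P = 0 ∧ ∫ ω, linQuad 0 K (ε ω) ^ 2 ∂P ≤ u ^ 2 * frobSq K := by
  set A : (J → ℝ) → J → ℝ := fun x => 0 + (1 / 2 : ℝ) • K *ᵥ x with hA
  set D : (J → ℝ) → J → ℝ := fun x => 0 + (1 : ℝ) • K *ᵥ x with hD
  have hAm : Measurable A := measurable_affine_smul 0 K _
  have hDm : Measurable D := measurable_affine_smul 0 K _
  have hAi : ∀ g j, MemLp (fun ω => A (clusterRest cl g (ε ω)) j) 4 P :=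
    h.memLp_affine_smul_rest 0 K _
  have hDi : ∀ g j, MemLp (fun ω => D (clusterRest cl g (ε ω)) j) 4 P :=
    h.memLp_affine_smul_rest 0 K _
  set a : ι → Ω → ℝ := fun g ω => clusterPart cl g (ε ω) ⬝ᵥ A (clusterRest cl g (ε ω)) with ha
  set d : ι → Ω → ℝ := fun g ω => clusterPart cl g (ε ω) ⬝ᵥ D (clusterRest cl g (ε ω)) with hd
  have a4 : ∀ g, MemLp (a g) 4 P := fun g => h.memLp_clusterPart_dotProduct_rest g hAm (hAi g)
  have d4 : ∀ g, MemLp (d g) 4 P := fun g => h.memLp_clusterPart_dotProduct_rest g hDm (hDi g)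
  have hW : ∀ ω, linQuad 0 K (ε ω) = ∑ g, a g ω := fun ω =>
    (sum_clusterPart_dotProduct_rest hK 0 (ε ω)).symm
  have hWd : ∀ g ω, linQuad 0 K (ε ω) = linQuad 0 K (clusterRest cl g (ε ω)) + d g ω := by
    intro g ω
    simp only [hd, hD]
    rw [one_smul, ← linQuad_eq_rest_add hK hs]
  have a0 : ∀ g, ∫ ω, a g ω ∂P = 0 := fun g => by
    simpa using h.integral_clusterPart_dotProduct_mul (𝕜 := ℝ) g hAm (f := fun _ => 1)
      measurable_const fun j => by simpa using (hAi g j).integrable (by norm_num)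
  have W2 := h.memLp_two_linQuad 0 K
  have Wr2 : ∀ g, MemLp (fun ω => linQuad 0 K (clusterRest cl g (ε ω))) 2 P := fun g => by
    have := W2.sub (d4 g).two_of_four
    refine this.ae_eq (.of_forall fun ω => ?_)
    simp only [Pi.sub_apply]
    rw [hWd g ω, add_sub_cancel_right]
  refine ⟨?_, ?_⟩
  · simp only [hW]
    rw [integral_finsetSum _ fun g _ => (a4 g).integrable (by norm_num)]
    exact Finset.sum_eq_zero fun g _ => a0 g
  have iaW : ∀ g, Integrable (fun ω => a g ω * linQuad 0 K (clusterRest cl g (ε ω))) P := fun g =>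
    (a4 g).two_of_four.integrable_mul (Wr2 g)
  have iad : ∀ g, Integrable (fun ω => a g ω * d g ω) P := fun g =>
    (a4 g).two_of_four.integrable_mul (d4 g).two_of_four
  -- One factor is written as the sum of cluster shares `a_g`, and in the product with `a_g` the
  -- other factor is split as its value without cluster `g` plus `d_g`. Only `a_g d_g` has nonzero
  -- mean.
  have e1 : ∀ ω, linQuad 0 K (ε ω) ^ 2
      = ∑ g, (a g ω * linQuad 0 K (clusterRest cl g (ε ω)) + a g ω * d g ω) := by
    intro ω
    rw [pow_two]
    nth_rewrite 1 [hW]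
    rw [Finset.sum_mul]
    refine Finset.sum_congr rfl fun g _ => ?_
    rw [← mul_add, ← hWd]
  have e2 : ∀ g, ∫ ω, a g ω * linQuad 0 K (clusterRest cl g (ε ω)) ∂P = 0 := fun g =>
    h.integral_clusterPart_dotProduct_mul (𝕜 := ℝ) g hAm (measurable_linQuad 0 K)
      fun j => (hAi g j).two_of_four.integrable_mul (Wr2 g)
  have e3 : ∀ g, ∫ ω, a g ω * d g ω ∂P
      = ∫ ω, clusterCov P cl ε g (0 + (1 / 2 : ℝ) • K *ᵥ ε ω) (0 + (1 : ℝ) • K *ᵥ ε ω) ∂P := by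
    intro g
    have := h.integral_clusterPart_dotProduct_mul_mul (𝕜 := ℝ) g hAm hDm (f := fun _ => 1)
      measurable_const (fun j k => by
        simpa using (MemLp.mul' (hDi g k) (hAi g j) (r := 2)).integrable (by norm_num))
    refine Eq.trans ?_ (integral_congr_ae (.of_forall fun ω => hK.clusterCov_rest g 0 0 (ε ω) _ _))
    simp only [RCLike.ofReal_real_eq_id, id, mul_one] at this
    exact this
  have hi : ∀ g, Integrable (fun ω => clusterCov P cl ε g (0 + (1 / 2 : ℝ) • K *ᵥ ε ω)
      (0 + (1 : ℝ) • K *ᵥ ε ω)) P := fun g =>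
    (memLp_clusterCov (h.memLp_affine_smul 0 K _) (h.memLp_affine_smul 0 K _)).integrable
      (by norm_num)
  have e4 : ∀ g, ∫ ω, (a g ω * linQuad 0 K (clusterRest cl g (ε ω)) + a g ω * d g ω) ∂P
      = ∫ ω, clusterCov P cl ε g (0 + (1 / 2 : ℝ) • K *ᵥ ε ω) (0 + (1 : ℝ) • K *ᵥ ε ω) ∂P := by
    intro g
    rw [integral_add (iaW _) (iad _), e2, e3, zero_add]
  simp only [e1]
  rw [integral_finsetSum _ fun g _ => (iaW g).fun_add (iad g)]
  simp only [e4]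
  rw [← integral_finsetSum _ fun g _ => hi g]
  simp only [h.sum_clusterCov, zero_add, one_smul, smul_dotProduct, smul_eq_mul]
  rw [integral_const_mul]
  have hle : ∫ ω, K *ᵥ ε ω ⬝ᵥ crossMoment P ε ε *ᵥ K *ᵥ ε ω ∂P
      ≤ ∫ ω, u * (K *ᵥ ε ω ⬝ᵥ K *ᵥ ε ω) ∂P :=
    integral_mono_of_nonneg (.of_forall fun ω => h.dotProduct_crossMoment_self_nonneg _)
      ((h.integrable_mulVec_dotProduct_mulVec K).const_mul u) (.of_forall fun ω => hu _)
  rw [integral_const_mul] at hle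
  have h2 := mul_le_mul_of_nonneg_left (h.integral_mulVec_dotProduct_mulVec_le hu K) hu0.le
  have h3 : 0 ≤ u ^ 2 * frobSq K := mul_nonneg (sq_nonneg _) (frobSq_nonneg K)
  nlinarith

/-- The key moment bound, applied to a matrix acting on one cluster. -/
lemma integral_mulVec_clusterPart_sq_le (h : ClusterNoise P cl ε) {g : ι} {φ ν : ℝ}
    (hφ : ∀ y : J → ℝ, ∫ ω, (y ⬝ᵥ clusterPart cl g (ε ω)) ^ 2
      * (clusterPart cl g (ε ω) ⬝ᵥ clusterPart cl g (ε ω)) ∂P ≤ φ * (y ⬝ᵥ y))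
    (Y : Matrix J J ℝ) (hν0 : 0 ≤ ν)
    (hν : ∀ x, Y *ᵥ clusterPart cl g x ⬝ᵥ Y *ᵥ clusterPart cl g x
      ≤ ν * (clusterPart cl g x ⬝ᵥ clusterPart cl g x)) :
    ∫ ω, (Y *ᵥ clusterPart cl g (ε ω) ⬝ᵥ Y *ᵥ clusterPart cl g (ε ω)) ^ 2 ∂P
      ≤ φ * ν * ∑ i, clusterPart cl g (Y.row i) ⬝ᵥ clusterPart cl g (Y.row i) := by
  have hp4 := memLp_clusterPart cl g h.memLp
  have hd4 : ∀ y : J → ℝ, MemLp (fun ω => y ⬝ᵥ clusterPart cl g (ε ω)) 4 P := fun y =>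
    memLp_finsetSum _ fun j _ => (hp4 j).const_mul _
  have hn2 : MemLp (fun ω => clusterPart cl g (ε ω) ⬝ᵥ clusterPart cl g (ε ω)) 2 P :=
    memLp_finsetSum _ fun j _ => MemLp.mul (hp4 j) (hp4 j)
  have hi : ∀ y : J → ℝ, Integrable (fun ω => (y ⬝ᵥ clusterPart cl g (ε ω)) ^ 2
      * (clusterPart cl g (ε ω) ⬝ᵥ clusterPart cl g (ε ω))) P := fun y => by
    have : MemLp (fun ω => (y ⬝ᵥ clusterPart cl g (ε ω)) ^ 2) 2 P := by
      simpa only [pow_two] using MemLp.mul' (hd4 y) (hd4 y)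
    exact this.integrable_mul hn2
  -- One factor of the square is expanded over the rows of `Y`, the other is bounded by `ν|ε_g|²`;
  -- each row then has the shape to which `hφ` applies.
  have hle : ∀ ω, (Y *ᵥ clusterPart cl g (ε ω) ⬝ᵥ Y *ᵥ clusterPart cl g (ε ω)) ^ 2
      ≤ ν * ∑ i, (clusterPart cl g (Y.row i) ⬝ᵥ clusterPart cl g (ε ω)) ^ 2
        * (clusterPart cl g (ε ω) ⬝ᵥ clusterPart cl g (ε ω)) := by
    intro ω
    have e : Y *ᵥ clusterPart cl g (ε ω) ⬝ᵥ Y *ᵥ clusterPart cl g (ε ω)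
        = ∑ i, (clusterPart cl g (Y.row i) ⬝ᵥ clusterPart cl g (ε ω)) ^ 2 := by
      refine Finset.sum_congr rfl fun i _ => ?_
      rw [clusterPart_dotProduct_clusterPart, ← pow_two]
      rfl
    rw [pow_two]
    nth_rewrite 1 [e]
    rw [← Finset.sum_mul, mul_left_comm]
    exact mul_le_mul_of_nonneg_left (hν _) (Finset.sum_nonneg fun i _ => sq_nonneg _)
  refine (integral_mono_of_nonneg (.of_forall fun ω => sq_nonneg _)
    ((integrable_finsetSum _ fun i _ => hi _).const_mul ν) (.of_forall hle)).trans ?_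
  rw [integral_const_mul, integral_finsetSum _ fun i _ => hi _, mul_comm φ, mul_assoc]
  refine mul_le_mul_of_nonneg_left ?_ hν0
  rw [Finset.mul_sum]
  exact Finset.sum_le_sum fun i _ => hφ _

lemma _root_.sum_clusterPart_row (cl : J → ι) (Y : Matrix J J ℝ) :
    ∑ g, ∑ i, clusterPart cl g (Y.row i) ⬝ᵥ clusterPart cl g (Y.row i) = frobSq Y := by
  rw [Finset.sum_comm, frobSq]
  refine Finset.sum_congr rfl fun i _ => ?_
  simp only [clusterPart_dotProduct_clusterPart]
  exact sum_dotProduct_clusterPart cl _ _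

end ClusterNoise

/-! ### Separating within-cluster and between-cluster parts of a quadratic form. -/

section Hollow

variable {J ι : Type} [Fintype J] [DecidableEq ι]

/-- The matrix `R` with its within-cluster entries set to zero. -/
def hollowPart (cl : J → ι) (R : Matrix J J ℝ) : Matrix J J ℝ :=
  Matrix.of fun i j => if cl i = cl j then 0 else R i j

lemma isHollow_hollowPart (cl : J → ι) (R : Matrix J J ℝ) : IsHollow cl (hollowPart cl R) :=
  fun i j hij => by simp [hollowPart, hij]

lemma isSymm_hollowPart (cl : J → ι) {R : Matrix J J ℝ} (hR : R.IsSymm) :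
    (hollowPart cl R).IsSymm := by
  ext i j
  simp only [hollowPart, Matrix.transpose_apply, Matrix.of_apply, eq_comm (a := cl j), hR.apply i j]

lemma frobSq_hollowPart_le (cl : J → ι) (R : Matrix J J ℝ) : frobSq (hollowPart cl R) ≤ frobSq R := by
  refine Finset.sum_le_sum fun i _ => Finset.sum_le_sum fun j _ => ?_
  simp only [hollowPart, Matrix.row_apply, Matrix.of_apply]
  split_ifs
  · simpa using mul_self_nonneg _
  · rfl

lemma dotProduct_mulVec_eq_sum_add [Fintype ι] (cl : J → ι) (R : Matrix J J ℝ) (x : J → ℝ) :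
    x ⬝ᵥ R *ᵥ x = ∑ g, clusterPart cl g x ⬝ᵥ R *ᵥ clusterPart cl g x
      + 2 * linQuad 0 (hollowPart cl R) x := by
  have e : 2 * linQuad 0 (hollowPart cl R) x = x ⬝ᵥ hollowPart cl R *ᵥ x := by
    rw [linQuad, zero_add, dotProduct_smul, smul_eq_mul]
    ring
  rw [e]
  simp only [dotProduct, Matrix.mulVec, clusterPart, hollowPart, Matrix.of_apply]
  rw [Finset.sum_comm, ← Finset.sum_add_distrib]
  refine Finset.sum_congr rfl fun i _ => ?_
  simp only [ite_mul, zero_mul, Finset.sum_ite_eq, Finset.mem_univ, if_true]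
  rw [← mul_add, ← Finset.sum_add_distrib]
  congr 1
  refine Finset.sum_congr rfl fun j _ => ?_
  by_cases hij : cl i = cl j
  · simp [hij]
  · simp [hij, Ne.symm hij]

end Hollow

/-! ### Variance of the Stein kernel, fourth moments of the increments, explicit approximation. -/

namespace ClusterNoise

open ClusterDesign (crossMoment)

variable {J ι : Type} [Fintype J] [DecidableEq ι] [Fintype ι] {Ω : Type*} [MeasurableSpace Ω]
  {P : Measure Ω} [IsProbabilityMeasure P] {cl : J → ι} {ε : Ω → J → ℝ}

lemma integral_sum_sub_sq_le {Q : ι → Ω → ℝ} (hQ : ∀ g, MemLp (Q g) 2 P)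
    (hind : Pairwise fun i j => IndepFun (Q i) (Q j) P) :
    ∫ ω, (∑ g, (Q g ω - ∫ ω, Q g ω ∂P)) ^ 2 ∂P ≤ ∑ g, ∫ ω, Q g ω ^ 2 ∂P := by
  have h1 := IndepFun.variance_sum (s := Finset.univ) (fun g _ => hQ g)
    (fun i _ j _ hij => hind hij)
  have h2 : AEMeasurable (∑ g, Q g) P :=
    (memLp_finsetSum' _ fun g _ => hQ g).aestronglyMeasurable.aemeasurable
  rw [variance_eq_integral h2] at h1
  have e : ∫ ω, (∑ g, Q g) ω ∂P = ∑ g, ∫ ω, Q g ω ∂P := by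
    simp only [Finset.sum_apply]
    exact integral_finsetSum _ fun g _ => (hQ g).integrable (by norm_num)
  calc _ = ∫ ω, ((∑ g, Q g) ω - ∫ ω, (∑ g, Q g) ω ∂P) ^ 2 ∂P := by
        rw [e]
        simp only [Finset.sum_apply, Finset.sum_sub_distrib]
    _ = _ := h1
    _ ≤ _ := Finset.sum_le_sum fun g _ => by
      simpa using variance_le_expectation_sq (hQ g).aestronglyMeasurable

/-- The kernel is constant plus linear plus quadratic in the noise. The two linear terms have
coefficients `1` and `½` and coincide by symmetry, which gives `3/2`. -/
lemma steinVar_eq {K : Matrix J J ℝ} (hs : K.IsSymm) (b : J → ℝ) (ω : Ω) :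
    steinVar P ε b K ω = b ⬝ᵥ crossMoment P ε ε *ᵥ b
      + 3 / 2 * (K *ᵥ (crossMoment P ε ε *ᵥ b) ⬝ᵥ ε ω)
      + 1 / 2 * (ε ω ⬝ᵥ (K * crossMoment P ε ε * K) *ᵥ ε ω) := by
  have hS := crossMoment_isSymm P ε
  have e1 : K *ᵥ ε ω ⬝ᵥ crossMoment P ε ε *ᵥ b = K *ᵥ (crossMoment P ε ε *ᵥ b) ⬝ᵥ ε ω := by
    rw [dotProduct_comm, dotProduct_mulVec_comm_of_isSymm hs, dotProduct_comm]
  have e2 : b ⬝ᵥ crossMoment P ε ε *ᵥ K *ᵥ ε ω = K *ᵥ (crossMoment P ε ε *ᵥ b) ⬝ᵥ ε ω := by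
    rw [dotProduct_mulVec_comm_of_isSymm hS, e1]
  have e3 : K *ᵥ ε ω ⬝ᵥ crossMoment P ε ε *ᵥ K *ᵥ ε ω
      = ε ω ⬝ᵥ (K * crossMoment P ε ε * K) *ᵥ ε ω := by
    rw [dotProduct_comm, dotProduct_mulVec_comm_of_isSymm hs, Matrix.mulVec_mulVec,
      Matrix.mulVec_mulVec]
  simp only [steinVar, one_smul, add_dotProduct, dotProduct_add, Matrix.mulVec_add, smul_dotProduct,
    smul_eq_mul, e1, e2, e3]
  ring

/-- The centred kernel is a linear form, a sum of centred within-cluster forms independent across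
clusters, and a hollow form. These need, in turn, second moments only, the moment bound `φ`, and the
second moment of hollow forms. -/
theorem integral_steinVar_sub_sq_le (h : ClusterNoise P cl ε) {u φ ν₀ ν₁ : ℝ} (hu0 : 0 < u)
    (hu : ∀ y : J → ℝ, y ⬝ᵥ crossMoment P ε ε *ᵥ y ≤ u * (y ⬝ᵥ y))
    (hφ : ∀ g, ∀ y : J → ℝ, ∫ ω, (y ⬝ᵥ clusterPart cl g (ε ω)) ^ 2
      * (clusterPart cl g (ε ω) ⬝ᵥ clusterPart cl g (ε ω)) ∂P ≤ φ * (y ⬝ᵥ y))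
    {K : Matrix J J ℝ} (hs : K.IsSymm) (hν₀0 : 0 ≤ ν₀) (hν₁0 : 0 ≤ ν₁)
    (hν₀ : ∀ x : J → ℝ, K *ᵥ x ⬝ᵥ K *ᵥ x ≤ ν₀ * (x ⬝ᵥ x))
    (hν₁ : ∀ g x, K *ᵥ clusterPart cl g x ⬝ᵥ K *ᵥ clusterPart cl g x
      ≤ ν₁ * (clusterPart cl g x ⬝ᵥ clusterPart cl g x)) (b : J → ℝ) :
    ∫ ω, (steinVar P ε b K ω - ∫ ω, steinVar P ε b K ω ∂P) ^ 2 ∂P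
      ≤ 7 * (u ^ 3 * ν₀ * (b ⬝ᵥ b)) + u ^ 2 * φ * ν₁ * frobSq K + 3 * (u ^ 4 * ν₀ * frobSq K) := by
  set R := K * crossMoment P ε ε * K with hR
  have hRs : R.IsSymm := by
    rw [Matrix.IsSymm, hR, Matrix.transpose_mul, Matrix.transpose_mul, hs.eq,
      (crossMoment_isSymm P ε).eq, Matrix.mul_assoc]
  set y := K *ᵥ (crossMoment P ε ε *ᵥ b) with hy
  set L : Ω → ℝ := fun ω => y ⬝ᵥ ε ω with hL
  set Q : ι → Ω → ℝ := fun g ω => clusterPart cl g (ε ω) ⬝ᵥ R *ᵥ clusterPart cl g (ε ω) with hQ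
  set T : Ω → ℝ := fun ω => linQuad 0 (hollowPart cl R) (ε ω) with hT
  have hL2 : MemLp L 2 P := (h.memLp_dotProduct y).two_of_four
  have hp4 := fun g => memLp_clusterPart cl g h.memLp
  have hQ2 : ∀ g, MemLp (Q g) 2 P := fun g => memLp_two_dotProduct_mulVec R (hp4 g) (hp4 g)
  have hT2 : MemLp T 2 P := h.memLp_two_linQuad 0 _
  have hT' := h.integral_linQuad_zero_sq_le hu0 hu (isHollow_hollowPart cl R)
    (isSymm_hollowPart cl hRs)
  have hst : ∀ ω, steinVar P ε b K ω = b ⬝ᵥ crossMoment P ε ε *ᵥ b + 3 / 2 * L ω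
      + (1 / 2 * ∑ g, Q g ω + T ω) := fun ω => by
    rw [steinVar_eq hs, dotProduct_mulVec_eq_sum_add cl (K * crossMoment P ε ε * K)]
    simp only [hL, hQ, hT, hR, hy]
    ring
  have hL0 : ∫ ω, L ω ∂P = 0 := by
    simp only [hL, dotProduct]
    rw [integral_finsetSum _ fun j _ => ((h.memLp_two j).integrable (by norm_num)).const_mul _]
    simp [integral_const_mul, h.mean]
  have iL := hL2.integrable (q := 2) (by norm_num)
  have iQ := fun g => (hQ2 g).integrable (q := 2) (by norm_num)
  have iT := hT2.integrable (q := 2) (by norm_num)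
  have iS : Integrable (fun ω => ∑ g, Q g ω) P := integrable_finsetSum _ fun g _ => iQ g
  have hmean : ∫ ω, steinVar P ε b K ω ∂P = b ⬝ᵥ crossMoment P ε ε *ᵥ b
      + 1 / 2 * ∑ g, ∫ ω, Q g ω ∂P := by
    simp only [hst]
    rw [integral_add ((integrable_const _).fun_add (iL.const_mul _)) ((iS.const_mul _).fun_add iT),
      integral_add (integrable_const _) (iL.const_mul _), integral_add (iS.const_mul _) iT,
      integral_const_mul, integral_const_mul, hL0, hT'.1, integral_finsetSum _ fun g _ => iQ g]
    simp
  have hdev : ∀ ω, steinVar P ε b K ω - ∫ ω, steinVar P ε b K ω ∂P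
      = 3 / 2 * L ω + 1 / 2 * (∑ g, (Q g ω - ∫ ω, Q g ω ∂P)) + T ω := fun ω => by
    rw [hst, hmean, Finset.sum_sub_distrib]
    ring
  have hc2 : MemLp (fun ω => ∑ g, (Q g ω - ∫ ω, Q g ω ∂P)) 2 P :=
    memLp_finsetSum _ fun g _ => (hQ2 g).sub (memLp_const _)
  -- `(x + y + z)² ≤ 3(x² + y² + z²)` with the coefficients `27/4` and `3/4` rounded up to `7` and
  -- `1`.
  have hle : ∀ ω, (steinVar P ε b K ω - ∫ ω, steinVar P ε b K ω ∂P) ^ 2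
      ≤ 7 * L ω ^ 2 + (∑ g, (Q g ω - ∫ ω, Q g ω ∂P)) ^ 2 + 3 * T ω ^ 2 := fun ω => by
    rw [hdev]
    nlinarith [sq_nonneg (3 / 2 * L ω - 1 / 2 * (∑ g, (Q g ω - ∫ ω, Q g ω ∂P))),
      sq_nonneg (3 / 2 * L ω - T ω), sq_nonneg (1 / 2 * (∑ g, (Q g ω - ∫ ω, Q g ω ∂P)) - T ω),
      sq_nonneg (∑ g, (Q g ω - ∫ ω, Q g ω ∂P)), sq_nonneg (L ω)]
  have j1 := hL2.integrable_sq.const_mul 7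
  have j2 := hc2.integrable_sq
  have j3 := hT2.integrable_sq.const_mul 3
  refine (integral_mono_of_nonneg (.of_forall fun ω => sq_nonneg _) ((j1.add j2).add j3)
    (.of_forall hle)).trans ?_
  have b1 : ∫ ω, L ω ^ 2 ∂P ≤ u ^ 3 * ν₀ * (b ⬝ᵥ b) := by
    calc _ ≤ u * (y ⬝ᵥ y) := h.integral_dotProduct_sq_le hu y
      _ ≤ u * (ν₀ * (u ^ 2 * (b ⬝ᵥ b))) := by
        gcongr
        refine (hν₀ _).trans ?_
        gcongr
        exact h.crossMoment_mulVec_sq_le hu0 hu b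
      _ = _ := by ring
  have b2 : ∑ g, ∫ ω, Q g ω ^ 2 ∂P ≤ u ^ 2 * φ * ν₁ * frobSq K := by
    rw [← sum_clusterPart_row cl K, Finset.mul_sum]
    refine Finset.sum_le_sum fun g _ => ?_
    have hk := h.integral_mulVec_clusterPart_sq_le (hφ g) K hν₁0 (hν₁ g)
    -- `Q g` is the covariance form evaluated at `Kε_g`, hence lies between `0` and `u|Kε_g|²`.
    have hQle : ∀ ω, Q g ω ^ 2
        ≤ u ^ 2 * (K *ᵥ clusterPart cl g (ε ω) ⬝ᵥ K *ᵥ clusterPart cl g (ε ω)) ^ 2 := fun ω => by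
      have e : Q g ω = K *ᵥ clusterPart cl g (ε ω) ⬝ᵥ crossMoment P ε ε
          *ᵥ (K *ᵥ clusterPart cl g (ε ω)) := by
        rw [dotProduct_comm, dotProduct_mulVec_comm_of_isSymm hs, Matrix.mulVec_mulVec,
          Matrix.mulVec_mulVec]
      rw [← mul_pow]
      exact pow_le_pow_left₀ (e ▸ h.dotProduct_crossMoment_self_nonneg _) (e ▸ hu _) 2
    have hi : Integrable
        (fun ω => (K *ᵥ clusterPart cl g (ε ω) ⬝ᵥ K *ᵥ clusterPart cl g (ε ω)) ^ 2) P := by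
      have : MemLp (fun ω => K *ᵥ clusterPart cl g (ε ω) ⬝ᵥ K *ᵥ clusterPart cl g (ε ω)) 2 P :=
        memLp_finsetSum _ fun i _ => MemLp.mul (memLp_mulVec K (hp4 g) i) (memLp_mulVec K (hp4 g) i)
      exact this.integrable_sq
    refine (integral_mono_of_nonneg (.of_forall fun ω => sq_nonneg _) (hi.const_mul _)
      (.of_forall hQle)).trans ?_
    rw [integral_const_mul, mul_assoc (u ^ 2), mul_assoc (u ^ 2)]
    gcongr
  have b3 : ∫ ω, T ω ^ 2 ∂P ≤ u ^ 4 * ν₀ * frobSq K := by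
    calc _ ≤ u ^ 2 * frobSq (hollowPart cl R) := hT'.2
      _ ≤ u ^ 2 * (ν₀ * u ^ 2 * frobSq K) := by
        gcongr
        exact (frobSq_hollowPart_le cl R).trans
          (h.frobSq_mul_crossMoment_mul_le hu0 hu hs hν₀0 hν₀)
      _ = _ := by ring
  have hind : Pairwise fun i j => IndepFun (Q i) (Q j) P := by
    intro i j hij
    have hm : Measurable fun x : J → ℝ => x ⬝ᵥ R *ᵥ x := by
      have : Continuous fun x : J → ℝ => x ⬝ᵥ R *ᵥ x := by fun_prop
      exact this.measurable
    exact (h.indep.indepFun hij).comp hm hm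
  have b2' := (integral_sum_sub_sq_le hQ2 hind).trans b2
  have e : ∫ ω, (7 * L ω ^ 2 + (∑ g, (Q g ω - ∫ ω, Q g ω ∂P)) ^ 2 + 3 * T ω ^ 2) ∂P
      = 7 * ∫ ω, L ω ^ 2 ∂P + ∫ ω, (∑ g, (Q g ω - ∫ ω, Q g ω ∂P)) ^ 2 ∂P
        + 3 * ∫ ω, T ω ^ 2 ∂P := by
    rw [integral_add (j1.fun_add j2) j3, integral_add j1 j2, integral_const_mul, integral_const_mul]
  refine e.le.trans ?_
  linarith

lemma memLp_dotProduct_clusterPart (h : ClusterNoise P cl ε) (g : ι) (y : J → ℝ) :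
    MemLp (fun ω => y ⬝ᵥ clusterPart cl g (ε ω)) 4 P :=
  memLp_finsetSum _ fun j _ => (memLp_clusterPart cl g h.memLp j).const_mul _

lemma memLp_two_clusterPart_dotProduct_self (h : ClusterNoise P cl ε) (g : ι) :
    MemLp (fun ω => clusterPart cl g (ε ω) ⬝ᵥ clusterPart cl g (ε ω)) 2 P :=
  memLp_finsetSum _ fun j _ =>
    MemLp.mul (memLp_clusterPart cl g h.memLp j) (memLp_clusterPart cl g h.memLp j)

/-- Cauchy-Schwarz on two of the four factors gives `(y'ε_g)⁴ ≤ |y_g|² (y_g'ε_g)² |ε_g|²`, and `hφ`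
is applied at `y_g`. -/
lemma integral_dotProduct_clusterPart_pow_four_le (h : ClusterNoise P cl ε) {φ : ℝ} {g : ι}
    (hφ : ∀ y : J → ℝ, ∫ ω, (y ⬝ᵥ clusterPart cl g (ε ω)) ^ 2
      * (clusterPart cl g (ε ω) ⬝ᵥ clusterPart cl g (ε ω)) ∂P ≤ φ * (y ⬝ᵥ y)) (y : J → ℝ) :
    ∫ ω, (y ⬝ᵥ clusterPart cl g (ε ω)) ^ 4 ∂P
      ≤ φ * (clusterPart cl g y ⬝ᵥ clusterPart cl g y) ^ 2 := by
  set z := clusterPart cl g y with hz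
  have e : ∀ ω, y ⬝ᵥ clusterPart cl g (ε ω) = z ⬝ᵥ clusterPart cl g (ε ω) := fun ω => by
    rw [hz, clusterPart_dotProduct_clusterPart]
  have hi : Integrable (fun ω => (z ⬝ᵥ clusterPart cl g (ε ω)) ^ 2
      * (clusterPart cl g (ε ω) ⬝ᵥ clusterPart cl g (ε ω))) P := by
    have h4 := h.memLp_dotProduct_clusterPart g z
    have : MemLp (fun ω => (z ⬝ᵥ clusterPart cl g (ε ω)) ^ 2) 2 P := by
      simpa only [pow_two] using MemLp.mul' h4 h4
    exact this.integrable_mul (h.memLp_two_clusterPart_dotProduct_self g)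
  have hle : ∀ ω, (y ⬝ᵥ clusterPart cl g (ε ω)) ^ 4 ≤ (z ⬝ᵥ z) * ((z ⬝ᵥ clusterPart cl g (ε ω)) ^ 2
      * (clusterPart cl g (ε ω) ⬝ᵥ clusterPart cl g (ε ω))) := fun ω => by
    rw [e, show ((z ⬝ᵥ clusterPart cl g (ε ω)) ^ 4 : ℝ) = (z ⬝ᵥ clusterPart cl g (ε ω)) ^ 2
      * (z ⬝ᵥ clusterPart cl g (ε ω)) ^ 2 by ring, mul_left_comm]
    exact mul_le_mul_of_nonneg_left (dotProduct_sq_le _ _) (sq_nonneg _)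
  refine (integral_mono_of_nonneg (.of_forall fun ω => by positivity) (hi.const_mul _)
    (.of_forall hle)).trans ?_
  rw [integral_const_mul]
  calc _ ≤ (z ⬝ᵥ z) * (φ * (z ⬝ᵥ z)) :=
        mul_le_mul_of_nonneg_left (hφ z) (dotProduct_self_nonneg' z)
    _ = _ := by ring

lemma integral_dotProduct_pow_four_le (h : ClusterNoise P cl ε) {u φ : ℝ}
    (hu : ∀ y : J → ℝ, y ⬝ᵥ crossMoment P ε ε *ᵥ y ≤ u * (y ⬝ᵥ y))
    (hφ : ∀ g, ∀ y : J → ℝ, ∫ ω, (y ⬝ᵥ clusterPart cl g (ε ω)) ^ 2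
      * (clusterPart cl g (ε ω) ⬝ᵥ clusterPart cl g (ε ω)) ∂P ≤ φ * (y ⬝ᵥ y)) (y : J → ℝ) :
    ∫ ω, (y ⬝ᵥ ε ω) ^ 4 ∂P ≤ 3 * (u * (y ⬝ᵥ y)) ^ 2
      + φ * ∑ g, (clusterPart cl g y ⬝ᵥ clusterPart cl g y) ^ 2 := by
  have hm : ∀ g : ι, Measurable fun x : J → ℝ => y ⬝ᵥ x := fun _ => by
    have : Continuous fun x : J → ℝ => y ⬝ᵥ x := by fun_prop
    exact this.measurable
  have hX0 : ∀ g, ∫ ω, y ⬝ᵥ clusterPart cl g (ε ω) ∂P = 0 := fun g => by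
    simp only [dotProduct]
    rw [integral_finsetSum _ fun j _ =>
      ((memLp_clusterPart cl g h.memLp j).integrable (by norm_num)).const_mul _]
    refine Finset.sum_eq_zero fun j _ => ?_
    rw [integral_const_mul]
    by_cases hj : cl j = g <;> simp [clusterPart, hj, h.mean]
  obtain ⟨h2, h4⟩ := integral_sum_pow_four_le
    (X := fun g ω => y ⬝ᵥ clusterPart cl g (ε ω))
    (fun g => (hm g).comp ((measurable_clusterPart cl g).comp h.measurable))
    (fun g => h.memLp_dotProduct_clusterPart g y) hX0
    (h.indep.comp (fun _ x => y ⬝ᵥ x) hm) Finset.univ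
  simp only [sum_dotProduct_clusterPart] at h2 h4
  rw [← h2] at h4
  refine h4.trans ?_
  rw [Finset.mul_sum]
  refine add_le_add ?_ (Finset.sum_le_sum fun g _ =>
    h.integral_dotProduct_clusterPart_pow_four_le (hφ g) y)
  have := h.integral_dotProduct_sq_le hu y
  have h0 : 0 ≤ ∫ ω, (y ⬝ᵥ ε ω) ^ 2 ∂P := integral_nonneg fun ω => sq_nonneg _
  gcongr

/-- With `ε_g` frozen, `ε_g'Kε` is a linear form in the other clusters with coefficient vector
`Kε_g`, so the fourth-moment bound for linear forms applies. Its two terms, `|Kε_g|⁴` and the sum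
over `k` of `|(Kε_g)_k|⁴`, are then integrated over `ε_g`. -/
lemma sum_clusterPart_sq_le_integral (h : ClusterNoise P cl ε) {u φ ν₁ ν₂ : ℝ}
    (hu : ∀ y : J → ℝ, y ⬝ᵥ crossMoment P ε ε *ᵥ y ≤ u * (y ⬝ᵥ y)) (hφ0 : 0 ≤ φ)
    (hφ : ∀ g, ∀ y : J → ℝ, ∫ ω, (y ⬝ᵥ clusterPart cl g (ε ω)) ^ 2
      * (clusterPart cl g (ε ω) ⬝ᵥ clusterPart cl g (ε ω)) ∂P ≤ φ * (y ⬝ᵥ y))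
    {K : Matrix J J ℝ} (hs : K.IsSymm) (hK : IsHollow cl K) (hν₁0 : 0 ≤ ν₁) (hν₂0 : 0 ≤ ν₂) (g : ι)
    (hν₁ : ∀ x, K *ᵥ clusterPart cl g x ⬝ᵥ K *ᵥ clusterPart cl g x
      ≤ ν₁ * (clusterPart cl g x ⬝ᵥ clusterPart cl g x))
    (hν₂ : ∀ k x, clusterPart cl k (K *ᵥ clusterPart cl g x)
      ⬝ᵥ clusterPart cl k (K *ᵥ clusterPart cl g x)
      ≤ ν₂ * (clusterPart cl g x ⬝ᵥ clusterPart cl g x)) :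
    ∫ ω, (clusterPart cl g (ε ω) ⬝ᵥ K *ᵥ ε ω) ^ 4 ∂P
      ≤ (3 * (u ^ 2 * φ * ν₁) + φ ^ 2 * ν₂)
        * ∑ i, clusterPart cl g (K.row i) ⬝ᵥ clusterPart cl g (K.row i) := by
  have hp4 := memLp_clusterPart cl g h.memLp
  have hK4 : ∀ j, MemLp (fun ω => (K *ᵥ clusterPart cl g (ε ω)) j) 4 P := memLp_mulVec K hp4
  have hn1 : MemLp (fun ω => K *ᵥ clusterPart cl g (ε ω) ⬝ᵥ K *ᵥ clusterPart cl g (ε ω)) 2 P :=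
    memLp_finsetSum _ fun i _ => MemLp.mul (hK4 i) (hK4 i)
  have hn2 : ∀ k, MemLp (fun ω => clusterPart cl k (K *ᵥ clusterPart cl g (ε ω))
      ⬝ᵥ clusterPart cl k (K *ᵥ clusterPart cl g (ε ω))) 2 P := fun k =>
    memLp_finsetSum _ fun i _ =>
      MemLp.mul (memLp_clusterPart cl k hK4 i) (memLp_clusterPart cl k hK4 i)
  have i1 : Integrable (fun ω => 3 * (u * (K *ᵥ clusterPart cl g (ε ω)
      ⬝ᵥ K *ᵥ clusterPart cl g (ε ω))) ^ 2) P := by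
    simp only [mul_pow]
    exact (hn1.integrable_sq.const_mul _).const_mul _
  have i2 : Integrable (fun ω => ∑ k, (clusterPart cl k (K *ᵥ clusterPart cl g (ε ω))
      ⬝ᵥ clusterPart cl k (K *ᵥ clusterPart cl g (ε ω))) ^ 2) P :=
    integrable_finsetSum _ fun k _ => (hn2 k).integrable_sq
  -- For frozen `x` all of `ε` may replace the rest, because `Kx_g` vanishes on cluster `g`.
  have hmove : ∀ x ω, clusterPart cl g x ⬝ᵥ K *ᵥ clusterRest cl g (ε ω)
      = K *ᵥ clusterPart cl g x ⬝ᵥ ε ω := fun x ω => by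
    rw [clusterPart_dotProduct_comm, hK.clusterPart_mulVec_clusterRest,
      ← clusterPart_dotProduct_comm, dotProduct_mulVec_comm_of_isSymm hs, dotProduct_comm]
  have hmove' : ∀ ω, clusterPart cl g (ε ω) ⬝ᵥ K *ᵥ ε ω
      = clusterPart cl g (clusterPart cl g (ε ω)) ⬝ᵥ K *ᵥ clusterRest cl g (ε ω) := fun ω => by
    rw [clusterPart_clusterPart, clusterPart_dotProduct_comm,
      clusterPart_dotProduct_comm cl g (ε ω) (K *ᵥ clusterRest cl g (ε ω)),
      hK.clusterPart_mulVec_clusterRest]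
  have hint : Integrable (fun ω => (clusterPart cl g (ε ω) ⬝ᵥ K *ᵥ ε ω) ^ 4) P := by
    have hKm : Measurable fun x : J → ℝ => K *ᵥ x := by
      have : Continuous fun x : J → ℝ => K *ᵥ x := by fun_prop
      exact this.measurable
    simp only [hmove', clusterPart_clusterPart]
    exact (h.memLp_clusterPart_dotProduct_rest g hKm
      (memLp_mulVec K (memLp_clusterRest cl g h.memLp))).integrable_pow_four
  set f : (J → ℝ) → (J → ℝ) → ℝ := fun x y => (clusterPart cl g x ⬝ᵥ K *ᵥ y) ^ 4 with hf
  have hfm : Measurable (Function.uncurry f) := by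
    have hc : Continuous fun p : (J → ℝ) × (J → ℝ) => p.1 ⬝ᵥ K *ᵥ p.2 := by fun_prop
    have hg : Measurable fun p : (J → ℝ) × (J → ℝ) => (clusterPart cl g p.1, p.2) :=
      ((measurable_clusterPart cl g).comp measurable_fst).prodMk measurable_snd
    have hm : Measurable fun p : (J → ℝ) × (J → ℝ) => clusterPart cl g p.1 ⬝ᵥ K *ᵥ p.2 :=
      hc.measurable.comp hg
    exact hm.pow_const 4
  have hfe : ∀ ω, f (clusterPart cl g (ε ω)) (clusterRest cl g (ε ω))
      = (clusterPart cl g (ε ω) ⬝ᵥ K *ᵥ ε ω) ^ 4 := fun ω => by rw [hmove']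
  set B : (J → ℝ) → ℝ := fun x => 3 * (u * (K *ᵥ clusterPart cl g x ⬝ᵥ K *ᵥ clusterPart cl g x)) ^ 2
      + φ * ∑ k, (clusterPart cl k (K *ᵥ clusterPart cl g x)
        ⬝ᵥ clusterPart cl k (K *ᵥ clusterPart cl g x)) ^ 2 with hB
  have hBe : ∀ ω, B (clusterPart cl g (ε ω)) = B (ε ω) := fun ω => by
    simp only [hB, clusterPart_clusterPart]
  have step : ∫ ω, f (clusterPart cl g (ε ω)) (clusterRest cl g (ε ω)) ∂P
      ≤ ∫ ω, B (clusterPart cl g (ε ω)) ∂P := by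
    refine (h.indepFun_rest g).integral_le_of_forall_integral_le
      ((measurable_clusterPart cl g).comp h.measurable)
      ((measurable_clusterRest cl g).comp h.measurable) hfm (fun x y => by positivity)
      (by simpa only [hfe] using hint) ?_ fun x => ?_
    · simp only [hBe]
      exact i1.fun_add (i2.const_mul φ)
    · simp only [hf, hmove]
      exact h.integral_dotProduct_pow_four_le hu hφ _
  simp only [hfe, hBe] at step
  refine step.trans ?_
  rw [integral_add i1 (i2.const_mul φ), integral_const_mul, integral_const_mul,
    integral_finsetSum _ fun k _ => (hn2 k).integrable_sq]
  simp only [mul_pow]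
  rw [integral_const_mul]
  have b1 := h.integral_mulVec_clusterPart_sq_le (hφ g) K hν₁0 hν₁
  have b2 : ∑ k, ∫ ω, (clusterPart cl k (K *ᵥ clusterPart cl g (ε ω))
      ⬝ᵥ clusterPart cl k (K *ᵥ clusterPart cl g (ε ω))) ^ 2 ∂P
      ≤ φ * ν₂ * ∑ i, clusterPart cl g (K.row i) ⬝ᵥ clusterPart cl g (K.row i) := by
    -- `Y k` keeps the rows of `K` in cluster `k`. Summed over `k` the row norms reproduce those of
    -- `K`, so the sum over clusters costs nothing.
    set Y : ι → Matrix J J ℝ := fun k => Matrix.of fun i j => if cl i = k then K i j else 0 with hY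
    have hYx : ∀ k x, Y k *ᵥ x = clusterPart cl k (K *ᵥ x) := fun k x => by
      ext i
      by_cases hi : cl i = k <;> simp [hY, clusterPart, Matrix.mulVec, dotProduct, hi]
    have hrow : ∀ i, ∑ k, clusterPart cl g ((Y k).row i) ⬝ᵥ clusterPart cl g ((Y k).row i)
        = clusterPart cl g (K.row i) ⬝ᵥ clusterPart cl g (K.row i) := fun i => by
      have hr : ∀ k, clusterPart cl g ((Y k).row i) ⬝ᵥ clusterPart cl g ((Y k).row i)
          = if cl i = k then clusterPart cl g (K.row i) ⬝ᵥ clusterPart cl g (K.row i) else 0 :=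
        fun k => by
          by_cases hi : cl i = k <;>
            simp [hY, clusterPart, dotProduct, hi, Matrix.row_apply]
      simp only [hr, Finset.sum_ite_eq, Finset.mem_univ, if_true]
    calc _ ≤ ∑ k, φ * ν₂ * ∑ i, clusterPart cl g ((Y k).row i)
          ⬝ᵥ clusterPart cl g ((Y k).row i) := by
          refine Finset.sum_le_sum fun k _ => ?_
          have := h.integral_mulVec_clusterPart_sq_le (hφ g) (Y k) hν₂0
            (by simpa only [hYx] using hν₂ k)
          simpa only [hYx] using this
      _ = _ := by
          rw [← Finset.mul_sum, Finset.sum_comm]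
          simp only [hrow]
  have b1' := mul_le_mul_of_nonneg_left b1 (by positivity : 0 ≤ 3 * u ^ 2)
  have b2' := mul_le_mul_of_nonneg_left b2 hφ0
  nlinarith

theorem sum_integral_pow_four_le (h : ClusterNoise P cl ε) {u φ ν₁ ν₂ : ℝ}
    (hu : ∀ y : J → ℝ, y ⬝ᵥ crossMoment P ε ε *ᵥ y ≤ u * (y ⬝ᵥ y)) (hφ0 : 0 ≤ φ)
    (hφ : ∀ g, ∀ y : J → ℝ, ∫ ω, (y ⬝ᵥ clusterPart cl g (ε ω)) ^ 2
      * (clusterPart cl g (ε ω) ⬝ᵥ clusterPart cl g (ε ω)) ∂P ≤ φ * (y ⬝ᵥ y))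
    {K : Matrix J J ℝ} (hs : K.IsSymm) (hK : IsHollow cl K) (hν₁0 : 0 ≤ ν₁) (hν₂0 : 0 ≤ ν₂)
    (hν₁ : ∀ g x, K *ᵥ clusterPart cl g x ⬝ᵥ K *ᵥ clusterPart cl g x
      ≤ ν₁ * (clusterPart cl g x ⬝ᵥ clusterPart cl g x))
    (hν₂ : ∀ g k x, clusterPart cl k (K *ᵥ clusterPart cl g x)
      ⬝ᵥ clusterPart cl k (K *ᵥ clusterPart cl g x)
      ≤ ν₂ * (clusterPart cl g x ⬝ᵥ clusterPart cl g x)) (b : J → ℝ) :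
    ∑ g, ∫ ω, (clusterPart cl g (ε ω) ⬝ᵥ (b + (1 : ℝ) • K *ᵥ ε ω)) ^ 4 ∂P
      ≤ 8 * (φ * ∑ g, (clusterPart cl g b ⬝ᵥ clusterPart cl g b) ^ 2)
        + 8 * ((3 * (u ^ 2 * φ * ν₁) + φ ^ 2 * ν₂) * frobSq K) := by
  rw [← sum_clusterPart_row cl K, Finset.mul_sum, Finset.mul_sum, Finset.mul_sum, Finset.mul_sum,
    ← Finset.sum_add_distrib]
  refine Finset.sum_le_sum fun g _ => ?_
  have hKm : Measurable fun x : J → ℝ => K *ᵥ x := by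
    have : Continuous fun x : J → ℝ => K *ᵥ x := by fun_prop
    exact this.measurable
  have i2 : Integrable (fun ω => (clusterPart cl g (ε ω) ⬝ᵥ K *ᵥ ε ω) ^ 4) P := by
    have := (h.memLp_clusterPart_dotProduct_rest g hKm
      (memLp_mulVec K (memLp_clusterRest cl g h.memLp))).integrable_pow_four
    refine this.congr (.of_forall fun ω => ?_)
    simp only []
    rw [clusterPart_dotProduct_comm, hK.clusterPart_mulVec_clusterRest,
      ← clusterPart_dotProduct_comm]
  have i1 := (h.memLp_dotProduct_clusterPart g b).integrable_pow_four
  have hle : ∀ ω, (clusterPart cl g (ε ω) ⬝ᵥ (b + (1 : ℝ) • K *ᵥ ε ω)) ^ 4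
      ≤ 8 * (b ⬝ᵥ clusterPart cl g (ε ω)) ^ 4
        + 8 * (clusterPart cl g (ε ω) ⬝ᵥ K *ᵥ ε ω) ^ 4 := fun ω => by
    rw [one_smul, dotProduct_add, dotProduct_comm _ b]
    generalize b ⬝ᵥ clusterPart cl g (ε ω) = s
    generalize clusterPart cl g (ε ω) ⬝ᵥ K *ᵥ ε ω = t
    nlinarith [sq_nonneg (s - t), sq_nonneg (s + t), sq_nonneg (s ^ 2 - t ^ 2),
      mul_nonneg (sq_nonneg (s - t)) (sq_nonneg (s - t)),
      mul_nonneg (sq_nonneg (s - t)) (sq_nonneg (s + t)), sq_nonneg ((s - t) ^ 2),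
      sq_nonneg (s * (s - t)), sq_nonneg (t * (s - t))]
  refine (integral_mono_of_nonneg (.of_forall fun ω => by positivity)
    ((i1.const_mul 8).fun_add (i2.const_mul 8)) (.of_forall hle)).trans ?_
  rw [integral_add (i1.const_mul 8) (i2.const_mul 8), integral_const_mul, integral_const_mul]
  have b1 := h.integral_dotProduct_clusterPart_pow_four_le (hφ g) b
  have b2 := h.sum_clusterPart_sq_le_integral hu hφ0 hφ hs hK hν₁0 hν₂0 g (hν₁ g) (hν₂ g)
  linarith

lemma integral_dotProduct_eq_zero (h : ClusterNoise P cl ε) (y : J → ℝ) :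
    ∫ ω, y ⬝ᵥ ε ω ∂P = 0 := by
  simp only [dotProduct]
  rw [integral_finsetSum _ fun j _ => ((h.memLp_two j).integrable (by norm_num)).const_mul _]
  simp [integral_const_mul, h.mean]

lemma integral_quadForm (h : ClusterNoise P cl ε) (R : Matrix J J ℝ) :
    Integrable (fun ω => ε ω ⬝ᵥ R *ᵥ ε ω) P ∧
      ∫ ω, ε ω ⬝ᵥ R *ᵥ ε ω ∂P = (R * crossMoment P ε ε).trace := by
  have hi : ∀ i j, Integrable (fun ω => ε ω i * (R i j * ε ω j)) P := fun i j =>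
    ((h.integrable_coord_mul i j).const_mul (R i j)).congr (.of_forall fun ω => by simp only []; ring)
  simp only [dotProduct, Matrix.mulVec, Finset.mul_sum]
  refine ⟨integrable_finsetSum _ fun i _ => integrable_finsetSum _ fun j _ => hi i j, ?_⟩
  rw [integral_finsetSum _ fun i _ => integrable_finsetSum _ fun j _ => hi i j, Matrix.trace]
  refine Finset.sum_congr rfl fun i _ => ?_
  rw [integral_finsetSum _ fun j _ => hi i j, Matrix.diag_apply, Matrix.mul_apply]
  refine Finset.sum_congr rfl fun j _ => ?_
  rw [crossMoment, Matrix.of_apply, ← integral_const_mul]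
  exact integral_congr_ae (.of_forall fun ω => by simp only []; ring)

lemma integral_steinVar (h : ClusterNoise P cl ε) {K : Matrix J J ℝ} (hs : K.IsSymm) (b : J → ℝ) :
    ∫ ω, steinVar P ε b K ω ∂P = b ⬝ᵥ crossMoment P ε ε *ᵥ b
      + 1 / 2 * (K * crossMoment P ε ε * K * crossMoment P ε ε).trace := by
  have hq := h.integral_quadForm (K * crossMoment P ε ε * K)
  have hl : Integrable (fun ω => K *ᵥ (crossMoment P ε ε *ᵥ b) ⬝ᵥ ε ω) P :=
    (h.memLp_dotProduct _).integrable (by norm_num)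
  simp only [steinVar_eq hs]
  rw [integral_add ((integrable_const _).fun_add (hl.const_mul _)) (hq.1.const_mul _),
    integral_add (integrable_const _) (hl.const_mul _), integral_const_mul, integral_const_mul,
    h.integral_dotProduct_eq_zero, hq.2]
  simp

/-- The trace `tr(KSKS)` is the mean of `(Kε)'S(Kε)`, where the lower eigenvalue bound can be used
twice: once for the inner form, once for `E|Kε|²`. -/
lemma le_integral_steinVar (h : ClusterNoise P cl ε) {c : ℝ} (hc0 : 0 ≤ c)
    (hc : ∀ y : J → ℝ, c * (y ⬝ᵥ y) ≤ y ⬝ᵥ crossMoment P ε ε *ᵥ y)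
    {K : Matrix J J ℝ} (hs : K.IsSymm) (b : J → ℝ) :
    c * (b ⬝ᵥ b) + 1 / 2 * (c ^ 2 * frobSq K) ≤ ∫ ω, steinVar P ε b K ω ∂P := by
  have hq := h.integral_quadForm (K * crossMoment P ε ε * K)
  have hle : c * ∫ ω, K *ᵥ ε ω ⬝ᵥ K *ᵥ ε ω ∂P
      ≤ ∫ ω, ε ω ⬝ᵥ (K * crossMoment P ε ε * K) *ᵥ ε ω ∂P := by
    rw [← integral_const_mul]
    refine integral_mono ((h.integrable_mulVec_dotProduct_mulVec K).const_mul c) hq.1 fun ω => ?_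
    refine (hc _).trans_eq ?_
    rw [dotProduct_comm, dotProduct_mulVec_comm_of_isSymm hs, Matrix.mulVec_mulVec,
      Matrix.mulVec_mulVec]
  have h1 := mul_le_mul_of_nonneg_left (h.mul_frobSq_le_integral hc K) hc0
  rw [h.integral_steinVar hs, ← hq.2]
  have := hc b
  nlinarith

/-- The difference of the integrands is `½ b'SKε`, which has mean zero, plus a quarter of a
nonnegative form. Normalizing the kernel to mean 1 thus also bounds the total second moment of the
shares. -/
lemma integral_half_le_integral_steinVar (h : ClusterNoise P cl ε) {K : Matrix J J ℝ}
    (b : J → ℝ) :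
    ∫ ω, (b + (1 / 2 : ℝ) • K *ᵥ ε ω) ⬝ᵥ crossMoment P ε ε *ᵥ (b + (1 / 2 : ℝ) • K *ᵥ ε ω) ∂P
      ≤ ∫ ω, steinVar P ε b K ω ∂P := by
  have hl : Integrable (fun ω => Kᵀ *ᵥ (crossMoment P ε ε *ᵥ b) ⬝ᵥ ε ω) P :=
    (h.memLp_dotProduct _).integrable (by norm_num)
  have h0 : ∫ ω, 1 / 2 * (Kᵀ *ᵥ (crossMoment P ε ε *ᵥ b) ⬝ᵥ ε ω) ∂P = 0 := by
    rw [integral_const_mul, h.integral_dotProduct_eq_zero, mul_zero]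
  have hz : Integrable (fun ω => (b + (1 / 2 : ℝ) • K *ᵥ ε ω)
      ⬝ᵥ crossMoment P ε ε *ᵥ (b + (1 / 2 : ℝ) • K *ᵥ ε ω)) P :=
    (memLp_two_dotProduct_mulVec _ (h.memLp_affine_smul b K _)
      (h.memLp_affine_smul b K _)).integrable (q := 2) (by norm_num)
  rw [← add_zero (∫ ω, _ ∂P), ← h0, ← integral_add hz (hl.const_mul _)]
  refine integral_mono (hz.add (hl.const_mul _))
    ((h.memLp_two_steinVar b K).integrable (by norm_num)) fun ω => ?_
  have e : Kᵀ *ᵥ (crossMoment P ε ε *ᵥ b) ⬝ᵥ ε ω = b ⬝ᵥ crossMoment P ε ε *ᵥ K *ᵥ ε ω := by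
    rw [dotProduct_mulVec_comm_of_isSymm (crossMoment_isSymm P ε) b, Matrix.mulVec_transpose,
      ← Matrix.dotProduct_mulVec, dotProduct_comm]
  have hp := h.dotProduct_crossMoment_self_nonneg (K *ᵥ ε ω)
  simp only [steinVar, e, one_smul, add_dotProduct, dotProduct_add, Matrix.mulVec_add,
    smul_dotProduct, smul_eq_mul, Matrix.mulVec_smul, dotProduct_smul,
    dotProduct_mulVec_comm_of_isSymm (crossMoment_isSymm P ε) (K *ᵥ ε ω) b]
  linarith

lemma linQuad_smul (s : ℝ) (b : J → ℝ) (K : Matrix J J ℝ) (x : J → ℝ) :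
    linQuad (s • b) (s • K) x = s * linQuad b K x := by
  simp only [linQuad, Matrix.smul_mulVec, dotProduct_add, dotProduct_smul, smul_eq_mul]
  ring

lemma steinVar_smul (s : ℝ) (b : J → ℝ) (K : Matrix J J ℝ) (ω : Ω) :
    steinVar P ε (s • b) (s • K) ω = s ^ 2 * steinVar P ε b K ω := by
  simp only [steinVar, Matrix.smul_mulVec, one_smul, smul_comm _ s, ← smul_add, smul_dotProduct,
    Matrix.mulVec_smul, dotProduct_smul, smul_eq_mul]
  ring

/-- Normal approximation of a linear plus hollow quadratic form in terms of explicit bounds. -/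
theorem norm_integral_exp_div_sub_le (h : ClusterNoise P cl ε) {u φ ν₀ ν₁ ν₂ : ℝ} (hu0 : 0 < u)
    (hu : ∀ y : J → ℝ, y ⬝ᵥ crossMoment P ε ε *ᵥ y ≤ u * (y ⬝ᵥ y)) (hφ0 : 0 ≤ φ)
    (hφ : ∀ g, ∀ y : J → ℝ, ∫ ω, (y ⬝ᵥ clusterPart cl g (ε ω)) ^ 2
      * (clusterPart cl g (ε ω) ⬝ᵥ clusterPart cl g (ε ω)) ∂P ≤ φ * (y ⬝ᵥ y))
    {K : Matrix J J ℝ} (hs : K.IsSymm) (hK : IsHollow cl K)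
    (hν₀0 : 0 ≤ ν₀) (hν₁0 : 0 ≤ ν₁) (hν₂0 : 0 ≤ ν₂)
    (hν₀ : ∀ x : J → ℝ, K *ᵥ x ⬝ᵥ K *ᵥ x ≤ ν₀ * (x ⬝ᵥ x))
    (hν₁ : ∀ g x, K *ᵥ clusterPart cl g x ⬝ᵥ K *ᵥ clusterPart cl g x
      ≤ ν₁ * (clusterPart cl g x ⬝ᵥ clusterPart cl g x))
    (hν₂ : ∀ g k x, clusterPart cl k (K *ᵥ clusterPart cl g x)
      ⬝ᵥ clusterPart cl k (K *ᵥ clusterPart cl g x)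
      ≤ ν₂ * (clusterPart cl g x ⬝ᵥ clusterPart cl g x)) (b : J → ℝ) {σ δ : ℝ} (hσ : 0 < σ)
    (hδ : 0 < δ) (hσ2 : ∫ ω, steinVar P ε b K ω ∂P = σ ^ 2)
    (hV : 7 * (u ^ 3 * ν₀ * (b ⬝ᵥ b)) + u ^ 2 * φ * ν₁ * frobSq K + 3 * (u ^ 4 * ν₀ * frobSq K)
      ≤ δ ^ 2 * σ ^ 4)
    (hF : 8 * (φ * ∑ g, (clusterPart cl g b ⬝ᵥ clusterPart cl g b) ^ 2)
        + 8 * ((3 * (u ^ 2 * φ * ν₁) + φ ^ 2 * ν₂) * frobSq K) ≤ δ ^ 2 * σ ^ 4) (t : ℝ) :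
    ‖∫ ω, Complex.exp ((t * (linQuad b K (ε ω) / σ) : ℝ) * Complex.I) ∂P - Real.exp (-t ^ 2 / 2)‖
      ≤ Real.exp (t ^ 2 / 2) * ((|t| + 3 * t ^ 2) * δ) * |t| := by
  have hK' : IsHollow cl (σ⁻¹ • K) := fun i j hij => by simp [hK i j hij]
  have hs' : (σ⁻¹ • K).IsSymm := hs.smul _
  have hσ4 : (σ⁻¹) ^ 4 * σ ^ 4 = 1 := by
    rw [← mul_pow, inv_mul_cancel₀ hσ.ne', one_pow]
  have hσ2' : (σ⁻¹) ^ 2 * σ ^ 2 = 1 := by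
    rw [← mul_pow, inv_mul_cancel₀ hσ.ne', one_pow]
  -- Scaling `b` and `K` by `σ⁻¹` scales the kernel by `σ⁻²`, and both the fourth moments and the
  -- kernel variance by `σ⁻⁴`; this is why the hypotheses compare with `δ²σ⁴`.
  have hst : ∫ ω, steinVar P ε (σ⁻¹ • b) (σ⁻¹ • K) ω ∂P = 1 := by
    simp only [steinVar_smul]
    rw [integral_const_mul, hσ2, hσ2']
  have hA := h.integral_half_le_integral_steinVar (K := σ⁻¹ • K) (σ⁻¹ • b)
  rw [hst] at hA
  have hF' : ∑ g, ∫ ω, (clusterPart cl g (ε ω) ⬝ᵥ (σ⁻¹ • b + (1 : ℝ) • (σ⁻¹ • K) *ᵥ ε ω)) ^ 4 ∂P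
      ≤ δ ^ 2 := by
    have e : ∀ g ω, (clusterPart cl g (ε ω) ⬝ᵥ (σ⁻¹ • b + (1 : ℝ) • (σ⁻¹ • K) *ᵥ ε ω)) ^ 4
        = (σ⁻¹) ^ 4 * (clusterPart cl g (ε ω) ⬝ᵥ (b + (1 : ℝ) • K *ᵥ ε ω)) ^ 4 := fun g ω => by
      simp only [Matrix.smul_mulVec, one_smul, ← smul_add, dotProduct_smul, smul_eq_mul, mul_pow]
    simp only [e, integral_const_mul]
    rw [← Finset.mul_sum]
    calc _ ≤ (σ⁻¹) ^ 4 * (δ ^ 2 * σ ^ 4) := by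
          gcongr
          exact (h.sum_integral_pow_four_le hu hφ0 hφ hs hK hν₁0 hν₂0 hν₁ hν₂ b).trans hF
      _ = δ ^ 2 * ((σ⁻¹) ^ 4 * σ ^ 4) := by ring
      _ = δ ^ 2 := by rw [hσ4, mul_one]
  have hV' : ∫ ω, (steinVar P ε (σ⁻¹ • b) (σ⁻¹ • K) ω - 1) ^ 2 ∂P ≤ δ ^ 2 := by
    have e : ∀ ω, (steinVar P ε (σ⁻¹ • b) (σ⁻¹ • K) ω - 1) ^ 2
        = (σ⁻¹) ^ 4 * (steinVar P ε b K ω - ∫ ω, steinVar P ε b K ω ∂P) ^ 2 := fun ω => by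
      rw [steinVar_smul, hσ2, ← hσ2']
      ring
    simp only [e, integral_const_mul]
    calc _ ≤ (σ⁻¹) ^ 4 * (δ ^ 2 * σ ^ 4) := by
          gcongr
          exact (h.integral_steinVar_sub_sq_le hu0 hu hφ hs hν₀0 hν₁0 hν₀ hν₁ b).trans hV
      _ = δ ^ 2 * ((σ⁻¹) ^ 4 * σ ^ 4) := by ring
      _ = δ ^ 2 := by rw [hσ4, mul_one]
  have := h.norm_integral_exp_linQuad_sub_le hK' hs' hδ hA hF' hV' t
  simpa only [linQuad_smul, inv_mul_eq_div] using this

/-- Interpolation of fourth moments between second moments and moments of order `2q`. -/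
lemma integral_sq_mul_le_of_rpow (h : ClusterNoise P cl ε) {u q M : ℝ} (hu0 : 0 < u) (hq : 2 ≤ q)
    (hM : 0 < M) (hu : ∀ y : J → ℝ, y ⬝ᵥ crossMoment P ε ε *ᵥ y ≤ u * (y ⬝ᵥ y)) (g : ι)
    (hi : Integrable (fun ω => (clusterPart cl g (ε ω) ⬝ᵥ clusterPart cl g (ε ω)) ^ q) P)
    (hb : ∫ ω, (clusterPart cl g (ε ω) ⬝ᵥ clusterPart cl g (ε ω)) ^ q ∂P ≤ M) (y : J → ℝ) :
    ∫ ω, (y ⬝ᵥ clusterPart cl g (ε ω)) ^ 2 * (clusterPart cl g (ε ω) ⬝ᵥ clusterPart cl g (ε ω)) ∂P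
      ≤ u ^ ((q - 2) / (q - 1)) * M ^ (1 / (q - 1)) * (y ⬝ᵥ y) := by
  have hq1 : 0 < q - 1 := by linarith
  set α := (q - 2) / (q - 1) with hα
  set β := 1 / (q - 1) with hβ
  have hα0 : 0 ≤ α := div_nonneg (by linarith) hq1.le
  have hβ0 : 0 < β := by positivity
  have hαβ : α + β = 1 := by rw [hα, hβ, ← add_div, div_eq_one_iff_eq hq1.ne']; ring
  have hqβ : q * β = 1 + β := by rw [hβ]; field_simp; ring
  rcases (dotProduct_self_nonneg' y).eq_or_lt with hr | hr
  · have : ∀ ω, (y ⬝ᵥ clusterPart cl g (ε ω)) ^ 2 = 0 := fun ω =>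
      le_antisymm ((dotProduct_sq_le _ _).trans (by rw [← hr, zero_mul])) (sq_nonneg _)
    simp [this, ← hr]
  set r := y ⬝ᵥ y with hrdef
  have key : ∀ ω, (y ⬝ᵥ clusterPart cl g (ε ω)) ^ 2
      * (clusterPart cl g (ε ω) ⬝ᵥ clusterPart cl g (ε ω))
      ≤ (u ^ α * M ^ β * r) * (α * ((y ⬝ᵥ clusterPart cl g (ε ω)) ^ 2 / (u * r))
        + β * ((clusterPart cl g (ε ω) ⬝ᵥ clusterPart cl g (ε ω)) ^ q / M)) := by
    intro ω
    have hs0 := dotProduct_self_nonneg' (clusterPart cl g (ε ω))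
    have has := dotProduct_sq_le y (clusterPart cl g (ε ω))
    have ha0 := sq_nonneg (y ⬝ᵥ clusterPart cl g (ε ω))
    set s := clusterPart cl g (ε ω) ⬝ᵥ clusterPart cl g (ε ω)
    set a := (y ⬝ᵥ clusterPart cl g (ε ω)) ^ 2
    have h1 : a * s ≤ r ^ β * (a ^ α * (s ^ q) ^ β) := by
      -- Cauchy-Schwarz `a ≤ rs` is applied to the factor `a^β` only. The power of `s` becomes `1 +
      -- β = qβ`, matching the moment of order `2q`.
      have e1 : a = a ^ α * a ^ β := by
        rw [← Real.rpow_add_of_nonneg ha0 hα0 hβ0.le, hαβ, Real.rpow_one]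
      have e2 : (s ^ q) ^ β = s * s ^ β := by
        rw [← Real.rpow_mul hs0, hqβ, Real.rpow_add_of_nonneg hs0 zero_le_one hβ0.le, Real.rpow_one]
      have e3 : a ^ β ≤ r ^ β * s ^ β := by
        rw [← Real.mul_rpow hr.le hs0]
        exact Real.rpow_le_rpow ha0 has hβ0.le
      rw [e2]
      calc a * s = a ^ α * s * a ^ β := by
            nth_rewrite 1 [e1]
            ring
        _ ≤ a ^ α * s * (r ^ β * s ^ β) := by gcongr
        _ = _ := by ring
    -- Weighted arithmetic-geometric mean in place of Hölder: normalized by `ur` and `M`, both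
    -- arguments have expectation at most 1.
    have h2 := Real.geom_mean_le_arith_mean2_weighted hα0 hβ0.le
      (div_nonneg ha0 (mul_pos hu0 hr).le) (div_nonneg (Real.rpow_nonneg hs0 q) hM.le) hαβ
    have h3 : r ^ β * (a ^ α * (s ^ q) ^ β)
        = (u ^ α * M ^ β * r) * ((a / (u * r)) ^ α * (s ^ q / M) ^ β) := by
      rw [Real.div_rpow ha0 (mul_pos hu0 hr).le, Real.div_rpow (Real.rpow_nonneg hs0 q) hM.le,
        Real.mul_rpow hu0.le hr.le]
      have e4 : r = r ^ α * r ^ β := by rw [← Real.rpow_add hr, hαβ, Real.rpow_one]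
      have p1 : 0 < u ^ α := Real.rpow_pos_of_pos hu0 _
      have p2 : 0 < M ^ β := Real.rpow_pos_of_pos hM _
      have p3 : 0 < r ^ α := Real.rpow_pos_of_pos hr _
      calc _ = r ^ β * (a ^ α * (s ^ q) ^ β) * (u ^ α * M ^ β * r ^ α) / (u ^ α * M ^ β * r ^ α) := by
            field_simp
        _ = (u ^ α * M ^ β * (r ^ α * r ^ β)) * (a ^ α / (u ^ α * r ^ α) * ((s ^ q) ^ β / M ^ β)) := by
            field_simp
        _ = _ := by rw [← e4]
    refine h1.trans (h3.le.trans ?_)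
    exact mul_le_mul_of_nonneg_left h2 (by positivity)
  have i1 : Integrable (fun ω => (y ⬝ᵥ clusterPart cl g (ε ω)) ^ 2) P :=
    (h.memLp_dotProduct_clusterPart g y).two_of_four.integrable_sq
  have j1 := (i1.div_const (u * r)).const_mul α
  have j2 := (hi.div_const M).const_mul β
  refine (integral_mono_of_nonneg (.of_forall fun ω => mul_nonneg (sq_nonneg _)
    (dotProduct_self_nonneg' _)) ((j1.fun_add j2).const_mul _) (.of_forall key)).trans ?_
  rw [integral_const_mul, integral_add j1 j2, integral_const_mul, integral_const_mul, integral_div,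
    integral_div]
  have b1 : (∫ ω, (y ⬝ᵥ clusterPart cl g (ε ω)) ^ 2 ∂P) / (u * r) ≤ 1 := by
    rw [div_le_one (mul_pos hu0 hr)]
    simp only [← clusterPart_dotProduct_comm]
    refine (h.integral_dotProduct_sq_le hu _).trans ?_
    rw [clusterPart_dotProduct_clusterPart]
    refine mul_le_mul_of_nonneg_left ?_ hu0.le
    refine Finset.sum_le_sum fun j _ => ?_
    simp only [clusterPart]
    split_ifs
    · rfl
    · simpa using mul_self_nonneg (y j)
  have b2 : (∫ ω, (clusterPart cl g (ε ω) ⬝ᵥ clusterPart cl g (ε ω)) ^ q ∂P) / M ≤ 1 := by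
    rwa [div_le_one hM]
  have hpos : 0 ≤ u ^ α * M ^ β * r := by positivity
  calc _ ≤ u ^ α * M ^ β * r * (α * 1 + β * 1) := by gcongr
    _ = _ := by rw [mul_one, mul_one, hαβ, mul_one]

/-- The power mean inequality over at most `N` coordinates gives `N^{q-1}`; summing the coordinate
moments supplies the last factor `N`. -/
lemma integral_clusterPart_rpow_le (hm : Measurable ε) {q C : ℝ} (hq : 1 ≤ q) (hC : 0 ≤ C)
    (hi : ∀ j, Integrable (fun ω => |ε ω j| ^ (2 * q)) P)
    (hb : ∀ j, ∫ ω, |ε ω j| ^ (2 * q) ∂P ≤ C) (g : ι) {N : ℕ} (hN0 : 0 < N)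
    (hN : (Finset.univ.filter fun j => cl j = g).card ≤ N) :
    Integrable (fun ω => (clusterPart cl g (ε ω) ⬝ᵥ clusterPart cl g (ε ω)) ^ q) P ∧
      ∫ ω, (clusterPart cl g (ε ω) ⬝ᵥ clusterPart cl g (ε ω)) ^ q ∂P ≤ (N : ℝ) ^ q * C := by
  set s := Finset.univ.filter fun j => cl j = g with hs
  have hN0' : (0 : ℝ) < N := by exact_mod_cast hN0
  have e : ∀ ω, clusterPart cl g (ε ω) ⬝ᵥ clusterPart cl g (ε ω) = ∑ j ∈ s, |ε ω j| ^ 2 := by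
    intro ω
    simp only [dotProduct, clusterPart, hs, Finset.sum_filter, sq_abs]
    refine Finset.sum_congr rfl fun j _ => ?_
    split_ifs <;> simp [pow_two]
  have hle : ∀ ω, (clusterPart cl g (ε ω) ⬝ᵥ clusterPart cl g (ε ω)) ^ q
      ≤ (N : ℝ) ^ (q - 1) * ∑ j ∈ s, |ε ω j| ^ (2 * q) := by
    intro ω
    have h1 := Real.rpow_sum_le_const_mul_sum_rpow_of_nonneg s hq
      (f := fun j => |ε ω j| ^ 2) (fun j _ => by positivity)
    have e2 : ∀ j, (|ε ω j| ^ 2) ^ q = |ε ω j| ^ (2 * q) := fun j => by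
      rw [← Real.rpow_natCast, ← Real.rpow_mul (abs_nonneg _)]
      norm_num
    simp only [e2] at h1
    rw [e]
    refine h1.trans (mul_le_mul_of_nonneg_right ?_
      (Finset.sum_nonneg fun j _ => Real.rpow_nonneg (abs_nonneg _) _))
    exact Real.rpow_le_rpow (Nat.cast_nonneg _) (by exact_mod_cast hN) (by linarith)
  have ib : Integrable (fun ω => (N : ℝ) ^ (q - 1) * ∑ j ∈ s, |ε ω j| ^ (2 * q)) P :=
    (integrable_finsetSum _ fun j _ => hi j).const_mul _
  have h0 : ∀ ω, 0 ≤ (clusterPart cl g (ε ω) ⬝ᵥ clusterPart cl g (ε ω)) ^ q := fun ω =>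
    Real.rpow_nonneg (dotProduct_self_nonneg' _) _
  have hms : Measurable fun ω => (clusterPart cl g (ε ω) ⬝ᵥ clusterPart cl g (ε ω)) ^ q := by
    have h1 : Measurable fun ω => clusterPart cl g (ε ω) := (measurable_clusterPart cl g).comp hm
    have h2 : Continuous fun x : J → ℝ => x ⬝ᵥ x := by fun_prop
    exact (h2.measurable.comp h1).pow_const q
  refine ⟨ib.mono' hms.aestronglyMeasurable (.of_forall fun ω => ?_), ?_⟩
  · rw [Real.norm_of_nonneg (h0 ω)]
    exact hle ω
  refine (integral_mono_of_nonneg (.of_forall h0) ib (.of_forall hle)).trans ?_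
  rw [integral_const_mul, integral_finsetSum _ fun j _ => hi j]
  calc _ ≤ (N : ℝ) ^ (q - 1) * (N * C) := by
        gcongr
        refine (Finset.sum_le_sum fun j _ => hb j).trans ?_
        rw [Finset.sum_const, nsmul_eq_mul]
        gcongr
    _ = _ := by
        rw [← mul_assoc, ← Real.rpow_add_one hN0'.ne', sub_add_cancel]

end ClusterNoise

/-! ### Eigenvalue bounds as bounds on quadratic forms. -/

section Spectrum

variable {n : Type} [Fintype n] [DecidableEq n]

open scoped MatrixOrder in
lemma le_quadForm_of_le_spectrum {Q : Matrix n n ℝ} (hQ : Q.IsSymm) {c : ℝ}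
    (h : ∀ x ∈ spectrum ℝ Q, c ≤ x) (x : n → ℝ) : c * (x ⬝ᵥ x) ≤ x ⬝ᵥ Q *ᵥ x := by
  have h1 : algebraMap ℝ _ c ≤ Q :=
    (algebraMap_le_iff_le_spectrum (a := Q)
      (by rw [IsSelfAdjoint, Matrix.star_eq_conjTranspose, Matrix.conjTranspose_eq_transpose_of_trivial, hQ.eq])).2 h
  have h2 := (Matrix.le_iff.1 h1).dotProduct_mulVec_nonneg x
  rw [Algebra.algebraMap_eq_smul_one, Matrix.sub_mulVec, dotProduct_sub, Matrix.smul_mulVec,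
    Matrix.one_mulVec, dotProduct_smul, smul_eq_mul, star_trivial] at h2
  linarith

open scoped MatrixOrder in
lemma quadForm_le_of_spectrum_le {Q : Matrix n n ℝ} (hQ : Q.IsSymm) {u : ℝ}
    (h : ∀ x ∈ spectrum ℝ Q, x ≤ u) (x : n → ℝ) : x ⬝ᵥ Q *ᵥ x ≤ u * (x ⬝ᵥ x) := by
  have h1 : Q ≤ algebraMap ℝ _ u :=
    (le_algebraMap_iff_spectrum_le (a := Q)
      (by rw [IsSelfAdjoint, Matrix.star_eq_conjTranspose, Matrix.conjTranspose_eq_transpose_of_trivial, hQ.eq])).2 h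
  have h2 := (Matrix.le_iff.1 h1).dotProduct_mulVec_nonneg x
  rw [Algebra.algebraMap_eq_smul_one, Matrix.sub_mulVec, dotProduct_sub, Matrix.smul_mulVec,
    Matrix.one_mulVec, dotProduct_smul, smul_eq_mul, star_trivial] at h2
  linarith

lemma isUnit_of_le_quadForm {Q : Matrix n n ℝ} {c : ℝ} (hc : 0 < c)
    (h : ∀ x, c * (x ⬝ᵥ x) ≤ x ⬝ᵥ Q *ᵥ x) : IsUnit Q := by
  rw [← Matrix.mulVec_injective_iff_isUnit]
  refine (injective_iff_map_eq_zero (Matrix.mulVecLin Q)).2 fun x hx => ?_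
  have h1 := h x
  rw [Matrix.mulVecLin_apply] at hx
  rw [hx, dotProduct_zero] at h1
  have h2 := dotProduct_self_nonneg' x
  exact dotProduct_self_eq_zero.1 (by nlinarith)

/-- For `y = Q⁻¹x` coercivity says `c|y|² ≤ y'x`, and Cauchy-Schwarz bounds the right side by
`|y||x|`. -/
lemma inv_mulVec_sq_le {Q : Matrix n n ℝ} {c : ℝ} (hc : 0 < c)
    (h : ∀ x, c * (x ⬝ᵥ x) ≤ x ⬝ᵥ Q *ᵥ x) (x : n → ℝ) :
    c ^ 2 * (Q⁻¹ *ᵥ x ⬝ᵥ Q⁻¹ *ᵥ x) ≤ x ⬝ᵥ x := by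
  have h1 := h (Q⁻¹ *ᵥ x)
  rw [Matrix.mulVec_mulVec, Matrix.mul_nonsing_inv _
    ((Matrix.isUnit_iff_isUnit_det Q).1 (isUnit_of_le_quadForm hc h)), Matrix.one_mulVec] at h1
  have h2 := dotProduct_sq_le (Q⁻¹ *ᵥ x) x
  have h3 := dotProduct_self_nonneg' (Q⁻¹ *ᵥ x)
  rcases h3.eq_or_lt with h4 | h4
  · rw [← h4, mul_zero]
    exact dotProduct_self_nonneg' x
  · have h5 : (c * (Q⁻¹ *ᵥ x ⬝ᵥ Q⁻¹ *ᵥ x)) ^ 2 ≤ (Q⁻¹ *ᵥ x ⬝ᵥ x) ^ 2 :=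
      pow_le_pow_left₀ (by positivity) h1 2
    refine le_of_mul_le_mul_left (a := Q⁻¹ *ᵥ x ⬝ᵥ Q⁻¹ *ᵥ x) ?_ h4
    nlinarith

end Spectrum

/-! ### The matrices of the design and their operator bounds. -/

namespace ClusterDesign

section OpNorm

variable {m n : Type} [Fintype m] [Fintype n] [DecidableEq n]

lemma opNorm_nonneg (Q : Matrix m n ℝ) : 0 ≤ opNorm Q := norm_nonneg _

lemma norm_toLp_sq (x : m → ℝ) : ‖WithLp.toLp 2 x‖ ^ 2 = x ⬝ᵥ x := by
  rw [EuclideanSpace.norm_sq_eq]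
  simp [dotProduct, sq]

lemma mulVec_sq_le_opNorm (Q : Matrix m n ℝ) (x : n → ℝ) :
    Q *ᵥ x ⬝ᵥ Q *ᵥ x ≤ opNorm Q ^ 2 * (x ⬝ᵥ x) := by
  have h := (LinearMap.toContinuousLinearMap (Matrix.toEuclideanLin Q)).le_opNorm (WithLp.toLp 2 x)
  have h2 := pow_le_pow_left₀ (norm_nonneg _) h 2
  rw [mul_pow, norm_toLp_sq x] at h2
  rw [← norm_toLp_sq (Q *ᵥ x)]
  exact h2

lemma opNorm_le_one {Q : Matrix m n ℝ} (h : ∀ x, Q *ᵥ x ⬝ᵥ Q *ᵥ x ≤ x ⬝ᵥ x) : opNorm Q ≤ 1 := by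
  refine ContinuousLinearMap.opNorm_le_bound _ zero_le_one fun x => ?_
  rw [one_mul]
  refine le_of_sq_le_sq ?_ (norm_nonneg _)
  have h1 : ‖x‖ ^ 2 = x.ofLp ⬝ᵥ x.ofLp := norm_toLp_sq x.ofLp
  rw [h1]
  refine le_trans (le_of_eq ?_) (h x.ofLp)
  exact norm_toLp_sq (Q *ᵥ x.ofLp)

lemma dotProduct_mulVec_sq_le_opNorm (Q : Matrix m n ℝ) (x : m → ℝ) (y : n → ℝ) :
    (x ⬝ᵥ Q *ᵥ y) ^ 2 ≤ opNorm Q ^ 2 * (x ⬝ᵥ x) * (y ⬝ᵥ y) := by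
  have h1 := dotProduct_sq_le x (Q *ᵥ y)
  have h2 := mul_le_mul_of_nonneg_left (mulVec_sq_le_opNorm Q y) (dotProduct_self_nonneg' x)
  linarith

lemma eq_zero_of_opNorm_eq_zero {Q : Matrix m n ℝ} (h : opNorm Q = 0) : Q = 0 := by
  refine Matrix.toLin'.injective (LinearMap.ext fun x => ?_)
  have h1 := mulVec_sq_le_opNorm Q x
  rw [h] at h1
  have h2 := dotProduct_self_nonneg' (Q *ᵥ x)
  simpa using dotProduct_self_eq_zero.1 (show Q *ᵥ x ⬝ᵥ Q *ᵥ x = 0 by linarith)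

end OpNorm

section InvSqrt

variable {n : Type} [Fintype n] [DecidableEq n]

open scoped MatrixOrder in
lemma invSqrt_mul_invSqrt {S : Matrix n n ℝ} (hS : S.PosSemidef) :
    invSqrt S * invSqrt S = S⁻¹ :=
  CFC.sqrt_mul_sqrt_self S⁻¹ hS.inv.nonneg

open scoped MatrixOrder in
lemma invSqrt_isSymm (S : Matrix n n ℝ) : (invSqrt S).IsSymm := by
  have h := (Matrix.nonneg_iff_posSemidef.1 (CFC.sqrt_nonneg S⁻¹)).isHermitian
  rwa [Matrix.IsHermitian, Matrix.conjTranspose_eq_transpose_of_trivial] at h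

end InvSqrt

variable {D : ClusterDesign}

lemma gram_posSemidef : D.gram.PosSemidef := by
  have := Matrix.posSemidef_conjTranspose_mul_self D.W
  rwa [Matrix.conjTranspose_eq_transpose_of_trivial] at this

lemma gram_isSymm : D.gram.IsSymm := by
  rw [Matrix.IsSymm, gram, Matrix.transpose_mul, Matrix.transpose_transpose]

lemma gram_inv_isSymm : D.gram⁻¹.IsSymm := by
  rw [Matrix.IsSymm, Matrix.transpose_nonsing_inv, gram_isSymm.eq]

lemma gram_mul_inv (hr : IsUnit D.gram) : D.gram * D.gram⁻¹ = 1 :=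
  Matrix.mul_nonsing_inv _ ((Matrix.isUnit_iff_isUnit_det _).1 hr)

lemma gram_inv_mul (hr : IsUnit D.gram) : D.gram⁻¹ * D.gram = 1 :=
  Matrix.nonsing_inv_mul _ ((Matrix.isUnit_iff_isUnit_det _).1 hr)

/-- The quadratic form of `(W'W)⁻¹`. -/
noncomputable def invGramForm (D : ClusterDesign) (v : Fin D.d → ℝ) : ℝ := v ⬝ᵥ D.gram⁻¹ *ᵥ v

lemma invGramForm_eq (v : Fin D.d → ℝ) :
    D.invGramForm v = invSqrt D.gram *ᵥ v ⬝ᵥ invSqrt D.gram *ᵥ v := by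
  rw [invGramForm, ← invSqrt_mul_invSqrt gram_posSemidef, ← Matrix.mulVec_mulVec,
    Matrix.dotProduct_mulVec, ← Matrix.mulVec_transpose, (invSqrt_isSymm _).eq]

lemma invGramForm_nonneg (v : Fin D.d → ℝ) : 0 ≤ D.invGramForm v := by
  rw [invGramForm_eq]
  exact dotProduct_self_nonneg' _

/-- The matrix `(W'W)⁻¹ A₀ (W'W)⁻¹`. -/
noncomputable def core (D : ClusterDesign) : Matrix (Fin D.d) (Fin D.d) ℝ := D.gram⁻¹ * D.A₀ * D.gram⁻¹

/-- Pulling `(W'W)^{-1/2}` out on both sides leaves a matrix of operator norm `h`. All bounds on `A`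
below combine this with estimates of `invGramForm` at `W'x`. -/
lemma core_sq_le (v w : Fin D.d → ℝ) :
    (v ⬝ᵥ D.core *ᵥ w) ^ 2 ≤ D.hNorm ^ 2 * D.invGramForm v * D.invGramForm w := by
  rw [invGramForm_eq, invGramForm_eq]
  refine le_trans (le_of_eq ?_) (dotProduct_mulVec_sq_le_opNorm _ _ _)
  congr 1
  have h : D.core = invSqrt D.gram * (invSqrt D.gram * D.A₀ * invSqrt D.gram) * invSqrt D.gram := by
    rw [core, ← invSqrt_mul_invSqrt gram_posSemidef]
    simp only [Matrix.mul_assoc]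
  rw [h, ← Matrix.mulVec_mulVec, ← Matrix.mulVec_mulVec, Matrix.dotProduct_mulVec v,
    ← Matrix.mulVec_transpose, (invSqrt_isSymm _).eq]

lemma A_eq : D.A = D.W * D.core * D.Wᵀ := by
  simp only [A, core, Matrix.mul_assoc]

lemma hNorm_nonneg : 0 ≤ D.hNorm := opNorm_nonneg _

lemma hNorm_pos (hr : IsUnit D.gram) (hA : D.A₀ ≠ 0) : 0 < D.hNorm := by
  refine lt_of_le_of_ne hNorm_nonneg fun h => hA ?_
  have h1 : D.core = 0 := by
    have := eq_zero_of_opNorm_eq_zero h.symm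
    rw [core, ← invSqrt_mul_invSqrt gram_posSemidef,
      show invSqrt D.gram * invSqrt D.gram * D.A₀ * (invSqrt D.gram * invSqrt D.gram)
        = invSqrt D.gram * (invSqrt D.gram * D.A₀ * invSqrt D.gram) * invSqrt D.gram by
        simp only [Matrix.mul_assoc], this, Matrix.mul_zero, Matrix.zero_mul]
  calc D.A₀ = (D.gram * D.gram⁻¹) * D.A₀ * (D.gram⁻¹ * D.gram) := by
        rw [gram_mul_inv hr, gram_inv_mul hr, Matrix.one_mul, Matrix.mul_one]
    _ = D.gram * D.core * D.gram := by simp only [core, Matrix.mul_assoc]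
    _ = 0 := by rw [h1, Matrix.mul_zero, Matrix.zero_mul]

lemma proj_isSymm : D.proj.IsSymm := by
  rw [Matrix.IsSymm, proj, Matrix.transpose_mul, Matrix.transpose_mul, Matrix.transpose_transpose,
    gram_inv_isSymm.eq, Matrix.mul_assoc]

lemma annih_isSymm : D.annih.IsSymm := by
  rw [Matrix.IsSymm, annih, Matrix.transpose_sub, Matrix.transpose_one, proj_isSymm.eq]

lemma proj_mul_W (hr : IsUnit D.gram) : D.proj * D.W = D.W := by
  rw [proj, Matrix.mul_assoc, Matrix.mul_assoc, ← gram, gram_inv_mul hr, Matrix.mul_one]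

lemma proj_mul_proj (hr : IsUnit D.gram) : D.proj * D.proj = D.proj := by
  conv_lhs => rhs; rw [proj]
  rw [← Matrix.mul_assoc, ← Matrix.mul_assoc, proj_mul_W hr, ← proj]

lemma dotProduct_proj_mulVec (x : D.Obs → ℝ) :
    x ⬝ᵥ D.proj *ᵥ x = D.invGramForm (D.Wᵀ *ᵥ x) := by
  rw [invGramForm, proj, ← Matrix.mulVec_mulVec, ← Matrix.mulVec_mulVec, Matrix.dotProduct_mulVec,
    ← Matrix.mulVec_transpose]

lemma proj_mulVec_sq (hr : IsUnit D.gram) (x : D.Obs → ℝ) :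
    D.proj *ᵥ x ⬝ᵥ D.proj *ᵥ x = x ⬝ᵥ D.proj *ᵥ x := by
  conv_rhs => rw [← proj_mul_proj hr, ← Matrix.mulVec_mulVec, Matrix.dotProduct_mulVec,
    ← Matrix.mulVec_transpose, proj_isSymm.eq]

lemma annih_mulVec_sq (hr : IsUnit D.gram) (x : D.Obs → ℝ) :
    D.annih *ᵥ x ⬝ᵥ D.annih *ᵥ x = x ⬝ᵥ x - x ⬝ᵥ D.proj *ᵥ x := by
  rw [annih, Matrix.sub_mulVec, Matrix.one_mulVec, sub_dotProduct, dotProduct_sub, dotProduct_sub,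
    proj_mulVec_sq hr, dotProduct_comm (D.proj *ᵥ x) x]
  ring

lemma annih_mulVec_sq_le (hr : IsUnit D.gram) (x : D.Obs → ℝ) :
    D.annih *ᵥ x ⬝ᵥ D.annih *ᵥ x ≤ x ⬝ᵥ x := by
  rw [annih_mulVec_sq hr, ← proj_mulVec_sq hr]
  linarith [dotProduct_self_nonneg' (D.proj *ᵥ x)]

lemma invGramForm_le (hr : IsUnit D.gram) (x : D.Obs → ℝ) :
    D.invGramForm (D.Wᵀ *ᵥ x) ≤ x ⬝ᵥ x := by
  rw [← dotProduct_proj_mulVec]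
  linarith [annih_mulVec_sq hr x, dotProduct_self_nonneg' (D.annih *ᵥ x)]

lemma dotProduct_eq_sum_seg (x y : D.Obs → ℝ) : x ⬝ᵥ y = ∑ g, seg x g ⬝ᵥ seg y g := by
  rw [dotProduct, Fintype.sum_sigma]
  rfl

lemma seg_dotProduct_seg_le (x : D.Obs → ℝ) (g : Fin D.G) : seg x g ⬝ᵥ seg x g ≤ x ⬝ᵥ x := by
  rw [dotProduct_eq_sum_seg x x]
  exact Finset.single_le_sum (f := fun g => seg x g ⬝ᵥ seg x g)
    (fun k _ => dotProduct_self_nonneg' _) (Finset.mem_univ g)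

lemma seg_clusterPart_self (g : Fin D.G) (x : D.Obs → ℝ) :
    seg (clusterPart Sigma.fst g x) g = seg x g := by
  ext i
  simp [seg, clusterPart]

lemma seg_clusterPart_of_ne {g k : Fin D.G} (h : k ≠ g) (x : D.Obs → ℝ) :
    seg (clusterPart Sigma.fst g x) k = 0 := by
  ext i
  simp [seg, clusterPart, h]

lemma clusterPart_dotProduct_eq_seg (g : Fin D.G) (x y : D.Obs → ℝ) :
    clusterPart Sigma.fst g x ⬝ᵥ y = seg x g ⬝ᵥ seg y g := by
  rw [dotProduct_eq_sum_seg, Finset.sum_eq_single g, seg_clusterPart_self]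
  · intro k _ hk
    rw [seg_clusterPart_of_ne hk, zero_dotProduct]
  · simp

/-- The `n`-vector that equals `z` on cluster `g` and vanishes elsewhere. -/
def emb (g : Fin D.G) (z : Fin (D.size g) → ℝ) : D.Obs → ℝ := fun j =>
  if e : j.1 = g then z (e ▸ j.2) else 0

@[simp]
lemma seg_emb_self (g : Fin D.G) (z : Fin (D.size g) → ℝ) : seg (emb g z) g = z := by
  ext i
  simp [seg, emb]

lemma seg_emb_of_ne {g k : Fin D.G} (h : k ≠ g) (z : Fin (D.size g) → ℝ) : seg (emb g z) k = 0 := by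
  ext i
  simp [seg, emb, h]

lemma ext_seg {x y : D.Obs → ℝ} (h : ∀ g, seg x g = seg y g) : x = y := by
  funext ⟨g, i⟩
  exact congrFun (h g) i

@[simp]
lemma clusterPart_emb (g : Fin D.G) (z : Fin (D.size g) → ℝ) :
    clusterPart Sigma.fst g (emb g z) = emb g z := by
  refine ext_seg fun k => ?_
  by_cases h : k = g
  · subst h
    rw [seg_clusterPart_self]
  · rw [seg_clusterPart_of_ne h, seg_emb_of_ne h]

lemma dotProduct_emb (g : Fin D.G) (x : D.Obs → ℝ) (z : Fin (D.size g) → ℝ) :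
    x ⬝ᵥ emb g z = seg x g ⬝ᵥ z := by
  rw [← clusterPart_emb, ← clusterPart_dotProduct_comm, clusterPart_dotProduct_eq_seg, seg_emb_self]

lemma W_transpose_mulVec_clusterPart (g : Fin D.G) (x : D.Obs → ℝ) :
    D.Wᵀ *ᵥ clusterPart Sigma.fst g x = (D.Wc g)ᵀ *ᵥ seg x g := by
  ext k
  rw [Matrix.mulVec, dotProduct_comm, clusterPart_dotProduct_eq_seg, Matrix.mulVec, dotProduct_comm]
  rfl

lemma W_transpose_mulVec_emb (g : Fin D.G) (z : Fin (D.size g) → ℝ) :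
    D.Wᵀ *ᵥ emb g z = (D.Wc g)ᵀ *ᵥ z := by
  rw [← clusterPart_emb, W_transpose_mulVec_clusterPart, seg_emb_self]

lemma block_W_mul_mul (R : Matrix (Fin D.d) (Fin D.d) ℝ) (g k : Fin D.G) :
    block (D.W * R * D.Wᵀ) g k = D.Wc g * R * (D.Wc k)ᵀ := rfl

lemma block_proj (g k : Fin D.G) : block D.proj g k = D.Wc g * D.gram⁻¹ * (D.Wc k)ᵀ := rfl

lemma block_annih_self (g : Fin D.G) :
    block D.annih g g = 1 - D.Wc g * D.gram⁻¹ * (D.Wc g)ᵀ := by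
  rw [← block_proj]
  ext i j
  simp [block, annih, Matrix.one_apply]

lemma block_A (g k : Fin D.G) : block D.A g k = D.Wc g * D.core * (D.Wc k)ᵀ := by
  rw [A_eq, block_W_mul_mul]

lemma block_annih_isSymm (g : Fin D.G) : (block D.annih g g).IsSymm := by
  rw [Matrix.IsSymm, block, Matrix.transpose_submatrix, annih_isSymm.eq]

lemma dotProduct_block_proj (g : Fin D.G) (z : Fin (D.size g) → ℝ) :
    z ⬝ᵥ block D.proj g g *ᵥ z = D.invGramForm ((D.Wc g)ᵀ *ᵥ z) := by
  rw [invGramForm, block_proj, ← Matrix.mulVec_mulVec, ← Matrix.mulVec_mulVec,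
    Matrix.dotProduct_mulVec, ← Matrix.mulVec_transpose]

lemma seg_mulVec_emb (Q : Matrix D.Obs D.Obs ℝ) (g k : Fin D.G) (z : Fin (D.size g) → ℝ) :
    seg (Q *ᵥ emb g z) k = block Q k g *ᵥ z := by
  ext i
  change Q.row ⟨k, i⟩ ⬝ᵥ emb g z = _
  rw [dotProduct_emb]
  rfl

lemma opNorm_block_proj_le_one (hr : IsUnit D.gram) (g : Fin D.G) : opNorm (block D.proj g g) ≤ 1 := by
  refine opNorm_le_one fun z => ?_
  rw [← seg_mulVec_emb]
  refine (seg_dotProduct_seg_le _ g).trans ?_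
  rw [proj_mulVec_sq hr, dotProduct_proj_mulVec]
  refine (invGramForm_le hr _).trans_eq ?_
  rw [dotProduct_emb, seg_emb_self]

lemma opNorm_block_proj_le_lam (g : Fin D.G) : opNorm (block D.proj g g) ≤ D.lam :=
  le_ciSup (f := fun g => opNorm (block D.proj g g)) (Set.finite_range _).bddAbove g

lemma lam_nonneg : 0 ≤ D.lam := Real.iSup_nonneg fun _ => opNorm_nonneg _

lemma lam_le_one (hr : IsUnit D.gram) : D.lam ≤ 1 :=
  Real.iSup_le (opNorm_block_proj_le_one hr) zero_le_one

/-- The left side is `z'P_{g,g}z`. This is the source of every factor `λ`: each argument supported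
on one cluster gains one. -/
lemma invGramForm_Wc_le (g : Fin D.G) (z : Fin (D.size g) → ℝ) :
    D.invGramForm ((D.Wc g)ᵀ *ᵥ z) ≤ D.lam * (z ⬝ᵥ z) := by
  rw [← dotProduct_block_proj]
  have h0 := dotProduct_self_nonneg' z
  refine abs_le_of_sq_le_sq' ?_ (mul_nonneg lam_nonneg h0) |>.2
  refine (dotProduct_mulVec_sq_le_opNorm _ _ _).trans ?_
  rw [mul_pow, sq (z ⬝ᵥ z), mul_assoc]
  have := opNorm_nonneg (block D.proj g g)
  gcongr
  exact opNorm_block_proj_le_lam g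

lemma invGramForm_clusterPart_le (g : Fin D.G) (x : D.Obs → ℝ) :
    D.invGramForm (D.Wᵀ *ᵥ clusterPart Sigma.fst g x)
      ≤ D.lam * (clusterPart Sigma.fst g x ⬝ᵥ clusterPart Sigma.fst g x) := by
  rw [W_transpose_mulVec_clusterPart, clusterPart_dotProduct_eq_seg, seg_clusterPart_self]
  exact invGramForm_Wc_le g _

lemma seg_blockDiagonal'_mulVec
    (F : ∀ g : Fin D.G, Matrix (Fin (D.size g)) (Fin (D.size g)) ℝ) (x : D.Obs → ℝ) (g : Fin D.G) :
    seg (Matrix.blockDiagonal' F *ᵥ x) g = F g *ᵥ seg x g := by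
  ext i
  simp only [seg, Matrix.mulVec, dotProduct, Fintype.sum_sigma]
  rw [Finset.sum_eq_single g]
  · simp [Matrix.blockDiagonal'_apply]
  · intro k _ hk
    refine Finset.sum_eq_zero fun j _ => ?_
    rw [Matrix.blockDiagonal'_apply_ne _ _ _ hk.symm, zero_mul]
  · simp

lemma mulVec_sq_le_of_seg {Q : Matrix D.Obs D.Obs ℝ}
    {F : ∀ g : Fin D.G, Matrix (Fin (D.size g)) (Fin (D.size g)) ℝ}
    (hQ : Q = Matrix.blockDiagonal' F) {a : ℝ} (h : ∀ g z, F g *ᵥ z ⬝ᵥ F g *ᵥ z ≤ a * (z ⬝ᵥ z))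
    (x : D.Obs → ℝ) : Q *ᵥ x ⬝ᵥ Q *ᵥ x ≤ a * (x ⬝ᵥ x) := by
  rw [dotProduct_eq_sum_seg, dotProduct_eq_sum_seg x x, Finset.mul_sum]
  refine Finset.sum_le_sum fun g _ => ?_
  rw [hQ, seg_blockDiagonal'_mulVec]
  exact h g _

/-- A bilinear form bounded by two quadratic forms, the first of which is bounded by the square of the
norm, bounds the norm of the vector that represents it. -/
lemma dotProduct_self_le_of_sq_le {J : Type} [Fintype J] {w : J → ℝ} {a b : ℝ} (ha : 0 ≤ a) (hb : 0 ≤ b)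
    (h : (w ⬝ᵥ w) ^ 2 ≤ a * (w ⬝ᵥ w) * b) : w ⬝ᵥ w ≤ a * b := by
  rcases (dotProduct_self_nonneg' w).eq_or_lt with h0 | h0
  · rw [← h0]
    positivity
  · refine le_of_mul_le_mul_left (a := w ⬝ᵥ w) ?_ h0
    nlinarith

lemma dotProduct_block_A (g k : Fin D.G) (x : Fin (D.size g) → ℝ) (y : Fin (D.size k) → ℝ) :
    x ⬝ᵥ block D.A g k *ᵥ y = ((D.Wc g)ᵀ *ᵥ x) ⬝ᵥ D.core *ᵥ ((D.Wc k)ᵀ *ᵥ y) := by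
  rw [block_A, ← Matrix.mulVec_mulVec, ← Matrix.mulVec_mulVec, Matrix.dotProduct_mulVec,
    ← Matrix.mulVec_transpose]

lemma dotProduct_A (x y : D.Obs → ℝ) :
    x ⬝ᵥ D.A *ᵥ y = (D.Wᵀ *ᵥ x) ⬝ᵥ D.core *ᵥ (D.Wᵀ *ᵥ y) := by
  rw [A_eq, ← Matrix.mulVec_mulVec, ← Matrix.mulVec_mulVec, Matrix.dotProduct_mulVec,
    ← Matrix.mulVec_transpose]

lemma block_A_sq_le (g : Fin D.G) (y : Fin (D.size g) → ℝ) :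
    block D.A g g *ᵥ y ⬝ᵥ block D.A g g *ᵥ y ≤ D.hNorm ^ 2 * D.lam ^ 2 * (y ⬝ᵥ y) := by
  have h0 := dotProduct_self_nonneg' y
  have hl := lam_nonneg (D := D)
  refine (dotProduct_self_le_of_sq_le (a := D.hNorm ^ 2 * D.lam) (b := D.lam * (y ⬝ᵥ y))
    (by positivity) (by positivity) ?_).trans_eq (by ring)
  set w := block D.A g g *ᵥ y with hw
  have h5 : w ⬝ᵥ w = w ⬝ᵥ block D.A g g *ᵥ y := rfl
  conv_lhs => rw [h5, dotProduct_block_A]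
  refine (core_sq_le _ _).trans ?_
  have h1 := invGramForm_Wc_le g w
  have h2 := invGramForm_Wc_le g y
  have h3 := invGramForm_nonneg (D := D) ((D.Wc g)ᵀ *ᵥ y)
  have h4 := dotProduct_self_nonneg' w
  rw [mul_assoc (D.hNorm ^ 2) D.lam]
  gcongr

lemma block_A_transpose_sq_le (g : Fin D.G) (y : Fin (D.size g) → ℝ) :
    (block D.A g g)ᵀ *ᵥ y ⬝ᵥ (block D.A g g)ᵀ *ᵥ y ≤ D.hNorm ^ 2 * D.lam ^ 2 * (y ⬝ᵥ y) := by
  have h0 := dotProduct_self_nonneg' y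
  have hl := lam_nonneg (D := D)
  refine (dotProduct_self_le_of_sq_le (a := D.hNorm ^ 2 * D.lam) (b := D.lam * (y ⬝ᵥ y))
    (by positivity) (by positivity) ?_).trans_eq (by ring)
  set w := (block D.A g g)ᵀ *ᵥ y with hw
  have h5 : w ⬝ᵥ w = y ⬝ᵥ block D.A g g *ᵥ w := by
    conv_lhs => rw [dotProduct_comm]; rhs; rw [hw]
    rw [Matrix.dotProduct_mulVec, Matrix.vecMul_transpose, dotProduct_comm]
  conv_lhs => rw [h5]
  rw [dotProduct_block_A]
  refine (core_sq_le _ _).trans ?_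
  have h1 := invGramForm_Wc_le g w
  have h2 := invGramForm_Wc_le g y
  have h3 := invGramForm_nonneg (D := D) ((D.Wc g)ᵀ *ᵥ y)
  have h3' := invGramForm_nonneg (D := D) ((D.Wc g)ᵀ *ᵥ w)
  have h4 := dotProduct_self_nonneg' w
  rw [mul_assoc (D.hNorm ^ 2) D.lam, mul_right_comm]
  gcongr

/-! ### Norm bounds for `B`, its hollowness, and the leave-one-cluster-out identity. -/

section LeaveOut

variable {c : ℝ}

lemma block_annih_mul_inv (hc : 0 < c)
    (hM : ∀ g, ∀ z, c * (z ⬝ᵥ z) ≤ z ⬝ᵥ block D.annih g g *ᵥ z) (g : Fin D.G) :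
    block D.annih g g * (block D.annih g g)⁻¹ = 1 :=
  Matrix.mul_nonsing_inv _ ((Matrix.isUnit_iff_isUnit_det _).1 (isUnit_of_le_quadForm hc (hM g)))

lemma corr_sq_le (hc : 0 < c) (hM : ∀ g, ∀ z, c * (z ⬝ᵥ z) ≤ z ⬝ᵥ block D.annih g g *ᵥ z)
    (x : D.Obs → ℝ) :
    D.corr *ᵥ x ⬝ᵥ D.corr *ᵥ x ≤ (c ^ 2)⁻¹ * (D.hNorm ^ 2 * D.lam ^ 2) * (x ⬝ᵥ x) := by
  refine mulVec_sq_le_of_seg rfl (fun g z => ?_) x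
  rw [← Matrix.mulVec_mulVec, mul_assoc, ← div_eq_inv_mul, le_div_iff₀' (by positivity)]
  exact (inv_mulVec_sq_le hc (hM g) _).trans (block_A_sq_le g z)

lemma corr_transpose_sq_le (hc : 0 < c)
    (hM : ∀ g, ∀ z, c * (z ⬝ᵥ z) ≤ z ⬝ᵥ block D.annih g g *ᵥ z) (x : D.Obs → ℝ) :
    D.corrᵀ *ᵥ x ⬝ᵥ D.corrᵀ *ᵥ x ≤ (c ^ 2)⁻¹ * (D.hNorm ^ 2 * D.lam ^ 2) * (x ⬝ᵥ x) := by
  refine mulVec_sq_le_of_seg (Matrix.blockDiagonal'_transpose _) (fun g z => ?_) x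
  rw [Matrix.transpose_mul, Matrix.transpose_nonsing_inv, (block_annih_isSymm g).eq,
    ← Matrix.mulVec_mulVec]
  refine (block_A_transpose_sq_le g _).trans ?_
  rw [mul_comm (c ^ 2)⁻¹, mul_assoc (D.hNorm ^ 2 * D.lam ^ 2), ← div_eq_inv_mul]
  refine mul_le_mul_of_nonneg_left ?_ (by positivity)
  rw [le_div_iff₀' (by positivity)]
  exact inv_mulVec_sq_le hc (hM g) z

end LeaveOut

lemma _root_.sub_dotProduct_sub_le {J : Type} [Fintype J] (x y : J → ℝ) :
    (x - y) ⬝ᵥ (x - y) ≤ 2 * (x ⬝ᵥ x) + 2 * (y ⬝ᵥ y) := by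
  have h := dotProduct_self_nonneg' (x + y)
  simp only [sub_dotProduct, dotProduct_sub, add_dotProduct, dotProduct_add] at h ⊢
  linarith

lemma _root_.clusterPart_dotProduct_self_le {J ι : Type} [Fintype J] [DecidableEq ι] (cl : J → ι) (g : ι)
    (x : J → ℝ) : clusterPart cl g x ⬝ᵥ clusterPart cl g x ≤ x ⬝ᵥ x := by
  refine Finset.sum_le_sum fun j _ => ?_
  simp only [clusterPart]
  split_ifs
  · exact le_rfl
  · rw [mul_zero]
    exact mul_self_nonneg _

/-- The matrix `Q` is bounded by `a` as an operator, by `a √λ` when restricted to a cluster, and by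
`a λ` from a cluster to a cluster. -/
structure BlockBound (D : ClusterDesign) (Q : Matrix D.Obs D.Obs ℝ) (a : ℝ) : Prop where
  mulVec_le : ∀ x, Q *ᵥ x ⬝ᵥ Q *ᵥ x ≤ a * (x ⬝ᵥ x)
  mulVec_clusterPart_le : ∀ g x, Q *ᵥ clusterPart Sigma.fst g x ⬝ᵥ Q *ᵥ clusterPart Sigma.fst g x
    ≤ a * D.lam * (clusterPart Sigma.fst g x ⬝ᵥ clusterPart Sigma.fst g x)
  clusterPart_mulVec_clusterPart_le : ∀ g k x,
    clusterPart Sigma.fst k (Q *ᵥ clusterPart Sigma.fst g x)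
        ⬝ᵥ clusterPart Sigma.fst k (Q *ᵥ clusterPart Sigma.fst g x)
      ≤ a * D.lam ^ 2 * (clusterPart Sigma.fst g x ⬝ᵥ clusterPart Sigma.fst g x)

/-- Test the bilinear bound at `x = Qy`, or at its part in cluster `k`, and cancel one factor of the
norm. Localizing `y` gains one `λ`, localizing `Qy` as well gains another. -/
lemma blockBound_of_sq_le (hr : IsUnit D.gram) {Q : Matrix D.Obs D.Obs ℝ} {a : ℝ} (ha : 0 ≤ a)
    (h : ∀ x y, (x ⬝ᵥ Q *ᵥ y) ^ 2
      ≤ a * D.invGramForm (D.Wᵀ *ᵥ x) * D.invGramForm (D.Wᵀ *ᵥ y)) : BlockBound D Q a := by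
  have h1 : ∀ y, Q *ᵥ y ⬝ᵥ Q *ᵥ y ≤ a * D.invGramForm (D.Wᵀ *ᵥ y) := fun y => by
    have h2 := invGramForm_nonneg (D.Wᵀ *ᵥ y)
    refine dotProduct_self_le_of_sq_le ha h2 ((h (Q *ᵥ y) y).trans ?_)
    gcongr
    exact invGramForm_le hr _
  have hl := lam_nonneg (D := D)
  refine ⟨fun x => (h1 x).trans ?_, fun g x => (h1 _).trans ?_, fun g k x => ?_⟩
  · gcongr
    exact invGramForm_le hr _
  · rw [mul_assoc]
    gcongr
    exact invGramForm_clusterPart_le g x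
  · set y := clusterPart Sigma.fst g x with hy
    have h2 := invGramForm_nonneg (D.Wᵀ *ᵥ y)
    have h3 : D.invGramForm (D.Wᵀ *ᵥ y) ≤ D.lam * (y ⬝ᵥ y) := invGramForm_clusterPart_le g x
    have h4 : clusterPart Sigma.fst k (Q *ᵥ y) ⬝ᵥ clusterPart Sigma.fst k (Q *ᵥ y)
        ≤ a * D.lam * D.invGramForm (D.Wᵀ *ᵥ y) := by
      refine dotProduct_self_le_of_sq_le (by positivity) h2 ?_
      conv_lhs => rw [dotProduct_comm, clusterPart_dotProduct_comm, clusterPart_clusterPart,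
        dotProduct_comm]
      refine (h _ _).trans ?_
      rw [mul_assoc a D.lam]
      have h5 := invGramForm_clusterPart_le (D := D) k (Q *ᵥ y)
      gcongr
    refine h4.trans ?_
    rw [sq, ← mul_assoc, mul_assoc (a * D.lam)]
    gcongr

/-- As `λ ≤ 1`, a perturbation of squared norm `bλ²` fits all three scales `1`, `λ`, `λ²` at once.
The factor 2 is from `|x - y|² ≤ 2|x|² + 2|y|²`. -/
lemma BlockBound.sub (hr : IsUnit D.gram) {Q R : Matrix D.Obs D.Obs ℝ} {a b : ℝ}
    (hQ : BlockBound D Q a) (hb : 0 ≤ b)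
    (hR : ∀ x, R *ᵥ x ⬝ᵥ R *ᵥ x ≤ b * D.lam ^ 2 * (x ⬝ᵥ x)) :
    BlockBound D (Q - R) (2 * (a + b)) := by
  have hl := lam_nonneg (D := D)
  have hl1 := lam_le_one hr
  have h1 : b * D.lam ^ 2 ≤ b * D.lam := by
    gcongr
    nlinarith
  have h2 : b * D.lam ≤ b := by nlinarith
  refine ⟨fun x => ?_, fun g x => ?_, fun g k x => ?_⟩
  · rw [Matrix.sub_mulVec]
    refine (sub_dotProduct_sub_le _ _).trans ?_
    have := mul_le_mul_of_nonneg_right (h1.trans h2) (dotProduct_self_nonneg' x)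
    linarith [hQ.mulVec_le x, hR x]
  · rw [Matrix.sub_mulVec]
    refine (sub_dotProduct_sub_le _ _).trans ?_
    have := mul_le_mul_of_nonneg_right h1 (dotProduct_self_nonneg' (clusterPart Sigma.fst g x))
    linarith [hQ.mulVec_clusterPart_le g x, hR (clusterPart Sigma.fst g x)]
  · rw [Matrix.sub_mulVec, show ∀ x y : D.Obs → ℝ, clusterPart Sigma.fst k (x - y)
      = clusterPart Sigma.fst k x - clusterPart Sigma.fst k y from fun x y => by
        rw [sub_eq_add_neg, clusterPart_add, ← neg_one_smul ℝ y, clusterPart_smul, neg_one_smul,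
          sub_eq_add_neg]]
    refine (sub_dotProduct_sub_le _ _).trans ?_
    linarith [hQ.clusterPart_mulVec_clusterPart_le g k x, hR (clusterPart Sigma.fst g x),
      clusterPart_dotProduct_self_le Sigma.fst k (R *ᵥ clusterPart Sigma.fst g x)]

variable {c : ℝ}

lemma blockBound_B (hr : IsUnit D.gram) (hc : 0 < c)
    (hM : ∀ g, ∀ z, c * (z ⬝ᵥ z) ≤ z ⬝ᵥ block D.annih g g *ᵥ z) :
    BlockBound D D.B (2 * (D.hNorm ^ 2 + (c ^ 2)⁻¹ * D.hNorm ^ 2)) := by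
  refine (blockBound_of_sq_le hr (sq_nonneg _) fun x y => ?_).sub hr (by positivity) fun x => ?_
  · rw [dotProduct_A]
    exact core_sq_le _ _
  · rw [← Matrix.mulVec_mulVec, mul_assoc (c ^ 2)⁻¹]
    exact (annih_mulVec_sq_le hr _).trans (corr_sq_le hc hM x)

lemma blockBound_B_transpose (hr : IsUnit D.gram) (hc : 0 < c)
    (hM : ∀ g, ∀ z, c * (z ⬝ᵥ z) ≤ z ⬝ᵥ block D.annih g g *ᵥ z) :
    BlockBound D D.Bᵀ (2 * (D.hNorm ^ 2 + (c ^ 2)⁻¹ * D.hNorm ^ 2)) := by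
  rw [B, Matrix.transpose_sub, Matrix.transpose_mul, annih_isSymm.eq]
  refine (blockBound_of_sq_le hr (sq_nonneg _) fun x y => ?_).sub hr (by positivity) fun x => ?_
  · rw [Matrix.mulVec_transpose, dotProduct_comm, ← Matrix.dotProduct_mulVec, dotProduct_A,
      mul_right_comm]
    exact core_sq_le _ _
  · rw [← Matrix.mulVec_mulVec, mul_assoc (c ^ 2)⁻¹]
    refine (corr_transpose_sq_le hc hM _).trans ?_
    gcongr
    exact annih_mulVec_sq_le hr x

lemma annih_mul_W (hr : IsUnit D.gram) : D.annih * D.W = 0 := by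
  rw [annih, Matrix.sub_mul, Matrix.one_mul, proj_mul_W hr, sub_self]

lemma W_transpose_mul_annih (hr : IsUnit D.gram) : D.Wᵀ * D.annih = 0 := by
  rw [← annih_isSymm.eq, ← Matrix.transpose_mul, annih_mul_W hr, Matrix.transpose_zero]

lemma W_transpose_mul_A_mul_W (hr : IsUnit D.gram) : D.Wᵀ * D.A * D.W = D.A₀ := by
  calc D.Wᵀ * D.A * D.W = (D.gram * D.gram⁻¹) * D.A₀ * (D.gram⁻¹ * D.gram) := by
        simp only [A, gram, Matrix.mul_assoc]
    _ = D.A₀ := by rw [gram_mul_inv hr, gram_inv_mul hr, Matrix.one_mul, Matrix.mul_one]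

/-- The correction term starts with `M`, and `W'M = 0`. Consequently the signal part of `X'BY` is
exactly `θ`, and `B` cannot vanish. -/
lemma W_transpose_mul_B_mul_W (hr : IsUnit D.gram) : D.Wᵀ * D.B * D.W = D.A₀ := by
  rw [B, Matrix.mul_sub, ← Matrix.mul_assoc, W_transpose_mul_annih hr, Matrix.zero_mul, sub_zero,
    W_transpose_mul_A_mul_W hr]

lemma B_ne_zero (hr : IsUnit D.gram) (hA : D.A₀ ≠ 0) : D.B ≠ 0 := fun h => hA <| by
  rw [← W_transpose_mul_B_mul_W hr, h, Matrix.mul_zero, Matrix.zero_mul]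

lemma sigX_dotProduct_B_mulVec_sigY (hr : IsUnit D.gram) : D.sigX ⬝ᵥ D.B *ᵥ D.sigY = D.theta := by
  rw [theta, ← W_transpose_mul_B_mul_W hr, sigX, sigY, ← Matrix.mulVec_mulVec,
    ← Matrix.mulVec_mulVec, Matrix.dotProduct_mulVec D.coefX, Matrix.vecMul_transpose]

lemma corr_mulVec_clusterPart (g : Fin D.G) (y : D.Obs → ℝ) :
    D.corr *ᵥ clusterPart Sigma.fst g y
      = emb g ((block D.annih g g)⁻¹ *ᵥ block D.A g g *ᵥ seg y g) := by
  refine ext_seg fun k => ?_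
  rw [corr, seg_blockDiagonal'_mulVec, Matrix.mulVec_mulVec]
  by_cases hk : k = g
  · subst hk
    rw [seg_emb_self, seg_clusterPart_self]
  · rw [seg_emb_of_ne hk, seg_clusterPart_of_ne hk, Matrix.mulVec_zero]

lemma annih_mulVec_emb (g : Fin D.G) (z : Fin (D.size g) → ℝ) :
    D.annih *ᵥ emb g z = emb g z - D.W *ᵥ D.gram⁻¹ *ᵥ (D.Wc g)ᵀ *ᵥ z := by
  rw [annih, Matrix.sub_mulVec, Matrix.one_mulVec, proj, ← Matrix.mulVec_mulVec,
    ← Matrix.mulVec_mulVec, W_transpose_mulVec_emb]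

/-- The `(g,g)` block of the correction is `M_{g,g} M_{g,g}⁻¹ A_{g,g} = A_{g,g}`. -/
lemma block_B_self (hc : 0 < c) (hM : ∀ g, ∀ z, c * (z ⬝ᵥ z) ≤ z ⬝ᵥ block D.annih g g *ᵥ z)
    (g : Fin D.G) : block D.B g g = 0 := by
  refine Matrix.toLin'.injective (LinearMap.ext fun z => ?_)
  rw [Matrix.toLin'_apply, ← seg_mulVec_emb, B, Matrix.sub_mulVec, ← Matrix.mulVec_mulVec,
    ← clusterPart_emb, corr_mulVec_clusterPart, clusterPart_emb, seg_emb_self]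
  rw [show ∀ x y : D.Obs → ℝ, seg (x - y) g = seg x g - seg y g from fun _ _ => rfl,
    seg_mulVec_emb, seg_mulVec_emb, Matrix.mulVec_mulVec, block_annih_mul_inv hc hM,
    Matrix.one_mulVec, sub_self]
  simp

lemma isHollow_B (hc : 0 < c) (hM : ∀ g, ∀ z, c * (z ⬝ᵥ z) ≤ z ⬝ᵥ block D.annih g g *ᵥ z) :
    IsHollow Sigma.fst D.B := by
  rintro ⟨g, i⟩ ⟨k, j⟩ h
  obtain rfl : g = k := h
  exact congrFun (congrFun (block_B_self hc hM g) i) j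

/-- Woodbury's identity; the small matrix to invert is `1 - W_g (W'W)⁻¹ W_g' = M_{g,g}`. -/
lemma leaveOut_inv (hr : IsUnit D.gram) (hc : 0 < c)
    (hM : ∀ g, ∀ z, c * (z ⬝ᵥ z) ≤ z ⬝ᵥ block D.annih g g *ᵥ z) (g : Fin D.G) :
    (D.gram - (D.Wc g)ᵀ * D.Wc g)⁻¹
      = D.gram⁻¹ + D.gram⁻¹ * (D.Wc g)ᵀ * (block D.annih g g)⁻¹ * D.Wc g * D.gram⁻¹ := by
  refine Matrix.inv_eq_right_inv ?_
  set w := D.Wc g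
  set N := (block D.annih g g)⁻¹
  have h1 := gram_mul_inv hr
  have h2 : w * D.gram⁻¹ * wᵀ = 1 - block D.annih g g := by rw [block_annih_self, sub_sub_cancel]
  have h3 : block D.annih g g * N = 1 := block_annih_mul_inv hc hM g
  calc (D.gram - wᵀ * w) * (D.gram⁻¹ + D.gram⁻¹ * wᵀ * N * w * D.gram⁻¹)
      = D.gram * D.gram⁻¹ + (D.gram * D.gram⁻¹) * wᵀ * N * w * D.gram⁻¹ - wᵀ * w * D.gram⁻¹
          - wᵀ * ((w * D.gram⁻¹ * wᵀ) * N) * w * D.gram⁻¹ := by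
        simp only [Matrix.sub_mul, Matrix.mul_add, Matrix.mul_assoc]
        abel
    _ = 1 := by
        rw [h1, h2, Matrix.sub_mul, h3, Matrix.mul_sub, Matrix.sub_mul, Matrix.sub_mul]
        simp only [Matrix.one_mul, Matrix.mul_one, Matrix.mul_assoc]
        abel

/-- With `L` the leave-out inverse and `s = A₀(W'W)⁻¹W_g'y_g`, Woodbury gives `W_g L = M_{g,g}⁻¹ W_g
(W'W)⁻¹`. Hence `B` sends the part of `y` in cluster `g` to `WLs` with its entries in cluster `g`
deleted, which is precisely how `π̂_{-g}` omits that cluster. -/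
lemma dotProduct_B_mulVec_clusterPart (hr : IsUnit D.gram) (hc : 0 < c)
    (hM : ∀ g, ∀ z, c * (z ⬝ᵥ z) ≤ z ⬝ᵥ block D.annih g g *ᵥ z) (g : Fin D.G) (x y : D.Obs → ℝ) :
    x ⬝ᵥ D.B *ᵥ clusterPart Sigma.fst g y
      = D.piHatLO x g ⬝ᵥ D.A₀ *ᵥ D.gram⁻¹ *ᵥ (D.Wc g)ᵀ *ᵥ seg y g := by
  set w := D.Wc g with hw
  set N := (block D.annih g g)⁻¹ with hN
  set L := (D.gram - wᵀ * w)⁻¹ with hL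
  set s := D.A₀ *ᵥ D.gram⁻¹ *ᵥ wᵀ *ᵥ seg y g with hs
  have hLeq : L = D.gram⁻¹ + D.gram⁻¹ * wᵀ * N * w * D.gram⁻¹ := leaveOut_inv hr hc hM g
  have hLs : Lᵀ = L := by
    rw [hL, Matrix.transpose_nonsing_inv, Matrix.transpose_sub, gram_isSymm.eq,
      Matrix.transpose_mul, Matrix.transpose_transpose]
  have h2 : w * D.gram⁻¹ * wᵀ = 1 - block D.annih g g := by rw [block_annih_self, sub_sub_cancel]
  have hwL : w * L = N * w * D.gram⁻¹ := by
    rw [hLeq, Matrix.mul_add, show w * (D.gram⁻¹ * wᵀ * N * w * D.gram⁻¹)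
      = (w * D.gram⁻¹ * wᵀ) * N * w * D.gram⁻¹ by simp only [Matrix.mul_assoc], h2,
      Matrix.sub_mul, block_annih_mul_inv hc hM, Matrix.sub_mul, Matrix.sub_mul, Matrix.one_mul,
      Matrix.one_mul, add_sub_cancel]
  have hA : block D.A g g *ᵥ seg y g = w *ᵥ D.gram⁻¹ *ᵥ s := by
    rw [block_A, core, hs]
    simp only [Matrix.mulVec_mulVec, Matrix.mul_assoc, hw]
  have hAp : D.A *ᵥ clusterPart Sigma.fst g y = D.W *ᵥ D.gram⁻¹ *ᵥ s := by
    rw [A_eq, ← Matrix.mulVec_mulVec, W_transpose_mulVec_clusterPart, core, hs]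
    simp only [Matrix.mulVec_mulVec, Matrix.mul_assoc, hw]
  have hB : D.B *ᵥ clusterPart Sigma.fst g y = D.W *ᵥ L *ᵥ s - emb g ((w * L) *ᵥ s) := by
    rw [B, Matrix.sub_mulVec, ← Matrix.mulVec_mulVec, corr_mulVec_clusterPart, hA, hAp,
      annih_mulVec_emb, hwL, hLeq, Matrix.add_mulVec, Matrix.mulVec_add]
    simp only [Matrix.mulVec_mulVec, Matrix.mul_assoc, hw, hN]
    abel
  have hLv : ∀ v, L *ᵥ v ⬝ᵥ s = v ⬝ᵥ L *ᵥ s := fun v => by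
    rw [Matrix.dotProduct_mulVec v L s, ← Matrix.mulVec_transpose, hLs]
  rw [hB, dotProduct_sub, dotProduct_emb, piHatLO, ← hw, ← hL, hLv, sub_dotProduct,
    Matrix.mulVec_transpose, Matrix.mulVec_transpose, ← Matrix.dotProduct_mulVec,
    ← Matrix.dotProduct_mulVec, Matrix.mulVec_mulVec s w]

lemma thetaLO_eq (hr : IsUnit D.gram) (hc : 0 < c)
    (hM : ∀ g, ∀ z, c * (z ⬝ᵥ z) ≤ z ⬝ᵥ block D.annih g g *ᵥ z) (x y : D.Obs → ℝ) :
    D.thetaLO x y = x ⬝ᵥ D.B *ᵥ y := by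
  simp only [thetaLO, ← dotProduct_B_mulVec_clusterPart hr hc hM]
  rw [← dotProduct_sum, ← Matrix.mulVec_sum, sum_clusterPart]

lemma hNorm_smul_H (hr : IsUnit D.gram) (hA : D.A₀ ≠ 0) : D.hNorm • D.H = D.Bᵀ *ᵥ D.sigX := by
  rw [H, smul_smul, mul_inv_cancel₀ (hNorm_pos hr hA).ne', one_smul]

lemma hNorm_smul_Ht (hr : IsUnit D.gram) (hA : D.A₀ ≠ 0) : D.hNorm • D.Ht = D.B *ᵥ D.sigY := by
  rw [Ht, smul_smul, mul_inv_cancel₀ (hNorm_pos hr hA).ne', one_smul]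

lemma thetaLO_sub_theta (hr : IsUnit D.gram) (hA : D.A₀ ≠ 0) (hc : 0 < c)
    (hM : ∀ g, ∀ z, c * (z ⬝ᵥ z) ≤ z ⬝ᵥ block D.annih g g *ᵥ z) (e f : D.Obs → ℝ) :
    D.thetaLO (D.W *ᵥ D.coefX + f) (D.W *ᵥ D.coefY + e) - D.theta
      = f ⬝ᵥ D.B *ᵥ e + (e ⬝ᵥ D.hNorm • D.H + f ⬝ᵥ D.hNorm • D.Ht) := by
  rw [thetaLO_eq hr hc hM, ← sigX, ← sigY, Matrix.mulVec_add, dotProduct_add, add_dotProduct,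
    add_dotProduct, sigX_dotProduct_B_mulVec_sigY hr, hNorm_smul_H hr hA, hNorm_smul_Ht hr hA,
    Matrix.dotProduct_mulVec D.sigX, ← Matrix.mulVec_transpose, dotProduct_comm (D.Bᵀ *ᵥ D.sigX)]
  ring

/-! ### Block diagonal algebra and stacking of the two error vectors. -/

section BlockDiagonal

lemma blockDiagonal'_block {Q : Matrix D.Obs D.Obs ℝ} (hQ : ∀ i j, i.1 ≠ j.1 → Q i j = 0) :
    Matrix.blockDiagonal' (fun g => block Q g g) = Q := by
  ext ⟨g, i⟩ ⟨k, j⟩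
  by_cases h : g = k
  · subst h
    rw [Matrix.blockDiagonal'_apply_eq]
    rfl
  · rw [Matrix.blockDiagonal'_apply_ne _ _ _ h, hQ _ _ h]

lemma dotProduct_mulVec_eq_sum_seg {Q : Matrix D.Obs D.Obs ℝ} (hQ : ∀ i j, i.1 ≠ j.1 → Q i j = 0)
    (x y : D.Obs → ℝ) : x ⬝ᵥ Q *ᵥ y = ∑ g, seg x g ⬝ᵥ block Q g g *ᵥ seg y g := by
  rw [dotProduct_eq_sum_seg]
  refine Finset.sum_congr rfl fun g _ => ?_
  conv_lhs => rw [← blockDiagonal'_block hQ, seg_blockDiagonal'_mulVec]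

lemma block_mul (Q R : Matrix D.Obs D.Obs ℝ) (g k : Fin D.G) :
    block (Q * R) g k = ∑ l, block Q g l * block R l k := by
  ext i j
  rw [Matrix.sum_apply]
  simp only [block, Matrix.submatrix_apply, Matrix.mul_apply, Fintype.sum_sigma]

lemma trace_eq_sum_block (Q : Matrix D.Obs D.Obs ℝ) : Q.trace = ∑ g, (block Q g g).trace := by
  rw [Matrix.trace, Fintype.sum_sigma]
  rfl

lemma block_mul_of_blockDiagonal (R : Matrix D.Obs D.Obs ℝ) {Q : Matrix D.Obs D.Obs ℝ}
    (hQ : ∀ i j, i.1 ≠ j.1 → Q i j = 0) (g k : Fin D.G) :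
    block (R * Q) g k = block R g k * block Q k k := by
  rw [block_mul, Finset.sum_eq_single k]
  · intro l _ hl
    rw [show block Q l k = 0 from by ext i j; exact hQ _ _ hl, Matrix.mul_zero]
  · simp

lemma trace_mul_mul_mul {Q R : Matrix D.Obs D.Obs ℝ} (hQ : ∀ i j, i.1 ≠ j.1 → Q i j = 0)
    (hR : ∀ i j, i.1 ≠ j.1 → R i j = 0) (B E : Matrix D.Obs D.Obs ℝ) :
    (Q * B * R * E).trace
      = ∑ g, ∑ k, (block Q g g * block B g k * block R k k * block E k g).trace := by
  rw [Matrix.mul_assoc Q, Matrix.mul_assoc Q, Matrix.trace_mul_comm, trace_eq_sum_block]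
  refine Finset.sum_congr rfl fun g _ => ?_
  rw [block_mul_of_blockDiagonal _ hQ, block_mul, Finset.sum_mul, Matrix.trace_sum]
  refine Finset.sum_congr rfl fun k _ => ?_
  rw [block_mul_of_blockDiagonal _ hR, Matrix.trace_mul_comm]
  simp only [Matrix.mul_assoc]

end BlockDiagonal

/-- The cluster of a coordinate of the stacked vector `(U, V)`. -/
def stackCluster (D : ClusterDesign) : D.Obs ⊕ D.Obs → Fin D.G := Sum.elim Sigma.fst Sigma.fst

/-- The matrix of the quadratic form `(U, V) ↦ 2 V'QU`. -/
def stackMatrix (Q : Matrix D.Obs D.Obs ℝ) : Matrix (D.Obs ⊕ D.Obs) (D.Obs ⊕ D.Obs) ℝ :=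
  Matrix.fromBlocks 0 Qᵀ Q 0

lemma clusterPart_stack (g : Fin D.G) (x y : D.Obs → ℝ) :
    clusterPart D.stackCluster g (Sum.elim x y)
      = Sum.elim (clusterPart Sigma.fst g x) (clusterPart Sigma.fst g y) := by
  ext (i | i) <;> rfl

lemma stackMatrix_mulVec (Q : Matrix D.Obs D.Obs ℝ) (x y : D.Obs → ℝ) :
    stackMatrix Q *ᵥ Sum.elim x y = Sum.elim (Qᵀ *ᵥ y) (Q *ᵥ x) := by
  rw [stackMatrix, Matrix.fromBlocks_mulVec]
  simp

lemma stackMatrix_isSymm (Q : Matrix D.Obs D.Obs ℝ) : (stackMatrix Q).IsSymm := by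
  rw [Matrix.IsSymm, stackMatrix, Matrix.fromBlocks_transpose, Matrix.transpose_transpose,
    Matrix.transpose_zero]

lemma isHollow_stackMatrix {Q : Matrix D.Obs D.Obs ℝ} (hQ : IsHollow Sigma.fst Q) :
    IsHollow D.stackCluster (stackMatrix Q) := by
  rintro (i | i) (j | j) h
  · rfl
  · exact hQ j i h.symm
  · exact hQ i j h
  · rfl

lemma linQuad_stack (Q : Matrix D.Obs D.Obs ℝ) (p r x y : D.Obs → ℝ) :
    linQuad (Sum.elim p r) (stackMatrix Q) (Sum.elim x y)
      = y ⬝ᵥ Q *ᵥ x + (x ⬝ᵥ p + y ⬝ᵥ r) := by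
  rw [linQuad, stackMatrix_mulVec, dotProduct_add, sumElim_dotProduct_sumElim, dotProduct_smul,
    sumElim_dotProduct_sumElim, Matrix.mulVec_transpose, dotProduct_comm x,
    dotProduct_comm x, ← Matrix.dotProduct_mulVec, dotProduct_comm p, smul_eq_mul]
  ring

lemma frobSq_stackMatrix (Q : Matrix D.Obs D.Obs ℝ) :
    frobSq (stackMatrix Q) = 2 * (Qᵀ * Q).trace := by
  have h : (Qᵀ * Q).trace = ∑ i, ∑ j, Q i j * Q i j := by
    rw [Matrix.trace_mul_comm]
    simp [Matrix.trace, Matrix.mul_apply]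
  rw [h]
  simp only [frobSq, Matrix.row, dotProduct, Fintype.sum_sum_type, stackMatrix,
    Matrix.fromBlocks_apply₁₁, Matrix.fromBlocks_apply₁₂, Matrix.fromBlocks_apply₂₁,
    Matrix.fromBlocks_apply₂₂, Matrix.zero_apply, Matrix.transpose_apply, mul_zero,
    Finset.sum_const_zero, zero_add, add_zero]
  rw [Finset.sum_comm]
  ring

lemma trace_fromBlocks' (Q R S T : Matrix D.Obs D.Obs ℝ) :
    (Matrix.fromBlocks Q R S T).trace = Q.trace + T.trace := by
  simp [Matrix.trace, Fintype.sum_sum_type]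

lemma exists_eq_sumElim (z : D.Obs ⊕ D.Obs → ℝ) : ∃ x y, z = Sum.elim x y :=
  ⟨z ∘ Sum.inl, z ∘ Sum.inr, (Sum.elim_comp_inl_inr z).symm⟩

section Bounds

variable {Q : Matrix D.Obs D.Obs ℝ} {a : ℝ}

lemma stackMatrix_mulVec_sq_le (h : BlockBound D Q a) (h' : BlockBound D Qᵀ a)
    (z : D.Obs ⊕ D.Obs → ℝ) :
    stackMatrix Q *ᵥ z ⬝ᵥ stackMatrix Q *ᵥ z ≤ a * (z ⬝ᵥ z) := by
  obtain ⟨x, y, rfl⟩ := exists_eq_sumElim z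
  rw [stackMatrix_mulVec, sumElim_dotProduct_sumElim, sumElim_dotProduct_sumElim]
  linarith [h.mulVec_le x, h'.mulVec_le y]

lemma stackMatrix_mulVec_clusterPart_sq_le (h : BlockBound D Q a) (h' : BlockBound D Qᵀ a)
    (g : Fin D.G) (z : D.Obs ⊕ D.Obs → ℝ) :
    stackMatrix Q *ᵥ clusterPart D.stackCluster g z ⬝ᵥ
        stackMatrix Q *ᵥ clusterPart D.stackCluster g z
      ≤ a * D.lam * (clusterPart D.stackCluster g z ⬝ᵥ clusterPart D.stackCluster g z) := by
  obtain ⟨x, y, rfl⟩ := exists_eq_sumElim z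
  rw [clusterPart_stack, stackMatrix_mulVec, sumElim_dotProduct_sumElim,
    sumElim_dotProduct_sumElim]
  linarith [h.mulVec_clusterPart_le g x, h'.mulVec_clusterPart_le g y]

lemma clusterPart_stackMatrix_mulVec_clusterPart_sq_le (h : BlockBound D Q a)
    (h' : BlockBound D Qᵀ a) (g k : Fin D.G) (z : D.Obs ⊕ D.Obs → ℝ) :
    clusterPart D.stackCluster k (stackMatrix Q *ᵥ clusterPart D.stackCluster g z) ⬝ᵥ
        clusterPart D.stackCluster k (stackMatrix Q *ᵥ clusterPart D.stackCluster g z)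
      ≤ a * D.lam ^ 2 * (clusterPart D.stackCluster g z ⬝ᵥ clusterPart D.stackCluster g z) := by
  obtain ⟨x, y, rfl⟩ := exists_eq_sumElim z
  rw [clusterPart_stack, stackMatrix_mulVec, clusterPart_stack, sumElim_dotProduct_sumElim,
    sumElim_dotProduct_sumElim]
  linarith [h.clusterPart_mulVec_clusterPart_le g k x, h'.clusterPart_mulVec_clusterPart_le g k y]

end Bounds

/-! ### The stacked errors as cluster noise, and `ω²` as the mean Stein kernel. -/

section Noise

variable {Ω : Type*} [MeasurableSpace Ω] {P : Measure Ω} {U V : Ω → D.Obs → ℝ}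

lemma crossMoment_transpose (P : Measure Ω) (S T : Ω → D.Obs → ℝ) :
    (crossMoment P S T)ᵀ = crossMoment P T S := by
  ext i j
  simp [crossMoment, mul_comm]

lemma crossMoment_stack (P : Measure Ω) (U V : Ω → D.Obs → ℝ) :
    crossMoment P (fun ω => Sum.elim (U ω) (V ω)) (fun ω => Sum.elim (U ω) (V ω))
      = Matrix.fromBlocks (crossMoment P U U) (crossMoment P U V) (crossMoment P V U)
        (crossMoment P V V) := by
  ext (i | i) (j | j) <;> rfl

lemma clusterPart_eq_emb (g : Fin D.G) (x : D.Obs → ℝ) :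
    clusterPart Sigma.fst g x = emb g (seg x g) := by
  refine ext_seg fun k => ?_
  by_cases h : k = g
  · subst h
    rw [seg_clusterPart_self, seg_emb_self]
  · rw [seg_clusterPart_of_ne h, seg_emb_of_ne h]

lemma measurable_emb (g : Fin D.G) : Measurable (emb (D := D) g) := by
  refine measurable_pi_lambda _ fun j => ?_
  simp only [emb]
  split_ifs with h
  · exact measurable_pi_apply _
  · exact measurable_const

lemma clusterNoise_stack [IsProbabilityMeasure P] (hU : Measurable U) (hV : Measurable V)
    (hU4 : ∀ j, MemLp (fun ω => U ω j) 4 P) (hV4 : ∀ j, MemLp (fun ω => V ω j) 4 P)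
    (hU0 : ∀ j, ∫ ω, U ω j ∂P = 0) (hV0 : ∀ j, ∫ ω, V ω j ∂P = 0)
    (hi : iIndepFun (fun (g : Fin D.G) ω => (seg (U ω) g, seg (V ω) g)) P) :
    ClusterNoise P D.stackCluster fun ω => Sum.elim (U ω) (V ω) where
  measurable := by
    refine measurable_pi_lambda _ ?_
    rintro (j | j)
    · exact (measurable_pi_apply j).comp hU
    · exact (measurable_pi_apply j).comp hV
  memLp := by
    rintro (j | j)
    · exact hU4 j
    · exact hV4 j
  mean := by
    rintro (j | j)
    · exact hU0 j
    · exact hV0 j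
  indep := by
    have h := hi.comp (fun g p => (Sum.elim (emb g p.1) (emb g p.2) : D.Obs ⊕ D.Obs → ℝ))
      fun g => by
        refine measurable_pi_lambda _ ?_
        rintro (j | j)
        · exact (measurable_pi_apply j).comp ((measurable_emb g).comp measurable_fst)
        · exact (measurable_pi_apply j).comp ((measurable_emb g).comp measurable_snd)
    convert h using 2 with g
    funext ω
    rw [clusterPart_stack, clusterPart_eq_emb, clusterPart_eq_emb]
    rfl

lemma crossMoment_blocks_eq_zero [IsProbabilityMeasure P]
    (h : ClusterNoise P D.stackCluster fun ω => Sum.elim (U ω) (V ω)) :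
    (∀ i j : D.Obs, i.1 ≠ j.1 → crossMoment P U U i j = 0) ∧
    (∀ i j : D.Obs, i.1 ≠ j.1 → crossMoment P U V i j = 0) ∧
    (∀ i j : D.Obs, i.1 ≠ j.1 → crossMoment P V U i j = 0) ∧
    (∀ i j : D.Obs, i.1 ≠ j.1 → crossMoment P V V i j = 0) :=
  ⟨fun i j hij => h.crossMoment_eq_zero (j := Sum.inl i) (k := Sum.inl j) hij,
    fun i j hij => h.crossMoment_eq_zero (j := Sum.inl i) (k := Sum.inr j) hij,
    fun i j hij => h.crossMoment_eq_zero (j := Sum.inr i) (k := Sum.inl j) hij,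
    fun i j hij => h.crossMoment_eq_zero (j := Sum.inr i) (k := Sum.inr j) hij⟩

lemma covFull_isSymm (g : Fin D.G) : (covFull P U V g).IsSymm := by
  have h : ∀ T : Ω → D.Obs → ℝ, (covBlock P T T g)ᵀ = covBlock P T T g := fun T => by
    ext i j
    simp [covBlock, crossMoment, mul_comm]
  rw [Matrix.IsSymm, covFull, Matrix.fromBlocks_transpose, Matrix.transpose_transpose, h, h]

lemma dotProduct_crossMoment_stack [IsProbabilityMeasure P]
    (h : ClusterNoise P D.stackCluster fun ω => Sum.elim (U ω) (V ω)) (x y : D.Obs → ℝ) :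
    Sum.elim x y ⬝ᵥ crossMoment P (fun ω => Sum.elim (U ω) (V ω)) (fun ω => Sum.elim (U ω) (V ω))
        *ᵥ Sum.elim x y
      = ∑ g, Sum.elim (seg x g) (seg y g) ⬝ᵥ covFull P U V g *ᵥ Sum.elim (seg x g) (seg y g) := by
  obtain ⟨h1, h2, h3, h4⟩ := crossMoment_blocks_eq_zero h
  have h5 : ∀ g, (covBlock P U V g)ᵀ = covBlock P V U g := fun g => by
    ext i j
    simp [covBlock, crossMoment, mul_comm]
  simp only [crossMoment_stack, Matrix.fromBlocks_mulVec, sumElim_dotProduct_sumElim, covFull,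
    dotProduct_add, Sum.elim_comp_inl, Sum.elim_comp_inr, dotProduct_mulVec_eq_sum_seg h1,
    dotProduct_mulVec_eq_sum_seg h2, dotProduct_mulVec_eq_sum_seg h3,
    dotProduct_mulVec_eq_sum_seg h4, Finset.sum_add_distrib, h5]
  rfl

/-- Up to reordering coordinates, the covariance of the stacked vector is block diagonal with blocks
`Ω_g`, so eigenvalue bounds on the blocks pass to the whole form. -/
lemma crossMoment_stack_bounds [IsProbabilityMeasure P]
    (h : ClusterNoise P D.stackCluster fun ω => Sum.elim (U ω) (V ω)) {c u : ℝ}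
    (hc : ∀ g, ∀ x ∈ spectrum ℝ (covFull P U V g), c ≤ x ∧ x ≤ u) (z : D.Obs ⊕ D.Obs → ℝ) :
    c * (z ⬝ᵥ z) ≤ z ⬝ᵥ crossMoment P (fun ω => Sum.elim (U ω) (V ω))
        (fun ω => Sum.elim (U ω) (V ω)) *ᵥ z ∧
      z ⬝ᵥ crossMoment P (fun ω => Sum.elim (U ω) (V ω))
        (fun ω => Sum.elim (U ω) (V ω)) *ᵥ z ≤ u * (z ⬝ᵥ z) := by
  obtain ⟨x, y, rfl⟩ := exists_eq_sumElim z
  rw [dotProduct_crossMoment_stack h, sumElim_dotProduct_sumElim, dotProduct_eq_sum_seg x,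
    dotProduct_eq_sum_seg y, ← Finset.sum_add_distrib, Finset.mul_sum, Finset.mul_sum]
  simp only [← sumElim_dotProduct_sumElim]
  exact ⟨Finset.sum_le_sum fun g _ =>
      le_quadForm_of_le_spectrum (covFull_isSymm g) (fun x hx => (hc g x hx).1) _,
    Finset.sum_le_sum fun g _ =>
      quadForm_le_of_spectrum_le (covFull_isSymm g) (fun x hx => (hc g x hx).2) _⟩

/-- Multiplying out `KSKS` in 2×2 blocks yields four traces that agree in pairs by transposition and
cyclicity; the resulting 2 cancels the `½` in front of the trace. -/
lemma omegaSq_eq [IsProbabilityMeasure P]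
    (h : ClusterNoise P D.stackCluster fun ω => Sum.elim (U ω) (V ω)) :
    omegaSq P U V = ∫ ω, ClusterNoise.steinVar P (fun ω => Sum.elim (U ω) (V ω))
      (Sum.elim (D.hNorm • D.H) (D.hNorm • D.Ht)) (stackMatrix D.B) ω ∂P := by
  obtain ⟨h1, h2, h3, h4⟩ := crossMoment_blocks_eq_zero h
  rw [ClusterNoise.integral_steinVar h (stackMatrix_isSymm _)]
  have hT := crossMoment_transpose P U V
  have e1 : D.H ⬝ᵥ crossMoment P U V *ᵥ D.Ht = D.Ht ⬝ᵥ crossMoment P V U *ᵥ D.H := by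
    rw [← hT, Matrix.mulVec_transpose, dotProduct_comm D.Ht, ← Matrix.dotProduct_mulVec]
  have e2 : (stackMatrix D.B * crossMoment P (fun ω => Sum.elim (U ω) (V ω))
        (fun ω => Sum.elim (U ω) (V ω)) * stackMatrix D.B
        * crossMoment P (fun ω => Sum.elim (U ω) (V ω)) (fun ω => Sum.elim (U ω) (V ω))).trace
      = 2 * (crossMoment P V V * D.B * crossMoment P U U * D.Bᵀ).trace
        + 2 * (crossMoment P U V * D.B * crossMoment P U V * D.B).trace := by
    have t1 : (D.Bᵀ * crossMoment P V U * D.Bᵀ * crossMoment P V U).trace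
        = (crossMoment P U V * D.B * crossMoment P U V * D.B).trace := by
      rw [← Matrix.trace_transpose]
      simp only [Matrix.transpose_mul, Matrix.transpose_transpose, ← hT, Matrix.mul_assoc]
    have t2 : (D.Bᵀ * crossMoment P V V * D.B * crossMoment P U U).trace
        = (crossMoment P V V * D.B * crossMoment P U U * D.Bᵀ).trace := by
      rw [Matrix.mul_assoc, Matrix.mul_assoc, Matrix.trace_mul_comm]
      simp only [Matrix.mul_assoc]
    have t3 : (D.B * crossMoment P U U * D.Bᵀ * crossMoment P V V).trace
        = (crossMoment P V V * D.B * crossMoment P U U * D.Bᵀ).trace := by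
      rw [Matrix.trace_mul_comm]
      simp only [Matrix.mul_assoc]
    have t4 : (D.B * crossMoment P U V * D.B * crossMoment P U V).trace
        = (crossMoment P U V * D.B * crossMoment P U V * D.B).trace := by
      rw [Matrix.trace_mul_comm]
      simp only [Matrix.mul_assoc]
    rw [crossMoment_stack, stackMatrix, Matrix.fromBlocks_multiply, Matrix.mul_assoc (Matrix.fromBlocks _ _ _ _),
      Matrix.fromBlocks_multiply, Matrix.fromBlocks_multiply,
      trace_fromBlocks']
    simp only [Matrix.zero_mul, zero_add, add_zero, Matrix.trace_add, ← Matrix.mul_assoc, t1, t2,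
      t3, t4]
    ring
  rw [e2, crossMoment_stack, Matrix.fromBlocks_mulVec, sumElim_dotProduct_sumElim]
  simp only [Sum.elim_comp_inl, Sum.elim_comp_inr, Matrix.mulVec_smul, smul_dotProduct,
    dotProduct_smul, dotProduct_add, smul_eq_mul, ← e1]
  rw [trace_mul_mul_mul h4 h1, trace_mul_mul_mul h2 h2, dotProduct_mulVec_eq_sum_seg h1,
    dotProduct_mulVec_eq_sum_seg h2, dotProduct_mulVec_eq_sum_seg h4, omegaSq]
  have e3 : ∀ g k, block D.Bᵀ g k = (block D.B k g)ᵀ := fun _ _ => rfl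
  have e4 : ∀ (S T : Ω → D.Obs → ℝ) g, block (crossMoment P S T) g g = covBlock P S T g :=
    fun _ _ _ => rfl
  simp only [e3, e4]
  ring

end Noise

end ClusterDesign

/-! ### Comparison of the error bounds with the rate condition. -/

namespace ClusterDesign

/-- The factor by which the operator norm bounds of `B` exceed those of `A`. -/
noncomputable def opConst (c : ℝ) : ℝ := 2 * (1 + (c ^ 2)⁻¹)

/-- The constant in the bound of the fourth moments within a cluster. -/
noncomputable def momentConst (q C : ℝ) : ℝ := 2 ^ (q / (q - 1)) * max C 1 ^ (1 / (q - 1))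

lemma momentConst_pos (q C : ℝ) : 0 < momentConst q C := by
  have : 0 < max C 1 := lt_max_of_lt_right one_pos
  unfold momentConst
  positivity

/-- The constant with which the rate condition enters the normal approximation. -/
noncomputable def rateConst (c q C : ℝ) : ℝ :=
  opConst c * (13 + 2 * momentConst q C) + 16 * momentConst q C
    + 48 * momentConst q C * opConst c + 16 * momentConst q C ^ 2 * opConst c

variable {D : ClusterDesign}

lemma maxSegSq_nonneg (v : D.Obs → ℝ) : 0 ≤ maxSegSq v :=
  Real.iSup_nonneg fun _ => dotProduct_self_nonneg' _

lemma le_maxSegSq (v : D.Obs → ℝ) (g : Fin D.G) : seg v g ⬝ᵥ seg v g ≤ maxSegSq v :=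
  le_ciSup (f := fun g => seg v g ⬝ᵥ seg v g) (Set.finite_range _).bddAbove g

lemma sum_seg_sq_le (v : D.Obs → ℝ) :
    ∑ g, (seg v g ⬝ᵥ seg v g) ^ 2 ≤ maxSegSq v * (v ⬝ᵥ v) := by
  rw [dotProduct_eq_sum_seg v v, Finset.mul_sum]
  refine Finset.sum_le_sum fun g _ => ?_
  rw [sq]
  exact mul_le_mul_of_nonneg_right (le_maxSegSq v g) (dotProduct_self_nonneg' _)

lemma sum_clusterPart_stack_sq_le (s : ℝ) (x y : D.Obs → ℝ) :
    ∑ g, (clusterPart D.stackCluster g (Sum.elim (s • x) (s • y))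
        ⬝ᵥ clusterPart D.stackCluster g (Sum.elim (s • x) (s • y))) ^ 2
      ≤ 2 * s ^ 4 * (maxSegSq x * (x ⬝ᵥ x) + maxSegSq y * (y ⬝ᵥ y)) := by
  have h : ∀ g, (clusterPart D.stackCluster g (Sum.elim (s • x) (s • y))
        ⬝ᵥ clusterPart D.stackCluster g (Sum.elim (s • x) (s • y))) ^ 2
      ≤ 2 * s ^ 4 * ((seg x g ⬝ᵥ seg x g) ^ 2 + (seg y g ⬝ᵥ seg y g) ^ 2) := fun g => by
    have e : ∀ v : D.Obs → ℝ, clusterPart Sigma.fst g (s • v) ⬝ᵥ clusterPart Sigma.fst g (s • v)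
        = s ^ 2 * (seg v g ⬝ᵥ seg v g) := fun v => by
      rw [clusterPart_smul, smul_dotProduct, dotProduct_smul, clusterPart_dotProduct_eq_seg,
        seg_clusterPart_self, smul_eq_mul, smul_eq_mul]
      ring
    rw [clusterPart_stack, sumElim_dotProduct_sumElim, e, e]
    nlinarith [mul_nonneg (sq_nonneg (s ^ 2)) (sq_nonneg (seg x g ⬝ᵥ seg x g - seg y g ⬝ᵥ seg y g))]
  refine (Finset.sum_le_sum fun g _ => h g).trans ?_
  rw [← Finset.mul_sum, Finset.sum_add_distrib]
  gcongr
  · exact sum_seg_sq_le x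
  · exact sum_seg_sq_le y

lemma size_le_nMax (g : Fin D.G) : D.size g ≤ D.nMax := Finset.le_sup (Finset.mem_univ g)

lemma card_stackCluster_le (g : Fin D.G) :
    (Finset.univ.filter fun j => D.stackCluster j = g).card ≤ 2 * D.nMax := by
  have : (Finset.univ.filter fun j => D.stackCluster j = g).card = 2 * D.size g := by
    have e : ∑ j : D.Obs, (if j.1 = g then 1 else 0) = D.size g := by
      rw [Fintype.sum_sigma, Finset.sum_eq_single g]
      · simp
      · intro k _ hk
        simp [hk]
      · simp
    rw [Finset.card_filter, Fintype.sum_sum_type, two_mul]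
    exact congrArg₂ (· + ·) e e
  rw [this]
  exact Nat.mul_le_mul_left 2 (size_le_nMax g)

lemma kappa_mul (hr : IsUnit D.gram) (hA : D.A₀ ≠ 0) :
    (D.Bᵀ * D.B).trace = D.hNorm ^ 2 * D.kappa := by
  rw [kappa, mul_div_cancel₀ _ (pow_pos (hNorm_pos hr hA) 2).ne']

lemma trace_transpose_mul_self_nonneg (Q : Matrix D.Obs D.Obs ℝ) : 0 ≤ (Qᵀ * Q).trace := by
  have := frobSq_nonneg (stackMatrix Q)
  rw [frobSq_stackMatrix] at this
  linarith

lemma kappa_nonneg : 0 ≤ D.kappa :=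
  div_nonneg (trace_transpose_mul_self_nonneg _) (sq_nonneg _)

/-- This keeps `ω²` positive even when the signals `H` and `H̃` vanish. -/
lemma kappa_pos (hr : IsUnit D.gram) (hA : D.A₀ ≠ 0) : 0 < D.kappa := by
  refine div_pos (lt_of_le_of_ne (trace_transpose_mul_self_nonneg _) fun h => ?_)
    (pow_pos (hNorm_pos hr hA) 2)
  exact B_ne_zero hr hA (Matrix.trace_conjTranspose_mul_self_eq_zero_iff.1 <| by
    rw [Matrix.conjTranspose_eq_transpose_of_trivial, ← h])

lemma one_le_eta : 1 ≤ D.eta := le_max_left _ _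

section Rate

variable {q u : ℝ}

/-- The bound of the moments `E (y'U_g)² |U_g|²` without its constant. -/
noncomputable def momentRate (D : ClusterDesign) (q u : ℝ) : ℝ :=
  u ^ ((q - 2) / (q - 1)) * (D.nMax : ℝ) ^ (q / (q - 1))

lemma momentRate_nonneg (hu : 0 < u) : 0 ≤ D.momentRate q u := by
  unfold momentRate
  positivity

/-- The fractional exponents are all powers of one quantity, the moment rate, because `(3q-4)/(q-1)
= 2 + (q-2)/(q-1)` and the fourth term is its square. -/
lemma rateLHS_eq (hq : 2 ≤ q) (hu : 0 < u) : D.rateLHS q u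
    = u ^ 3 * D.eta * (D.muSq + D.mutSq) + u ^ 2 * D.momentRate q u * D.lam * D.kappa
      + u ^ 4 * D.eta * D.kappa + D.momentRate q u ^ 2 * D.lam ^ 2 * D.kappa
      + D.momentRate q u * (D.zetaH * D.muSq + D.zetaHt * D.mutSq + D.kappa) := by
  have hq1 : q - 1 ≠ 0 := by linarith
  have e1 : u ^ ((3 * q - 4) / (q - 1)) = u ^ 2 * u ^ ((q - 2) / (q - 1)) := by
    rw [← Real.rpow_natCast, ← Real.rpow_add hu]
    congr 1
    push_cast
    field_simp
    ring
  have e2 : u ^ (2 * (q - 2) / (q - 1)) = (u ^ ((q - 2) / (q - 1))) ^ 2 := by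
    rw [← Real.rpow_mul_natCast hu.le]
    congr 1
    push_cast
    ring
  have e3 : (D.nMax : ℝ) ^ (2 * q / (q - 1)) = ((D.nMax : ℝ) ^ (q / (q - 1))) ^ 2 := by
    rw [← Real.rpow_mul_natCast (Nat.cast_nonneg _)]
    congr 1
    push_cast
    ring
  rw [rateLHS, e1, e2, e3, momentRate]
  ring

lemma opConst_pos {c : ℝ} (hc : 0 < c) : 0 < opConst c := by
  unfold opConst
  positivity

/-- The left sides are the bounds on the kernel variance and on the fourth moments, divided by `h⁴`.
They match the rate condition term by term, with `η` entering through `η ≥ 1`. -/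
lemma approx_terms_le (hq : 2 ≤ q) (hu : 0 < u) {c C : ℝ} (hc : 0 < c) :
    opConst c * (7 * (u ^ 3 * (D.muSq + D.mutSq))
        + 2 * momentConst q C * (u ^ 2 * D.momentRate q u * D.lam * D.kappa)
        + 6 * (u ^ 4 * D.kappa)) ≤ rateConst c q C * D.rateLHS q u ∧
    16 * momentConst q C * (D.momentRate q u * (D.zetaH * D.muSq + D.zetaHt * D.mutSq))
        + 48 * momentConst q C * opConst c * (u ^ 2 * D.momentRate q u * D.lam * D.kappa)
        + 16 * momentConst q C ^ 2 * opConst c * (D.momentRate q u ^ 2 * D.lam ^ 2 * D.kappa)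
      ≤ rateConst c q C * D.rateLHS q u := by
  have hk := momentConst_pos q C
  have ha := opConst_pos hc
  have hm : 0 ≤ D.muSq + D.mutSq :=
    add_nonneg (dotProduct_self_nonneg' _) (dotProduct_self_nonneg' _)
  have hκ := kappa_nonneg (D := D)
  have hr := momentRate_nonneg (D := D) (q := q) hu
  have hl := lam_nonneg (D := D)
  have hz : 0 ≤ D.zetaH * D.muSq + D.zetaHt * D.mutSq :=
    add_nonneg (mul_nonneg (maxSegSq_nonneg _) (dotProduct_self_nonneg' _))
      (mul_nonneg (maxSegSq_nonneg _) (dotProduct_self_nonneg' _))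
  have hη := one_le_eta (D := D)
  have h1 : u ^ 3 * (D.muSq + D.mutSq) ≤ u ^ 3 * D.eta * (D.muSq + D.mutSq) := by
    rw [mul_right_comm]
    exact le_mul_of_one_le_right (by positivity) hη
  have h3 : u ^ 4 * D.kappa ≤ u ^ 4 * D.eta * D.kappa := by
    rw [mul_right_comm]
    exact le_mul_of_one_le_right (by positivity) hη
  have h5 : D.momentRate q u * (D.zetaH * D.muSq + D.zetaHt * D.mutSq)
      ≤ D.momentRate q u * (D.zetaH * D.muSq + D.zetaHt * D.mutSq + D.kappa) := by
    refine mul_le_mul_of_nonneg_left ?_ hr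
    linarith
  rw [rateLHS_eq hq hu]
  set k := momentConst q C
  set a := opConst c
  set t1 := u ^ 3 * (D.muSq + D.mutSq)
  set t2 := u ^ 2 * D.momentRate q u * D.lam * D.kappa
  set t3 := u ^ 4 * D.kappa
  set t4 := D.momentRate q u ^ 2 * D.lam ^ 2 * D.kappa
  set t5 := D.momentRate q u * (D.zetaH * D.muSq + D.zetaHt * D.mutSq)
  have p1 : 0 ≤ t1 := by positivity
  have p2 : 0 ≤ t2 := by positivity
  have p3 : 0 ≤ t3 := by positivity
  have p4 : 0 ≤ t4 := by positivity
  have p5 : 0 ≤ t5 := by positivity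
  have hle : rateConst c q C * (t1 + t2 + t3 + t4 + t5) ≤ rateConst c q C *
      (u ^ 3 * D.eta * (D.muSq + D.mutSq) + t2 + u ^ 4 * D.eta * D.kappa + t4
        + D.momentRate q u * (D.zetaH * D.muSq + D.zetaHt * D.mutSq + D.kappa)) := by
    refine mul_le_mul_of_nonneg_left (by linarith) ?_
    simp only [rateConst]
    positivity
  have hak : 0 ≤ a * k := by positivity
  have hkk : 0 ≤ k ^ 2 * a := by positivity
  constructor
  · refine le_trans ?_ hle
    have : rateConst c q C * (t1 + t2 + t3 + t4 + t5)
        - a * (7 * t1 + 2 * k * t2 + 6 * t3)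
        = a * (6 * t1 + 13 * t2 + 7 * t3 + 13 * (t4 + t5)) + 2 * (a * k) * (t1 + t3 + t4 + t5)
          + (16 * k + 48 * (a * k) + 16 * (k ^ 2 * a)) * (t1 + t2 + t3 + t4 + t5) := by
      simp only [rateConst]
      ring
    have : 0 ≤ a * (6 * t1 + 13 * t2 + 7 * t3 + 13 * (t4 + t5))
        + 2 * (a * k) * (t1 + t3 + t4 + t5)
          + (16 * k + 48 * (a * k) + 16 * (k ^ 2 * a)) * (t1 + t2 + t3 + t4 + t5) := by positivity
    linarith
  · refine le_trans ?_ hle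
    have : rateConst c q C * (t1 + t2 + t3 + t4 + t5)
        - (16 * k * t5 + 48 * k * a * t2 + 16 * k ^ 2 * a * t4)
        = (13 * a + 2 * (a * k)) * (t1 + t2 + t3 + t4 + t5) + 16 * k * (t1 + t2 + t3 + t4)
          + 48 * (a * k) * (t1 + t3 + t4 + t5) + 16 * (k ^ 2 * a) * (t1 + t2 + t3 + t5) := by
      simp only [rateConst]
      ring
    have : 0 ≤ (13 * a + 2 * (a * k)) * (t1 + t2 + t3 + t4 + t5) + 16 * k * (t1 + t2 + t3 + t4)
          + 48 * (a * k) * (t1 + t3 + t4 + t5) + 16 * (k ^ 2 * a) * (t1 + t2 + t3 + t5) := by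
      positivity
    linarith

end Rate

end ClusterDesign

/-! ### Normal approximation in one design and passage to the limit. -/

namespace ClusterDesign

lemma memLp_four_of_integrable_rpow {Ω : Type*} [MeasurableSpace Ω] {P : Measure Ω}
    [IsFiniteMeasure P] {f : Ω → ℝ} (hf : Measurable f) {q : ℝ} (hq : 2 ≤ q)
    (hi : Integrable (fun ω => |f ω| ^ (2 * q)) P) : MemLp f 4 P := by
  refine memLp_four_iff.2 ⟨hf.aestronglyMeasurable, ?_⟩
  refine ((integrable_const (1 : ℝ)).add hi).mono' (by fun_prop) (ae_of_all _ fun ω => ?_)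
  have h0 : 0 ≤ |f ω| ^ (2 * q) := by positivity
  rw [Real.norm_eq_abs, abs_pow]
  change |f ω| ^ 4 ≤ 1 + |f ω| ^ (2 * q)
  rcases le_total |f ω| 1 with h | h
  · have := pow_le_one₀ (n := 4) (abs_nonneg (f ω)) h
    linarith
  · have : |f ω| ^ (4 : ℝ) ≤ |f ω| ^ (2 * q) := Real.rpow_le_rpow_of_exponent_le h (by linarith)
    rw [← Real.rpow_natCast]
    push_cast
    linarith

variable {D : ClusterDesign} {Ω : Type*} [MeasurableSpace Ω] {P : Measure Ω} [IsProbabilityMeasure P]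
  {U V : Ω → D.Obs → ℝ}

/-- Evaluate the two-sided bound on the covariance form at the all-ones vector, which is nonzero
because some unit exists. -/
lemma pos_of_crossMoment_stack_bounds (hG : 0 < D.G) (hsize : ∀ g, 0 < D.size g)
    (h : ClusterNoise P D.stackCluster fun ω => Sum.elim (U ω) (V ω)) {c u : ℝ} (hc0 : 0 < c)
    (hc : ∀ g, ∀ x ∈ spectrum ℝ (covFull P U V g), c ≤ x ∧ x ≤ u) : 0 < u := by
  obtain ⟨h1, h2⟩ := crossMoment_stack_bounds h hc 1
  have h3 : (0 : ℝ) < (1 : D.Obs ⊕ D.Obs → ℝ) ⬝ᵥ 1 := by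
    have : Nonempty (D.Obs ⊕ D.Obs) := ⟨Sum.inl ⟨⟨0, hG⟩, ⟨0, hsize _⟩⟩⟩
    simp only [dotProduct, Pi.one_apply, mul_one, Finset.sum_const, nsmul_eq_mul]
    exact_mod_cast Finset.card_pos.2 Finset.univ_nonempty
  nlinarith

/-- Normal approximation of the leave-one-cluster-out estimator in one design. -/
theorem norm_integral_exp_thetaLO_le (hG : 0 < D.G) (hsize : ∀ g, 0 < D.size g)
    (hr : IsUnit D.gram) (hA : D.A₀ ≠ 0) (hU : Measurable U) (hV : Measurable V)
    (hU0 : ∀ j, ∫ ω, U ω j ∂P = 0) (hV0 : ∀ j, ∫ ω, V ω j ∂P = 0)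
    (hindep : iIndepFun (fun (g : Fin D.G) ω => (seg (U ω) g, seg (V ω) g)) P)
    {cM : ℝ} (hcM : 0 < cM) (hleave : ∀ g, ∀ x ∈ spectrum ℝ (block D.annih g g), cM ≤ x)
    {q C : ℝ} (hq : 2 ≤ q) (hUi : ∀ j, Integrable (fun ω => |U ω j| ^ (2 * q)) P)
    (hVi : ∀ j, Integrable (fun ω => |V ω j| ^ (2 * q)) P)
    (hmom : ∀ j, (∫ ω, |U ω j| ^ (2 * q) ∂P) + (∫ ω, |V ω j| ^ (2 * q) ∂P) ≤ C)
    {c u : ℝ} (hc0 : 0 < c) (hcov : ∀ g, ∀ x ∈ spectrum ℝ (covFull P U V g), c ≤ x ∧ x ≤ u)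
    {δ : ℝ} (hδ : 0 < δ)
    (hrate : rateConst cM q C * D.rateLHS q u
      ≤ δ ^ 2 * (min c (c ^ 2) * (D.muSq + D.mutSq + D.kappa)) ^ 2) (t : ℝ) :
    ‖∫ ω, Complex.exp ((t * ((D.thetaLO (D.W *ᵥ D.coefX + V ω) (D.W *ᵥ D.coefY + U ω) - D.theta)
        / √(omegaSq P U V)) : ℝ) * Complex.I) ∂P - Real.exp (-t ^ 2 / 2)‖
      ≤ Real.exp (t ^ 2 / 2) * ((|t| + 3 * t ^ 2) * δ) * |t| := by
  have hM : ∀ g, ∀ z, cM * (z ⬝ᵥ z) ≤ z ⬝ᵥ block D.annih g g *ᵥ z := fun g z =>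
    le_quadForm_of_le_spectrum (block_annih_isSymm g) (hleave g) z
  have h : ClusterNoise P D.stackCluster fun ω => Sum.elim (U ω) (V ω) :=
    clusterNoise_stack hU hV
      (fun j => memLp_four_of_integrable_rpow ((measurable_pi_apply j).comp hU) hq (hUi j))
      (fun j => memLp_four_of_integrable_rpow ((measurable_pi_apply j).comp hV) hq (hVi j))
      hU0 hV0 hindep
  have hu0 := pos_of_crossMoment_stack_bounds hG hsize h hc0 hcov
  have hB := blockBound_B hr hcM hM
  have hB' := blockBound_B_transpose hr hcM hM
  have ha : 2 * (D.hNorm ^ 2 + (cM ^ 2)⁻¹ * D.hNorm ^ 2) = opConst cM * D.hNorm ^ 2 := by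
    rw [opConst]
    ring
  rw [ha] at hB hB'
  have hh := hNorm_pos hr hA
  have hoc := opConst_pos hcM
  have hl := lam_nonneg (D := D)
  have hκ := kappa_pos hr hA
  have hm : 0 ≤ D.muSq + D.mutSq :=
    add_nonneg (dotProduct_self_nonneg' _) (dotProduct_self_nonneg' _)
  have hfrob : frobSq (stackMatrix D.B) = 2 * (D.hNorm ^ 2 * D.kappa) := by
    rw [frobSq_stackMatrix, kappa_mul hr hA]
  have hbb : Sum.elim (D.hNorm • D.H) (D.hNorm • D.Ht) ⬝ᵥ Sum.elim (D.hNorm • D.H) (D.hNorm • D.Ht)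
      = D.hNorm ^ 2 * (D.muSq + D.mutSq) := by
    rw [sumElim_dotProduct_sumElim, smul_dotProduct, dotProduct_smul, smul_dotProduct,
      dotProduct_smul, muSq, mutSq]
    simp only [smul_eq_mul]
    ring
  -- The linear part contributes a factor `c`, the quadratic part `c²`; the `½` is offset by `‖K‖_F²
  -- = 2‖B‖_F²`.
  have hω : D.hNorm ^ 2 * (min c (c ^ 2) * (D.muSq + D.mutSq + D.kappa)) ≤ omegaSq P U V := by
    have h1 := ClusterNoise.le_integral_steinVar h hc0.le
      (fun z => (crossMoment_stack_bounds h hcov z).1) (stackMatrix_isSymm D.B)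
      (Sum.elim (D.hNorm • D.H) (D.hNorm • D.Ht))
    rw [← omegaSq_eq h, hfrob, hbb] at h1
    have h2 : min c (c ^ 2) * (D.muSq + D.mutSq) ≤ c * (D.muSq + D.mutSq) := by
      gcongr
      exact min_le_left _ _
    have h3 : min c (c ^ 2) * D.kappa ≤ c ^ 2 * D.kappa := by
      gcongr
      exact (min_le_right _ _)
    nlinarith [mul_le_mul_of_nonneg_left (add_le_add h2 h3) (sq_nonneg D.hNorm)]
  have hcmin : 0 < min c (c ^ 2) := lt_min hc0 (by positivity)
  have hω0 : 0 < omegaSq P U V := lt_of_lt_of_le (by positivity) hω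
  have hσ4 : √(omegaSq P U V) ^ 4 = omegaSq P U V ^ 2 := by
    rw [show (4 : ℕ) = 2 * 2 from rfl, pow_mul, Real.sq_sqrt hω0.le]
  have hfin : D.hNorm ^ 4 * (rateConst cM q C * D.rateLHS q u)
      ≤ δ ^ 2 * √(omegaSq P U V) ^ 4 := by
    rw [hσ4]
    calc D.hNorm ^ 4 * (rateConst cM q C * D.rateLHS q u)
        ≤ D.hNorm ^ 4 * (δ ^ 2 * (min c (c ^ 2) * (D.muSq + D.mutSq + D.kappa)) ^ 2) := by
          gcongr
      _ = δ ^ 2 * (D.hNorm ^ 2 * (min c (c ^ 2) * (D.muSq + D.mutSq + D.kappa))) ^ 2 := by ring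
      _ ≤ _ := by gcongr
  have hC1 : 0 < max C 1 := lt_max_of_lt_right one_pos
  have hN : 0 < D.nMax := (hsize ⟨0, hG⟩).trans_le (size_le_nMax _)
  have hε : ∀ j, Integrable (fun ω => |Sum.elim (U ω) (V ω) j| ^ (2 * q)) P := by
    rintro (j | j)
    · exact hUi j
    · exact hVi j
  have hUpos : ∀ j, 0 ≤ ∫ ω, |U ω j| ^ (2 * q) ∂P := fun j =>
    integral_nonneg fun ω => by positivity
  have hVpos : ∀ j, 0 ≤ ∫ ω, |V ω j| ^ (2 * q) ∂P := fun j =>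
    integral_nonneg fun ω => by positivity
  have hεb : ∀ j, ∫ ω, |Sum.elim (U ω) (V ω) j| ^ (2 * q) ∂P ≤ max C 1 := by
    rintro (j | j)
    · have h1 : ∫ ω, |U ω j| ^ (2 * q) ∂P ≤ C := by linarith [hmom j, hVpos j]
      exact le_max_of_le_left h1
    · have h1 : ∫ ω, |V ω j| ^ (2 * q) ∂P ≤ C := by linarith [hmom j, hUpos j]
      exact le_max_of_le_left h1
  have hq1 : 0 < q - 1 := by linarith
  -- A stacked cluster has up to `2 n_G` coordinates, hence the power of 2 in `momentConst`; `max C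
  -- 1` keeps the interpolation constant positive.
  have hφeq : u ^ ((q - 2) / (q - 1)) * (((2 * D.nMax : ℕ) : ℝ) ^ q * max C 1) ^ (1 / (q - 1))
      = momentConst q C * D.momentRate q u := by
    rw [Real.mul_rpow (by positivity) hC1.le, ← Real.rpow_mul (by positivity), mul_one_div,
      Nat.cast_mul, Real.mul_rpow (by positivity) (by positivity), momentConst, momentRate]
    push_cast
    ring
  have hφ : ∀ g, ∀ y : D.Obs ⊕ D.Obs → ℝ,
      ∫ ω, (y ⬝ᵥ clusterPart D.stackCluster g (Sum.elim (U ω) (V ω))) ^ 2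
        * (clusterPart D.stackCluster g (Sum.elim (U ω) (V ω))
          ⬝ᵥ clusterPart D.stackCluster g (Sum.elim (U ω) (V ω))) ∂P
      ≤ momentConst q C * D.momentRate q u * (y ⬝ᵥ y) := fun g y => by
    obtain ⟨h1, h2⟩ := ClusterNoise.integral_clusterPart_rpow_le (cl := D.stackCluster) h.measurable
      (by linarith : (1 : ℝ) ≤ q) hC1.le hε hεb g (N := 2 * D.nMax) (by omega)
      (card_stackCluster_le g)
    rw [← hφeq]
    exact ClusterNoise.integral_sq_mul_le_of_rpow h hu0 hq (by positivity)
      (fun z => (crossMoment_stack_bounds h hcov z).2) g h1 h2 y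
  obtain ⟨hT1, hT2⟩ := approx_terms_le (D := D) (C := C) hq hu0 hcM
  have hmr := momentRate_nonneg (D := D) (q := q) hu0
  have hmc := momentConst_pos q C
  have key := ClusterNoise.norm_integral_exp_div_sub_le h hu0
    (fun z => (crossMoment_stack_bounds h hcov z).2)
    (mul_nonneg hmc.le hmr) hφ
    (stackMatrix_isSymm D.B) (isHollow_stackMatrix (isHollow_B hcM hM)) (by positivity)
    (by positivity) (by positivity) (stackMatrix_mulVec_sq_le hB hB')
    (stackMatrix_mulVec_clusterPart_sq_le hB hB')
    (clusterPart_stackMatrix_mulVec_clusterPart_sq_le hB hB')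
    (Sum.elim (D.hNorm • D.H) (D.hNorm • D.Ht)) (Real.sqrt_pos.2 hω0) hδ
    (by rw [Real.sq_sqrt hω0.le, omegaSq_eq h])
    (by
      rw [hfrob, hbb]
      refine le_trans ?_ ((mul_le_mul_of_nonneg_left hT1 (by positivity)).trans hfin)
      exact le_of_eq (by ring))
    (by
      rw [hfrob]
      refine le_trans ?_ ((mul_le_mul_of_nonneg_left hT2 (by positivity)).trans hfin)
      have := mul_le_mul_of_nonneg_left (sum_clusterPart_stack_sq_le D.hNorm D.H D.Ht)
        (mul_nonneg hmc.le hmr)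
      change _ ≤ _ * (2 * D.hNorm ^ 4 * (D.zetaH * D.muSq + D.zetaHt * D.mutSq)) at this
      linarith) t
  simp only [linQuad_stack] at key
  simp only [thetaLO_sub_theta hr hA hcM hM]
  exact key

end ClusterDesign

theorem mainTheorem1
    (D : ℕ → ClusterDesign) {Ω : ℕ → Type*} [∀ m, MeasurableSpace (Ω m)]
    (P : ∀ m, Measure (Ω m)) [∀ m, IsProbabilityMeasure (P m)]
    (X Y U V : ∀ m, Ω m → (D m).Obs → ℝ)
    -- nonempty clusters, full column rank of `W`, and `h_n ≠ 0`
    (hsize : ∀ m g, 0 < (D m).size g)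
    (hrank : ∀ m, IsUnit (D m).gram)
    (hA₀ : ∀ m, (D m).A₀ ≠ 0)
    -- the two regressions; errors mean zero and independent across clusters
    (hY : ∀ m ω, Y m ω = (D m).W *ᵥ (D m).coefY + U m ω)
    (hX : ∀ m ω, X m ω = (D m).W *ᵥ (D m).coefX + V m ω)
    (hU_meas : ∀ m, Measurable (U m)) (hV_meas : ∀ m, Measurable (V m))
    (hU_mean : ∀ m j, ∫ ω, U m ω j ∂(P m) = 0)
    (hV_mean : ∀ m j, ∫ ω, V m ω j ∂(P m) = 0)
    (hindep : ∀ m, iIndepFun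
      (fun (g : Fin (D m).G) (ω : Ω m) =>
        (ClusterDesign.seg (U m ω) g, ClusterDesign.seg (V m ω) g)) (P m))
    -- `λ_min (M_{g,g}) ≥ cM`
    (cM : ℝ) (hcM : 0 < cM)
    (hleave : ∀ m g, ∀ x ∈ spectrum ℝ (ClusterDesign.block (D m).annih g g), cM ≤ x)
    -- bounded moments of order `2q`
    (q C : ℝ) (hq : 2 ≤ q)
    (hU_int : ∀ m j, Integrable (fun ω => |U m ω j| ^ (2 * q)) (P m))
    (hV_int : ∀ m j, Integrable (fun ω => |V m ω j| ^ (2 * q)) (P m))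
    (hmom : ∀ m j,
      (∫ ω, |U m ω j| ^ (2 * q) ∂(P m)) + (∫ ω, |V m ω j| ^ (2 * q) ∂(P m)) ≤ C)
    -- `cΩ ≤ λ_min (Ω_g) ≤ λ_max (Ω_g) ≤ u_n`
    (cΩ : ℝ) (hcΩ : 0 < cΩ) (u : ℕ → ℝ)
    (hcov : ∀ m g, ∀ x ∈ spectrum ℝ (ClusterDesign.covFull (P m) (U m) (V m) g),
      cΩ ≤ x ∧ x ≤ u m)
    -- bounded signal, growing number of clusters, rate condition
    (hsignal : ∃ K : ℝ, ∀ m,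
      ClusterDesign.maxSegSq (D m).sigX + ClusterDesign.maxSegSq (D m).sigY ≤ K * (D m).nMax)
    (hG : Tendsto (fun m => (D m).G) atTop atTop)
    (hrate : (fun m => (D m).rateLHS q (u m)) =o[atTop]
      fun m => ((D m).muSq + (D m).mutSq + (D m).kappa) ^ 2) :
    TendstoInDistribution
      (fun m ω => ((D m).thetaLO (X m ω) (Y m ω) - (D m).theta)
        / √(ClusterDesign.omegaSq (P m) (U m) (V m)))
      atTop id P (gaussianReal 0 1) := by
  have hm : ∀ m, Measurable fun ω => ((D m).thetaLO (X m ω) (Y m ω) - (D m).theta)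
      / √(ClusterDesign.omegaSq (P m) (U m) (V m)) := fun m => by
    have hX' : Measurable (X m) := by
      rw [show X m = fun ω => (D m).W *ᵥ (D m).coefX + V m ω from funext (hX m)]
      exact measurable_const.add (hV_meas m)
    have hY' : Measurable (Y m) := by
      rw [show Y m = fun ω => (D m).W *ᵥ (D m).coefY + U m ω from funext (hY m)]
      exact measurable_const.add (hU_meas m)
    have hM : ∀ g, ∀ z, cM * (z ⬝ᵥ z) ≤ z ⬝ᵥ ClusterDesign.block (D m).annih g g *ᵥ z := fun g z =>
      le_quadForm_of_le_spectrum (ClusterDesign.block_annih_isSymm g) (hleave m g) z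
    simp only [ClusterDesign.thetaLO_eq (hrank m) hcM hM]
    have hc : Continuous fun p : ((D m).Obs → ℝ) × ((D m).Obs → ℝ) => p.1 ⬝ᵥ (D m).B *ᵥ p.2 := by
      fun_prop
    exact ((hc.measurable.comp (hX'.prodMk hY')).sub_const _).div_const _
  refine ⟨fun m => (hm m).aemeasurable, aemeasurable_id, ?_⟩
  -- Lévy's continuity theorem: pointwise convergence of characteristic functions suffices, so `t`
  -- is fixed from here on and the error may depend on it.
  refine ProbabilityMeasure.tendsto_of_tendsto_charFun fun t => ?_
  have hlim : charFun ((gaussianReal 0 1).map id) t = Real.exp (-t ^ 2 / 2) := by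
    rw [Measure.map_id, charFun_gaussianReal]
    push_cast
    congr 1
    ring
  have hchar : ∀ m, charFun ((P m).map fun ω => ((D m).thetaLO (X m ω) (Y m ω) - (D m).theta)
      / √(ClusterDesign.omegaSq (P m) (U m) (V m))) t
      = ∫ ω, Complex.exp ((t * (((D m).thetaLO ((D m).W *ᵥ (D m).coefX + V m ω)
          ((D m).W *ᵥ (D m).coefY + U m ω) - (D m).theta)
        / √(ClusterDesign.omegaSq (P m) (U m) (V m))) : ℝ) * Complex.I) ∂(P m) := fun m => by
    rw [charFun_apply_real, integral_map (hm m).aemeasurable (by fun_prop)]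
    simp only [hX, hY]
    push_cast
    rfl
  change Tendsto (fun m => charFun ((P m).map fun ω =>
      ((D m).thetaLO (X m ω) (Y m ω) - (D m).theta)
        / √(ClusterDesign.omegaSq (P m) (U m) (V m))) t) atTop
    (𝓝 (charFun ((gaussianReal 0 1).map id) t))
  simp only [hlim, hchar]
  rw [Metric.tendsto_nhds]
  intro e he
  -- The added 1 keeps `a` positive at `t = 0`, so that `δ = e/(2a)` is defined and the final error
  -- is at most `e/2`.
  set a : ℝ := Real.exp (t ^ 2 / 2) * (|t| + 3 * t ^ 2) * |t| + 1 with ha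
  have ha0 : 0 < a := by positivity
  set δ : ℝ := e / (2 * a) with hδ
  have hδ0 : 0 < δ := by positivity
  have hk0 : 0 < ClusterDesign.rateConst cM q C + 1 := by
    have h1 := ClusterDesign.momentConst_pos q C
    have h2 := ClusterDesign.opConst_pos hcM
    unfold ClusterDesign.rateConst
    positivity
  have hcmin : 0 < min cΩ (cΩ ^ 2) := lt_min hcΩ (by positivity)
  -- The constant at which the little-o condition is used: it absorbs `rateConst` and the lower
  -- bound on `ω⁴`.
  have hρ : 0 < δ ^ 2 * min cΩ (cΩ ^ 2) ^ 2 / (ClusterDesign.rateConst cM q C + 1) := by positivity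
  -- `G ≥ 1` guarantees a nonempty sample, which the single-design bound needs for `u > 0` and `n_G
  -- > 0`.
  filter_upwards [hrate.def hρ, hG.eventually_ge_atTop 1] with m h1 h2
  have h3 : (D m).rateLHS q (u m) ≤ δ ^ 2 * min cΩ (cΩ ^ 2) ^ 2
      / (ClusterDesign.rateConst cM q C + 1)
      * ((D m).muSq + (D m).mutSq + (D m).kappa) ^ 2 := by
    refine (Real.le_norm_self _).trans (h1.trans_eq ?_)
    rw [Real.norm_of_nonneg (sq_nonneg _)]
  have hk1 : 0 ≤ ClusterDesign.rateConst cM q C := by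
    have h1 := ClusterDesign.momentConst_pos q C
    have h2 := ClusterDesign.opConst_pos hcM
    unfold ClusterDesign.rateConst
    positivity
  have h4 : ClusterDesign.rateConst cM q C * (D m).rateLHS q (u m)
      ≤ δ ^ 2 * (min cΩ (cΩ ^ 2) * ((D m).muSq + (D m).mutSq + (D m).kappa)) ^ 2 := by
    refine (mul_le_mul_of_nonneg_left h3 hk1).trans ?_
    rw [div_mul_eq_mul_div, mul_div_assoc', div_le_iff₀ hk0]
    have : 0 ≤ δ ^ 2 * (min cΩ (cΩ ^ 2) * ((D m).muSq + (D m).mutSq + (D m).kappa)) ^ 2 := by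
      positivity
    nlinarith
  have h5 := ClusterDesign.norm_integral_exp_thetaLO_le h2 (hsize m) (hrank m) (hA₀ m) (hU_meas m)
    (hV_meas m) (hU_mean m) (hV_mean m) (hindep m) hcM (hleave m) hq (hU_int m) (hV_int m) (hmom m)
    hcΩ (hcov m) hδ0 h4 t
  rw [dist_eq_norm]
  refine h5.trans_lt ?_
  calc Real.exp (t ^ 2 / 2) * ((|t| + 3 * t ^ 2) * δ) * |t| = (a - 1) * δ := by rw [ha]; ring
    _ ≤ a * δ := by nlinarith
    _ = e / 2 := by rw [hδ]; field_simp
    _ < e := by linarith
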